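/- Let $R$ be a ring with identity, not necessarily commutative, and let $K(R)$ be the homotopy category of (unbounded) complexes of left $R$-modules, with its usual triangulated structure. A complex $W$ of left $R$-modules is *pure acyclic* if $M\otimes_R W$ is acyclic for every right $R$-module $M$, and *K-flat* if the total tensor product complex $E\otimes_R W$ is acyclic for every acyclic complex $E$ of right $R$-modules. A monomorphism of left $R$-modules is *pure* if it remains injective after applying $M\otimes_R-$ for every right $R$-module $M$, and a left $R$-module is *pure-injective* if it is injective relative to all pure monomorphisms. Denote by - $\mathcal D_{pur}(R)$ the Verdier quotient of $K(R)$ by the pure acyclic complexes (the pure derived category), - $\mathcal D_{\text{K-flat}}(R)$ the Verdier quotient of $K(R)$ by the K-flat complexes (the K-flat derived category), - $\mathcal D(R)$ the usual derived category of left $R$-modules, - $K(\mathcal{PI})\subseteq K(R)$ the full subcategory of all complexes homotopy equivalent to a complex with pure-injective components, and $K_{ac}(\mathcal{PI})\subseteq K(\mathcal{PI})$ the full subcategory of those that are moreover acyclic. A triangulated category is *compactly generated* if it has small Hom-sets and all set-indexed coproducts, and there is a set $\mathcal G$ of compact objects (objects $G$ such that $\mathrm{Hom}(G,-)$ commutes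 with set-indexed coproducts) such that any $X$ with $\mathrm{Hom}(G,X[n])=0$ for all $G\in\mathcal G$ and $n\in\mathbb Z$ is zero. A *recollement* $\mathcal T'\xrightarrow{i}\mathcal T\xrightarrow{j}\mathcal T''$ consists of triangulated functors $i,j$ between triangulated categories such that $i$ is fully faithful and has a left and a right adjoint, $j$ has a fully faithful left adjoint and a fully faithful right adjoint, and an object $X$ of $\mathcal T$ satisfies $j(X)=0$ if and only if $X\cong i(Y)$ for some $Y$ in $\mathcal T'$. **Theorem.** The triangulated categories $\mathcal D_{\text{K-flat}}(R)$, $\mathcal D_{pur}(R)$ and $\mathcal D(R)$ are compactly generated, and there is a recollement $$\mathcal D_{\text{K-flat}}(R)\xrightarrow{\ i\ }\mathcal D_{pur}(R)\xrightarrow{\ j\ }\mathcal D(R)$$ in which $j$ is the canonical functor, that is, its composite with the quotient functor $K(R)\to\mathcal D_{pur}(R)$ is isomorphic to the quotient functor $K(R)\to\mathcal D(R)$. Moreover, the composites $$K_{ac}(\mathcal{PI})\hookrightarrow K(R)\to\mathcal D_{\text{K-flat}}(R)\qquad\text{and}\qquad K(\mathcal{PI})\hookrightarrow K(R)\to\mathcal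 D_{pur}(R)$$ are equivalences; under these equivalences $i$ corresponds, up to natural isomorphism, to the inclusion $K_{ac}(\mathcal{PI})\hookrightarrow K(\mathcal{PI})$; and the inclusion together with the canonical functor $K(\mathcal{PI})\hookrightarrow K(R)\to\mathcal D(R)$ is a recollement $$K_{ac}(\mathcal{PI})\to K(\mathcal{PI})\to\mathcal D(R).$$ (The natural isomorphisms are compatible with the shift functors.) In particular, the Verdier quotient $K(R)/\text{K-Flat}=\mathcal D_{\text{K-flat}}(R)$ is compactly generated. -/

import Mathlib

open CategoryTheory Limits Pretriangulated Opposite ZeroObject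

universe w u

noncomputable section

namespace KFlatDer

/-! ### Tensor product of a right module and a left module over an arbitrary ring -/

section Tensor

open TensorProduct

variable (R : Type u) [Ring R]

/-- The subgroup of `M ⊗_ℤ N` generated by the elements `(m r) ⊗ n - m ⊗ (r n)`,
for a right `R`-module `M` (a left module over the opposite ring) and a left `R`-module `N`. -/
def balancing (M : ModuleCat.{u} Rᵐᵒᵖ) (N : ModuleCat.{u} R) : AddSubgroup (M ⊗[ℤ] N) :=
  AddSubgroup.closure
    {t | ∃ (m : M) (r : R) (n : N), t = (MulOpposite.op r • m) ⊗ₜ[ℤ] n - m ⊗ₜ[ℤ] (r • n)}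

/-- The abelian group `M ⊗_R N`. -/
abbrev TensorOver (M : ModuleCat.{u} Rᵐᵒᵖ) (N : ModuleCat.{u} R) : Type u :=
  (M ⊗[ℤ] N) ⧸ balancing R M N

variable {R}

/-- The map `f ⊗ g : M ⊗_R N → M' ⊗_R N'`. -/
def tensorMap {M M' : ModuleCat.{u} Rᵐᵒᵖ} {N N' : ModuleCat.{u} R} (f : M ⟶ M') (g : N ⟶ N') :
    TensorOver R M N →+ TensorOver R M' N' :=
  QuotientAddGroup.map _ _
    (TensorProduct.map f.hom.toAddMonoidHom.toIntLinearMap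
      g.hom.toAddMonoidHom.toIntLinearMap).toAddMonoidHom <| by
      rw [balancing, AddSubgroup.closure_le]
      rintro _ ⟨m, r, n, rfl⟩
      refine AddSubgroup.subset_closure ⟨f.hom m, r, g.hom n, ?_⟩
      have h₁ : f.hom (MulOpposite.op r • m) = MulOpposite.op r • f.hom m := map_smul _ _ _
      have h₂ : g.hom (r • n) = r • g.hom n := map_smul _ _ _
      rw [← h₁, ← h₂, map_sub]
      rfl

lemma tensorMap_mk {M M' : ModuleCat.{u} Rᵐᵒᵖ} {N N' : ModuleCat.{u} R}
    (f : M ⟶ M') (g : N ⟶ N') (m : M) (n : N) :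
    tensorMap f g (QuotientAddGroup.mk (m ⊗ₜ[ℤ] n)) =
      QuotientAddGroup.mk (f.hom m ⊗ₜ[ℤ] g.hom n) := rfl

lemma tensor_hom_ext {M : ModuleCat.{u} Rᵐᵒᵖ} {N : ModuleCat.{u} R}
    {A : Type u} [AddCommGroup A] {a b : TensorOver R M N →+ A}
    (h : ∀ (m : M) (n : N), a (QuotientAddGroup.mk (m ⊗ₜ[ℤ] n)) =
      b (QuotientAddGroup.mk (m ⊗ₜ[ℤ] n))) : a = b := by
  refine QuotientAddGroup.addMonoidHom_ext _ ?_
  ext x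
  induction x with
  | zero => simp
  | add x y hx hy => rw [map_add, map_add, hx, hy]
  | tmul m n => exact h m n

variable (R)

/-- The functor `M ⊗_R -` from left `R`-modules to abelian groups. -/
def tensorLeft (M : ModuleCat.{u} Rᵐᵒᵖ) : ModuleCat.{u} R ⥤ AddCommGrpCat.{u} where
  obj N := AddCommGrpCat.of (TensorOver R M N)
  map g := AddCommGrpCat.ofHom (tensorMap (𝟙 M) g)
  map_id _ := AddCommGrpCat.hom_ext (tensor_hom_ext fun _ _ => rfl)
  map_comp _ _ := AddCommGrpCat.hom_ext (tensor_hom_ext fun _ _ => rfl)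

/-- The bifunctor `- ⊗_R -` from right and left `R`-modules to abelian groups. -/
def tensor : ModuleCat.{u} Rᵐᵒᵖ ⥤ ModuleCat.{u} R ⥤ AddCommGrpCat.{u} where
  obj M := tensorLeft R M
  map f :=
    { app N := AddCommGrpCat.ofHom (tensorMap f (𝟙 N))
      naturality _ _ _ := AddCommGrpCat.hom_ext (tensor_hom_ext fun _ _ => rfl) }
  map_id _ := NatTrans.ext (funext fun _ => AddCommGrpCat.hom_ext (tensor_hom_ext fun _ _ => rfl))
  map_comp _ _ :=
    NatTrans.ext (funext fun _ => AddCommGrpCat.hom_ext (tensor_hom_ext fun _ _ => rfl))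

instance (M : ModuleCat.{u} Rᵐᵒᵖ) : ((tensor R).obj M).Additive where
  map_add {_ N'} g g' := AddCommGrpCat.hom_ext <| tensor_hom_ext fun m n =>
    congrArg (QuotientAddGroup.mk (s := balancing R M N'))
      (TensorProduct.tmul_add m (g.hom n) (g'.hom n))

instance : (tensor R).Additive where
  map_add {_ M'} f f' := NatTrans.ext <| funext fun N => AddCommGrpCat.hom_ext <|
    tensor_hom_ext fun m n => congrArg (QuotientAddGroup.mk (s := balancing R M' N))
      (TensorProduct.add_tmul (f.hom m) (f'.hom m) n)

end Tensor

/-! ### Classes of modules and complexes -/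

section Classes

variable (R : Type u) [Ring R]

/-- A pure monomorphism of left `R`-modules: it stays injective after tensoring with any right
`R`-module (in particular with `R`, so it is injective itself). -/
def IsPureMono {A B : ModuleCat.{u} R} (f : A ⟶ B) : Prop :=
  ∀ M : ModuleCat.{u} Rᵐᵒᵖ, Function.Injective (((tensor R).obj M).map f).hom

/-- A pure-injective left `R`-module: it is injective relative to all pure monomorphisms. -/
def IsPureInjective (I : ModuleCat.{u} R) : Prop :=
  ∀ ⦃A B : ModuleCat.{u} R⦄ (f : A ⟶ B), IsPureMono R f →
    ∀ g : A ⟶ I, ∃ h : B ⟶ I, f ≫ h = g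

/-- The total tensor product `E ⊗_R X` of a complex `E` of right modules and a complex `X` of left
modules: in degree `n` it is the direct sum of the `E_p ⊗_R X_q` with `p + q = n`, with differential
`d (e ⊗ x) = d e ⊗ x + (-1) ^ p e ⊗ d x`. -/
abbrev tensorComplex : CochainComplex (ModuleCat.{u} Rᵐᵒᵖ) ℤ ⥤ CochainComplex (ModuleCat.{u} R) ℤ ⥤
    CochainComplex AddCommGrpCat.{u} ℤ :=
  (tensor R).map₂CochainComplex

/-- The complex `X` of left `R`-modules is pure acyclic: `M ⊗_R X` is acyclic for every right
`R`-module `M`. -/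
def IsPureAcyclic (X : CochainComplex (ModuleCat.{u} R) ℤ) : Prop :=
  ∀ M : ModuleCat.{u} Rᵐᵒᵖ,
    ((((tensor R).obj M).mapHomologicalComplex (ComplexShape.up ℤ)).obj X).Acyclic

/-- The complex `X` of left `R`-modules is K-flat: `E ⊗_R X` is acyclic for every acyclic complex
`E` of right `R`-modules. -/
def IsKFlat (X : CochainComplex (ModuleCat.{u} R) ℤ) : Prop :=
  ∀ E : CochainComplex (ModuleCat.{u} Rᵐᵒᵖ) ℤ, E.Acyclic → (((tensorComplex R).obj E).obj X).Acyclic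

/-- The homotopy category `K(R)` of complexes of left `R`-modules. -/
abbrev K : Type (u + 1) := HomotopyCategory (ModuleCat.{u} R) (ComplexShape.up ℤ)

/-- The pure acyclic complexes, in `K(R)`. -/
def pureAcyclic : ObjectProperty (K R) := fun X => IsPureAcyclic R X.as

/-- The K-flat complexes, in `K(R)`. -/
def kFlat : ObjectProperty (K R) := fun X => IsKFlat R X.as

/-- The complexes all of whose components are pure-injective, in `K(R)`. -/
def dwPureInjective : ObjectProperty (K R) := fun X => ∀ n : ℤ, IsPureInjective R (X.as.X n)

/-! These classes are triangulated subcategories of `K(R)`. -/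

variable {R}

/-- Stability under mapping cones in `Ch(R)` gives stability under cones in `K(R)`. -/
lemma isTriangulated_of_mappingCone {A : Type*} [Category* A] [Preadditive A] [HasZeroObject A]
    [HasBinaryBiproducts A] (P : CochainComplex A ℤ → Prop)
    (zero : ∀ X, IsZero X → P X) (shift : ∀ X (n : ℤ), P X → P (X⟦n⟧))
    (cone : ∀ (X Y : CochainComplex A ℤ) (f : X ⟶ Y), P X → P Y →
      P (CochainComplex.mappingCone f)) :
    ObjectProperty.IsTriangulated
      (fun X : HomotopyCategory A (ComplexShape.up ℤ) => P X.as) := by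
  let Q : ObjectProperty (HomotopyCategory A (ComplexShape.up ℤ)) := fun X => P X.as
  have h0 : Q.ContainsZero :=
    { exists_zero := ⟨(HomotopyCategory.quotient _ _).obj (0 : CochainComplex A ℤ),
        Functor.map_isZero _ (isZero_zero _), zero _ (isZero_zero _)⟩ }
  have hs : Q.IsStableUnderShift ℤ :=
    { isStableUnderShiftBy n :=
        { le_shift X hX := by
            obtain ⟨X, rfl⟩ := HomotopyCategory.quotient_obj_surjective X
            rw [ObjectProperty.prop_shift_iff, HomotopyCategory.shift_quotient_obj]
            exact shift X n hX } }
  have h3 : Q.IsTriangulatedClosed₃ :=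
    { ext₃' T hT h₁ h₂ := by
        obtain ⟨f : T.obj₁.as ⟶ T.obj₂.as, hf⟩ :=
          (HomotopyCategory.quotient _ _).map_surjective T.mor₁
        refine ⟨(HomotopyCategory.quotient _ _).obj (CochainComplex.mappingCone f), ?_,
          ⟨Triangle.π₃.mapIso (isoTriangleOfIso₁₂ T _ hT
            (HomotopyCategory.mappingCone_triangleh_distinguished f)
            (Iso.refl _) (Iso.refl _) ?_)⟩⟩
        · exact cone _ _ f h₁ h₂
        · exact (Category.comp_id _).trans (hf.symm.trans (Category.id_comp _).symm) }
  exact { toIsTriangulatedClosed₂ := .of_isTriangulatedClosed₃ }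

lemma acyclic_of_isZero {A : Type*} [Category* A] [Abelian A] {X : CochainComplex A ℤ}
    (hX : IsZero X) : X.Acyclic := fun n =>
  ShortComplex.exact_of_isZero_X₂ _ ((HomologicalComplex.eval A _ n).map_isZero hX)

lemma acyclic_of_iso {A : Type*} [Category* A] [Abelian A] {X Y : CochainComplex A ℤ}
    (e : X ≅ Y) (hX : X.Acyclic) : Y.Acyclic := fun n => (hX n).of_iso e

lemma acyclic_shift {A : Type*} [Category* A] [Abelian A] {X : CochainComplex A ℤ}
    (hX : X.Acyclic) (n : ℤ) : (X⟦n⟧).Acyclic := by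
  rw [← HomotopyCategory.quotient_obj_mem_subcategoryAcyclic_iff_acyclic] at hX ⊢
  rw [← HomotopyCategory.shift_quotient_obj]
  exact (HomotopyCategory.subcategoryAcyclic A).le_shift n _ hX

lemma acyclic_mappingCone {A : Type*} [Category* A] [Abelian A] {X Y : CochainComplex A ℤ}
    (f : X ⟶ Y) (hX : X.Acyclic) (hY : Y.Acyclic) : (CochainComplex.mappingCone f).Acyclic := by
  rw [← HomotopyCategory.quotient_obj_mem_subcategoryAcyclic_iff_acyclic] at hX hY ⊢
  exact (HomotopyCategory.subcategoryAcyclic A).ext_of_isTriangulatedClosed₃ _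
    (HomotopyCategory.mappingCone_triangleh_distinguished f) hX hY

instance : (pureAcyclic R).IsTriangulated := by
  refine isTriangulated_of_mappingCone (IsPureAcyclic R) (fun X hX M => ?_)
    (fun X n hX M => ?_) (fun X Y f hX hY M => ?_)
  · exact acyclic_of_isZero (Functor.map_isZero _ hX)
  · exact acyclic_of_iso
      (((((tensor R).obj M).mapHomologicalComplex (ComplexShape.up ℤ)).commShiftIso n).app X).symm
      (acyclic_shift (hX M) n)
  · exact acyclic_of_iso (CochainComplex.mappingCone.mapHomologicalComplexIso f _).symm
      (acyclic_mappingCone _ (hX M) (hY M))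

/-- The map in degree `n` from `E ⊗_R X` to `E ⊗_R Y` induced by a family of maps between the
components, which need not commute with the differentials. -/
def gradedMap (E : CochainComplex (ModuleCat.{u} Rᵐᵒᵖ) ℤ) {X Y : CochainComplex (ModuleCat.{u} R) ℤ}
    (φ : ∀ q, X.X q ⟶ Y.X q) (n : ℤ) :
    (HomologicalComplex.mapBifunctor E X (tensor R) (ComplexShape.up ℤ)).X n ⟶
      (HomologicalComplex.mapBifunctor E Y (tensor R) (ComplexShape.up ℤ)).X n :=
  HomologicalComplex.mapBifunctorDesc fun p q h =>
    ((tensor R).obj (E.X p)).map (φ q) ≫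
      HomologicalComplex.ιMapBifunctor E Y (tensor R) (ComplexShape.up ℤ) p q n h

lemma ι_gradedMap (E : CochainComplex (ModuleCat.{u} Rᵐᵒᵖ) ℤ)
    {X Y : CochainComplex (ModuleCat.{u} R) ℤ} (φ : ∀ q, X.X q ⟶ Y.X q) (n p q : ℤ)
    (h : ComplexShape.π (ComplexShape.up ℤ) (ComplexShape.up ℤ) (ComplexShape.up ℤ) (p, q) = n) :
    HomologicalComplex.ιMapBifunctor E X (tensor R) (ComplexShape.up ℤ) p q n h ≫ gradedMap E φ n =
      ((tensor R).obj (E.X p)).map (φ q) ≫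
        HomologicalComplex.ιMapBifunctor E Y (tensor R) (ComplexShape.up ℤ) p q n h :=
  HomologicalComplex.ι_mapBifunctorDesc _ _ _ _

lemma gradedMap_eq (E : CochainComplex (ModuleCat.{u} Rᵐᵒᵖ) ℤ)
    {X Y : CochainComplex (ModuleCat.{u} R) ℤ} (f : X ⟶ Y) (n : ℤ) :
    (HomologicalComplex.mapBifunctorMap (𝟙 E) f (tensor R) (ComplexShape.up ℤ)).f n = gradedMap E f.f n := by
  apply HomologicalComplex.mapBifunctor.hom_ext
  intro p q h
  rw [ι_gradedMap]
  refine (HomologicalComplex.ι_mapBifunctorMap _ _ _ _ _ _ _ _).trans ?_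
  rw [HomologicalComplex.id_f, (tensor R).map_id, NatTrans.id_app, Category.id_comp]

lemma gradedMap_id (E : CochainComplex (ModuleCat.{u} Rᵐᵒᵖ) ℤ)
    (X : CochainComplex (ModuleCat.{u} R) ℤ) (n : ℤ) :
    gradedMap E (fun q => 𝟙 (X.X q)) n = 𝟙 _ := by
  apply HomologicalComplex.mapBifunctor.hom_ext
  intro p q h
  rw [ι_gradedMap, CategoryTheory.Functor.map_id, Category.id_comp, Category.comp_id]

lemma gradedMap_comp (E : CochainComplex (ModuleCat.{u} Rᵐᵒᵖ) ℤ)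
    {X Y Z : CochainComplex (ModuleCat.{u} R) ℤ} (φ : ∀ q, X.X q ⟶ Y.X q)
    (ψ : ∀ q, Y.X q ⟶ Z.X q) (n : ℤ) :
    gradedMap E φ n ≫ gradedMap E ψ n = gradedMap E (fun q => φ q ≫ ψ q) n := by
  apply HomologicalComplex.mapBifunctor.hom_ext
  intro p q h
  rw [← Category.assoc, ι_gradedMap, ι_gradedMap, Category.assoc, ι_gradedMap,
    CategoryTheory.Functor.map_comp, Category.assoc]

lemma gradedMap_add (E : CochainComplex (ModuleCat.{u} Rᵐᵒᵖ) ℤ)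
    {X Y : CochainComplex (ModuleCat.{u} R) ℤ} (φ ψ : ∀ q, X.X q ⟶ Y.X q) (n : ℤ) :
    gradedMap E φ n + gradedMap E ψ n = gradedMap E (fun q => φ q + ψ q) n := by
  apply HomologicalComplex.mapBifunctor.hom_ext
  intro p q h
  rw [Preadditive.comp_add, ι_gradedMap, ι_gradedMap, ι_gradedMap, Functor.map_add,
    Preadditive.add_comp]

instance (E : CochainComplex (ModuleCat.{u} Rᵐᵒᵖ) ℤ) : ((tensorComplex R).obj E).Additive where
  map_add {X Y f g} := by
    ext n : 1
    exact (gradedMap_eq E (f + g) n).trans ((gradedMap_add E f.f g.f n).symm.trans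
      (congrArg₂ (· + ·) (gradedMap_eq E f n) (gradedMap_eq E g n)).symm)

/-- Tensoring with a fixed complex preserves degreewise split short exact sequences. -/
lemma tensorComplex_shortExact (E : CochainComplex (ModuleCat.{u} Rᵐᵒᵖ) ℤ)
    (S : ShortComplex (CochainComplex (ModuleCat.{u} R) ℤ))
    (σ : ∀ n, (S.map (HomologicalComplex.eval _ _ n)).Splitting) :
    (S.map ((tensorComplex R).obj E)).ShortExact := by
  let r : ∀ q, S.X₂.X q ⟶ S.X₁.X q := fun q => (σ q).r
  let s : ∀ q, S.X₃.X q ⟶ S.X₂.X q := fun q => (σ q).s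
  have f_r : ∀ q, S.f.f q ≫ r q = 𝟙 _ := fun q => (σ q).f_r
  have s_g : ∀ q, s q ≫ S.g.f q = 𝟙 _ := fun q => (σ q).s_g
  have id' : ∀ q, r q ≫ S.f.f q + S.g.f q ≫ s q = 𝟙 _ := fun q => (σ q).id
  refine HomologicalComplex.shortExact_of_degreewise_shortExact _ fun n => ?_
  refine ShortComplex.Splitting.shortExact
    { r := gradedMap E r n
      s := gradedMap E s n
      f_r := ?_
      s_g := ?_
      id := ?_ }
  · change (HomologicalComplex.mapBifunctorMap (𝟙 E) S.f (tensor R) (ComplexShape.up ℤ)).f n ≫ gradedMap E r n = 𝟙 _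
    rw [gradedMap_eq, gradedMap_comp, funext f_r, gradedMap_id]
  · change gradedMap E s n ≫ (HomologicalComplex.mapBifunctorMap (𝟙 E) S.g (tensor R) (ComplexShape.up ℤ)).f n = 𝟙 _
    rw [gradedMap_eq, gradedMap_comp, funext s_g, gradedMap_id]
  · change gradedMap E r n ≫ (HomologicalComplex.mapBifunctorMap (𝟙 E) S.f (tensor R) (ComplexShape.up ℤ)).f n +
      (HomologicalComplex.mapBifunctorMap (𝟙 E) S.g (tensor R) (ComplexShape.up ℤ)).f n ≫ gradedMap E s n = 𝟙 _
    rw [gradedMap_eq, gradedMap_eq, gradedMap_comp, gradedMap_comp, gradedMap_add, funext id',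
      gradedMap_id]

instance : (kFlat R).IsTriangulated := by
  have shift : ∀ (X : CochainComplex (ModuleCat.{u} R) ℤ) (n : ℤ), IsKFlat R X →
      IsKFlat R (X⟦n⟧) := fun X n hX E hE =>
    acyclic_of_iso (CochainComplex.mapBifunctorShift₂Iso E X (tensor R) n).symm
      (acyclic_shift (hX E hE) n)
  refine isTriangulated_of_mappingCone (IsKFlat R) (fun X hX E hE => ?_) shift
    (fun X Y f hX hY E hE => ?_)
  · exact acyclic_of_isZero (Functor.map_isZero _ hX)
  · exact (tensorComplex_shortExact E _
      (CochainComplex.mappingCone.triangleRotateShortComplexSplitting f)).acyclic_X₂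
      (hY E hE) (shift X 1 hX E hE)

lemma isPureInjective_of_splitting {S : ShortComplex (ModuleCat.{u} R)} (σ : S.Splitting)
    (h₁ : IsPureInjective R S.X₁) (h₃ : IsPureInjective R S.X₃) : IsPureInjective R S.X₂ := by
  intro A B a ha g
  obtain ⟨k₁, e₁⟩ := h₁ a ha (g ≫ σ.r)
  obtain ⟨k₃, e₃⟩ := h₃ a ha (g ≫ S.g)
  refine ⟨k₁ ≫ S.f + k₃ ≫ σ.s, ?_⟩
  rw [Preadditive.comp_add, reassoc_of% e₁, reassoc_of% e₃, ← Preadditive.comp_add, σ.id,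
    Category.comp_id]

instance : (dwPureInjective R).IsTriangulated := by
  refine isTriangulated_of_mappingCone (fun X => ∀ n : ℤ, IsPureInjective R (X.X n))
    (fun X hX n A B f hf g => ?_) (fun X m hX n => hX (n + m)) (fun X Y f hX hY n A B a ha g => ?_)
  · exact ⟨0, ((HomologicalComplex.eval _ _ n).map_isZero hX).eq_of_tgt _ _⟩
  · exact isPureInjective_of_splitting
      (CochainComplex.mappingCone.triangleRotateShortComplexSplitting f n) (hY n) (hX (n + 1)) a ha g

variable (R)

/-- The pure derived category `D_pur(R)`: the Verdier quotient of `K(R)` by the pure acyclic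
complexes. -/
abbrev DPur : Type (u + 1) := (pureAcyclic R).trW.Localization

/-- The K-flat derived category `D_{K-flat}(R)`: the Verdier quotient of `K(R)` by the K-flat
complexes. -/
abbrev DKFlat : Type (u + 1) := (kFlat R).trW.Localization

/-- The canonical functor `K(R) ⥤ D_pur(R)`. -/
abbrev QPur : K R ⥤ DPur R := (pureAcyclic R).trW.Q

/-- The canonical functor `K(R) ⥤ D_{K-flat}(R)`. -/
abbrev QKFlat : K R ⥤ DKFlat R := (kFlat R).trW.Q

/-- The complexes homotopy equivalent to a complex of pure-injective modules. -/
def kPI : ObjectProperty (K R) := (dwPureInjective R).isoClosure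

instance : (kPI R).IsTriangulated := inferInstanceAs (dwPureInjective R).isoClosure.IsTriangulated

/-- The acyclic complexes homotopy equivalent to a complex of pure-injective modules. -/
def kAcPI : ObjectProperty (K R) :=
  kPI R ⊓ HomotopyCategory.subcategoryAcyclic (ModuleCat.{u} R)

instance : (kAcPI R).IsTriangulated :=
  inferInstanceAs (kPI R ⊓ HomotopyCategory.subcategoryAcyclic (ModuleCat.{u} R)).IsTriangulated

/-- The category `K(PI)`. -/
abbrev KPI : Type (u + 1) := (kPI R).FullSubcategory

/-- The category `K_ac(PI)`. -/
abbrev KAcPI : Type (u + 1) := (kAcPI R).FullSubcategory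

/-- The inclusion of `K_ac(PI)` in `K(PI)`. -/
def inclAcPI : KAcPI R ⥤ KPI R := (kPI R).lift (kAcPI R).ι fun X => X.property.1

instance : (inclAcPI R).CommShift ℤ :=
  inferInstanceAs (((kPI R).lift (kAcPI R).ι fun X => X.property.1).CommShift ℤ)

end Classes

/-! ### Recollements and compact generation -/

section Triangulated

/-- A recollement `T' ⥤ T ⥤ T''` of triangulated categories: `i` and `j` are triangulated functors,
`i` is fully faithful with a left and a right adjoint, `j` has a fully faithful left adjoint and a
fully faithful right adjoint, and the kernel of `j` is the essential image of `i`. -/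
structure IsRecollement {T' T T'' : Type*} [Category* T'] [Category* T] [Category* T'']
    [HasZeroObject T'] [HasShift T' ℤ] [Preadditive T'] [∀ n : ℤ, (shiftFunctor T' n).Additive]
    [Pretriangulated T'] [IsTriangulated T']
    [HasZeroObject T] [HasShift T ℤ] [Preadditive T] [∀ n : ℤ, (shiftFunctor T n).Additive]
    [Pretriangulated T] [IsTriangulated T]
    [HasZeroObject T''] [HasShift T'' ℤ] [Preadditive T''] [∀ n : ℤ, (shiftFunctor T'' n).Additive]
    [Pretriangulated T''] [IsTriangulated T'']
    (i : T' ⥤ T) (j : T ⥤ T'') [i.CommShift ℤ] [j.CommShift ℤ] : Prop where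
  isTriangulated_i : i.IsTriangulated
  isTriangulated_j : j.IsTriangulated
  full_i : i.Full
  faithful_i : i.Faithful
  exists_leftAdjoint_i : ∃ iL : T ⥤ T', Nonempty (iL ⊣ i)
  exists_rightAdjoint_i : ∃ iR : T ⥤ T', Nonempty (i ⊣ iR)
  exists_leftAdjoint_j : ∃ jL : T'' ⥤ T, Nonempty (jL ⊣ j) ∧ jL.Full ∧ jL.Faithful
  exists_rightAdjoint_j : ∃ jR : T'' ⥤ T, Nonempty (j ⊣ jR) ∧ jR.Full ∧ jR.Faithful
  isZero_obj_iff : ∀ X : T, IsZero (j.obj X) ↔ i.essImage X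

/-- An object `G` is compact if `Hom(G, -)` preserves all `u`-small coproducts. -/
def IsCompactObj {T : Type*} [Category* T] [Preadditive T] (G : T) : Prop :=
  ∀ J : Type u, PreservesColimitsOfShape (Discrete J) (preadditiveCoyoneda.obj (op G))

/-- A triangulated category (with `u`-small morphism sets) is compactly generated if it has all
`u`-small coproducts and there is a `u`-small family of compact objects `G a` such that every object
`X` with `Hom(G a, X⟦n⟧) = 0` for all `a` and all integers `n` is zero. -/
structure IsCompactlyGenerated (T : Type*) [Category* T]
    [HasZeroObject T] [HasShift T ℤ] [Preadditive T] [∀ n : ℤ, (shiftFunctor T n).Additive]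
    [Pretriangulated T] [IsTriangulated T] : Prop where
  locallySmall : LocallySmall.{u} T
  hasCoproducts : HasCoproducts.{u} T
  exists_generators : ∃ (ι : Type u) (G : ι → T), (∀ a, IsCompactObj.{u} (G a)) ∧
    ∀ X : T, (∀ (a : ι) (n : ℤ) (f : G a ⟶ X⟦n⟧), f = 0) → IsZero X

end Triangulated

end KFlatDer

end

noncomputable section

set_option linter.unusedSectionVars false

namespace KFlatDer

/-! ### Adjoints from universal arrows -/

section UniversalArrows

variable {C D : Type*} [Category* C] [Category* D]

/-! Write Ac, PAc and KF for the acyclic, pure acyclic and K-flat complexes in K(R). Everything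
follows from four semiorthogonal decompositions of K(R): (⊥Ac, Ac), (Ac, Ac⊥), (PAc, K(PI)) and (KF,
K_ac(PI)). Given a decomposition (P, Q) with Q ⊆ P⊥, the quotient K(R)/P is Q, which identifies the
two quotients with K_ac(PI) and K(PI) and supplies the adjoints.

The first two are K-projective and K-injective resolutions. The class PAc is the right orthogonal of
the set of stalk complexes on finitely presented modules, and the map from X to its character bidual
X⁺⁺ detects maps from these stalks. The bidual has pure-injective components and receives no nonzero
map from PAc, because the bidual of a pure acyclic complex is contractible. A tower of fibres of
such maps gives the decomposition (PAc, K(PI) ∩ PAc⊥).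

The deepest point is `isZero_of_isPureInjective`: PAc ∩ K(PI) = 0. It is proved by lifting cocycles
of Hom(M, Y) for every module M, by induction on the number of relations presenting M: a module with
infinitely many relations is a chain colimit of modules with fewer, with a pure canonical
presentation whose kernel is filtered by such modules again. Hence K(PI) ⊆ PAc⊥.

Through characters, X is K-flat exactly when it has no nonzero map to a dual of an acyclic complex
of right modules. So KF contains ⊥Ac and PAc and their extensions, and KF ∩ Ac ⊆ PAc. Splicing (⊥Ac,
Ac) with (PAc, K(PI)) yields the decomposition (KF, K_ac(PI)).

The recollement is built on K_ac(PI) ⊆ K(PI) → D(R) and transported to the Verdier quotients.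
Compact generators are the stalks on R for D(R), and the stalks on finitely presented modules for
the other two quotients. -/

lemma exists_leftAdjoint_of_universal (G : D ⥤ C) (F : C → D) (u : ∀ X, X ⟶ G.obj (F X))
    (hu : ∀ (X : C) (Y : D), Function.Bijective (fun φ : F X ⟶ Y => u X ≫ G.map φ)) :
    ∃ (L : C ⥤ D) (_ : L ⊣ G), (∀ X, L.obj X = F X) ∧
      ((∀ X, IsIso (u X)) → L.Full ∧ L.Faithful) := by
  let adj := Adjunction.adjunctionOfEquivLeft (fun X Y => Equiv.ofBijective _ (hu X Y))
    (fun X Y Y' g h => by simp)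
  refine ⟨_, adj, fun X => rfl, fun h => ?_⟩
  have e : ∀ X, adj.unit.app X = u X := fun X => by
    simp [adj, Adjunction.adjunctionOfEquivLeft, Adjunction.mkOfHomEquiv]
  have : ∀ X, IsIso (adj.unit.app X) := fun X => by rw [e]; exact h X
  have : IsIso adj.unit := NatIso.isIso_of_isIso_app _
  exact ⟨adj.fullyFaithfulLOfIsIsoUnit.full, adj.fullyFaithfulLOfIsIsoUnit.faithful⟩

lemma exists_rightAdjoint_of_universal (G : D ⥤ C) (F : C → D) (u : ∀ X, G.obj (F X) ⟶ X)
    (hu : ∀ (X : C) (Y : D), Function.Bijective (fun φ : Y ⟶ F X => G.map φ ≫ u X)) :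
    ∃ (L : C ⥤ D) (_ : G ⊣ L), (∀ X, L.obj X = F X) ∧
      ((∀ X, IsIso (u X)) → L.Full ∧ L.Faithful) := by
  let adj := Adjunction.adjunctionOfEquivRight (F := G) (G_obj := F)
    (fun Y X => (Equiv.ofBijective _ (hu X Y)).symm)
    (fun Y' Y X f g => by
      rw [Equiv.symm_apply_eq]
      have := (Equiv.ofBijective _ (hu X Y)).apply_symm_apply g
      simp only [Equiv.ofBijective_apply] at this ⊢
      simp [this])
  refine ⟨_, adj, fun X => rfl, fun h => ?_⟩
  have e : ∀ X, adj.counit.app X = u X := fun X => by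
    simp [adj, Adjunction.adjunctionOfEquivRight, Adjunction.mkOfHomEquiv]
  have : ∀ X, IsIso (adj.counit.app X) := fun X => by rw [e]; exact h X
  have : IsIso adj.counit := NatIso.isIso_of_isIso_app _
  exact ⟨adj.fullyFaithfulROfIsIsoCounit.full, adj.fullyFaithfulROfIsIsoCounit.faithful⟩

end UniversalArrows

/-! ### Semiorthogonal decompositions -/

section Decomposition

variable {C : Type*} [Category* C] [HasZeroObject C] [HasShift C ℤ] [Preadditive C]
  [∀ n : ℤ, (shiftFunctor C n).Additive] [Pretriangulated C]

/-- Every object `X` sits in a distinguished triangle `A ⟶ X ⟶ B ⟶ A⟦1⟧` with `A` in `P` and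
`B` in `Q`. -/
def Decomposes (P Q : ObjectProperty C) : Prop :=
  ∀ X : C, P.extensionProduct Q X

variable {P Q : ObjectProperty C}

lemma Decomposes.mono (h : Decomposes P Q) {P' Q' : ObjectProperty C} (hP : P ≤ P')
    (hQ : Q ≤ Q') : Decomposes P' Q' := fun X => by
  obtain ⟨A, B, f, g, k, hT, hA, hB⟩ := h X
  exact ⟨A, B, f, g, k, hT, hP _ hA, hQ _ hB⟩

/-- Precomposition with `X ⟶ B` is bijective on maps to objects right orthogonal to `A`. -/
lemma precomp_bijective [P.IsTriangulated] {A X B Y : C} {f : A ⟶ X} {g : X ⟶ B}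
    {h : B ⟶ A⟦(1 : ℤ)⟧} (hT : Triangle.mk f g h ∈ distTriang C) (hA : P A)
    (hY : P.rightOrthogonal Y) : Function.Bijective (fun φ : B ⟶ Y => g ≫ φ) := by
  rw [← ObjectProperty.isLocal_trW] at hY
  exact hY g (ObjectProperty.trW.mk' P hT hA)

/-- Postcomposition with `A ⟶ X` is bijective on maps from objects left orthogonal to `B`. -/
lemma postcomp_bijective [Q.IsTriangulated] {A X B Y : C} {f : A ⟶ X} {g : X ⟶ B}
    {h : B ⟶ A⟦(1 : ℤ)⟧} (hT : Triangle.mk f g h ∈ distTriang C) (hB : Q B)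
    (hY : Q.leftOrthogonal Y) : Function.Bijective (fun φ : Y ⟶ A => φ ≫ f) := by
  rw [← ObjectProperty.isColocal_trW] at hY
  exact hY f (ObjectProperty.trW.mk Q hT hB)

/-- An object of the right orthogonal of `P` belongs to `Q` if `(P, Q)` is a decomposition. -/
lemma rightOrthogonal_le [P.IsTriangulated] (h : Decomposes P Q) (hQ : Q ≤ P.rightOrthogonal)
    [Q.IsClosedUnderIsomorphisms] : P.rightOrthogonal ≤ Q := fun X hX => by
  obtain ⟨A, B, f, g, k, hT, hA, hB⟩ := h X
  obtain ⟨b, hb⟩ := (precomp_bijective hT hA hX).2 (𝟙 X)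
  have hgb : g ≫ b = 𝟙 X := hb
  have hbg : b ≫ g = 𝟙 B := (precomp_bijective hT hA (hQ _ hB)).1 (by
    change g ≫ b ≫ g = g ≫ 𝟙 B
    rw [reassoc_of% hgb, Category.comp_id])
  exact Q.prop_of_iso ⟨b, g, hbg, hgb⟩ hB

section Localization

variable [IsTriangulated C] {D : Type*} [Category* D] (L : C ⥤ D)

lemma isIso_map_of_trW [P.IsTriangulated] [L.IsLocalization P.trW] {X Y : C} {f : X ⟶ Y}
    (hf : P.trW f) : IsIso (L.map f) := Localization.inverts L P.trW f hf

/-- The right orthogonal of a Bousfield subcategory is equivalent to the Verdier quotient. -/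
lemma isEquivalence_ι_comp [P.IsTriangulated] [L.IsLocalization P.trW] (h : Decomposes P Q)
    (hQ : Q ≤ P.rightOrthogonal) : (Q.ι ⋙ L).IsEquivalence where
  faithful :=
    { map_injective {X Y} f g hfg := by
        apply Q.ι.map_injective
        exact (ObjectProperty.rightOrthogonal.map_bijective_of_isTriangulated
          (hQ _ Y.property) L _).1 hfg }
  full :=
    { map_surjective {X Y} f := by
        obtain ⟨g, hg⟩ := (ObjectProperty.rightOrthogonal.map_bijective_of_isTriangulated
          (hQ _ Y.property) L _).2 f
        exact ⟨Q.fullyFaithfulι.preimage g, hg⟩ }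
  essSurj :=
    { mem_essImage d := by
        have := Localization.essSurj L P.trW
        obtain ⟨A, B, f, g, k, hT, hA, hB⟩ := h (L.objPreimage d)
        have : IsIso (L.map g) := isIso_map_of_trW L (ObjectProperty.trW.mk' P hT hA)
        exact ⟨⟨B, hB⟩, ⟨(asIso (L.map g)).symm ≪≫ L.objObjPreimageIso d⟩⟩ }

/-- Maps in the quotient into `L.obj B` with `B` in `P.rightOrthogonal` are already maps in `C`. A
representative of `d` lying in `Q` is therefore a universal arrow. -/
lemma exists_rightAdjoint_localization [P.IsTriangulated] [L.IsLocalization P.trW]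
    (h : Decomposes P Q) (hQ : Q ≤ P.rightOrthogonal) :
    ∃ (r : D ⥤ C) (_ : L ⊣ r), (∀ d, Q (r.obj d)) ∧ r.Full ∧ r.Faithful := by
  have : L.EssSurj := Localization.essSurj L P.trW
  have key : ∀ d : D, ∃ (B : C) (e : L.obj B ≅ d), Q B := fun d => by
    obtain ⟨A, B, f, g, k, hT, hA, hB⟩ := h (L.objPreimage d)
    have : IsIso (L.map g) := isIso_map_of_trW L (ObjectProperty.trW.mk' P hT hA)
    exact ⟨B, (asIso (L.map g)).symm ≪≫ L.objObjPreimageIso d, hB⟩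
  choose F e hF using key
  obtain ⟨r, adj, hr, hff⟩ := exists_rightAdjoint_of_universal L F (fun d => (e d).hom)
    (fun d X => by
      have := ObjectProperty.rightOrthogonal.map_bijective_of_isTriangulated (hQ _ (hF d)) L X
      exact ((e d).homToEquiv.symm.symm.bijective.comp this))
  exact ⟨r, adj, fun d => by rw [hr]; exact hF d, hff fun d => inferInstance⟩

lemma exists_leftAdjoint_localization [Q.IsTriangulated] [L.IsLocalization Q.trW]
    (h : Decomposes P Q) (hP : P ≤ Q.leftOrthogonal) :
    ∃ (l : D ⥤ C), Nonempty (l ⊣ L) := by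
  have : L.EssSurj := Localization.essSurj L Q.trW
  have key : ∀ d : D, ∃ (A : C) (e : d ≅ L.obj A), P A := fun d => by
    obtain ⟨A, B, f, g, k, hT, hA, hB⟩ := h (L.objPreimage d)
    have : IsIso (L.map f) := isIso_map_of_trW L (ObjectProperty.trW.mk Q hT hB)
    exact ⟨A, (L.objObjPreimageIso d).symm ≪≫ (asIso (L.map f)).symm, hA⟩
  choose F e hF using key
  obtain ⟨l, adj, -, -⟩ := exists_leftAdjoint_of_universal L F (fun d => (e d).hom)
    (fun d X => by
      have := ObjectProperty.leftOrthogonal.map_bijective_of_isTriangulated (hP _ (hF d)) L X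
      exact ((e d).homFromEquiv.symm.bijective.comp this))
  exact ⟨l, ⟨adj⟩⟩

end Localization

/-- A full subcategory `Y` which is part of a decomposition is reflective. -/
lemma exists_leftAdjoint_ι [P.IsTriangulated] (h : Decomposes P Q)
    (hQ : Q ≤ P.rightOrthogonal) : ∃ l : C ⥤ Q.FullSubcategory, Nonempty (l ⊣ Q.ι) := by
  choose A B f g k hT hA hB using h
  obtain ⟨l, adj, -⟩ := exists_leftAdjoint_of_universal Q.ι (fun X => ⟨B X, hB X⟩) g
    (fun X Y => (precomp_bijective (hT X) (hA X) (hQ _ Y.property)).comp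
      (Q.fullyFaithfulι.homEquiv (X := ⟨B X, hB X⟩) (Y := Y)).bijective)
  exact ⟨l, ⟨adj⟩⟩

lemma isZero_obj_of_prop [IsTriangulated C] {D : Type*} [Category* D] [HasZeroObject D]
    [Preadditive D] (L : C ⥤ D) [L.Additive] [P.IsTriangulated] [L.IsLocalization P.trW] {X : C}
    (hX : P X) : IsZero (L.obj X) := by
  have : IsIso (L.map (0 : X ⟶ 0)) := isIso_map_of_trW L
    (ObjectProperty.trW.mk' P (contractible_distinguished X) hX)
  exact (L.map_isZero (isZero_zero C)).of_iso (asIso (L.map (0 : X ⟶ 0)))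

lemma isZero_obj_iff_of_decomposes [IsTriangulated C] {D : Type*} [Category* D] [HasZeroObject D]
    [Preadditive D] (L : C ⥤ D) [L.Additive] [P.IsTriangulated] [P.IsClosedUnderIsomorphisms]
    [L.IsLocalization P.trW] (h : Decomposes P P.rightOrthogonal) (X : C) :
    IsZero (L.obj X) ↔ P X := by
  refine ⟨fun hX => ?_, isZero_obj_of_prop L⟩
  obtain ⟨A, B, f, g, k, hT, hA, hB⟩ := h X
  have : IsIso (L.map g) := isIso_map_of_trW L (ObjectProperty.trW.mk' P hT hA)
  -- Since `B` is orthogonal to `P`, its endomorphisms agree with those of `L.obj B ≅ L.obj X = 0`.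
  have hB' : IsZero B := by
    rw [IsZero.iff_id_eq_zero]
    exact (ObjectProperty.rightOrthogonal.map_bijective_of_isTriangulated hB L B).1
      ((hX.of_iso (asIso (L.map g)).symm).eq_of_src _ _)
  exact P.ext_of_isTriangulatedClosed₂ _ hT hA (P.prop_of_isZero hB')

section Recollement

variable [IsTriangulated C] {D : Type*} [Category* D] [HasZeroObject D] [HasShift D ℤ]
  [Preadditive D] [∀ n : ℤ, (shiftFunctor D n).Additive] [Pretriangulated D] [IsTriangulated D]
  (L : C ⥤ D) [L.CommShift ℤ] [L.IsTriangulated]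

variable {A N Y : ObjectProperty C} [A.IsTriangulated] [N.IsTriangulated] [Y.IsTriangulated]
  [A.IsClosedUnderIsomorphisms] [Y.IsClosedUnderIsomorphisms]

/-- Composing the decompositions `(⊥A, A)` and `(N, Y)`, when `N ≤ A`, gives a decomposition with
second term in `Y ⊓ A`. -/
lemma Decomposes.inf {F : ObjectProperty C} (hA : Decomposes A.leftOrthogonal A)
    (hN : Decomposes N Y) (hNA : N ≤ A)
    (hF : A.leftOrthogonal.extensionProduct N ≤ F) : Decomposes F (Y ⊓ A) := fun X => by
  obtain ⟨U, B, f, g, k, hT, hU, hB⟩ := hA X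
  obtain ⟨V, I, f', g', k', hT', hV, hI⟩ := hN B
  have hI' : A I := A.ext_of_isTriangulatedClosed₃ _ hT' (hNA _ hV) hB
  obtain ⟨W, a, b, hW⟩ := distinguished_cocone_triangle₁ (g ≫ g')
  refine ⟨W, I, a, g ≫ g', b, hW, hF _ ?_, hI, hI'⟩
  -- The octahedron on `X ⟶ B ⟶ I` presents `W⟦1⟧` as an extension of `V⟦1⟧` by `U⟦1⟧`; shift
  -- stability then gives `W`.
  have o := (Triangulated.someOctahedron (u₁₂ := g) (u₂₃ := g') rfl (rot_of_distTriang _ hT)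
    (rot_of_distTriang _ hT') (rot_of_distTriang _ hW)).mem
  rw [← ObjectProperty.prop_shift_iff_of_isStableUnderShift
    (A.leftOrthogonal.extensionProduct N) W (1 : ℤ)]
  exact ⟨_, _, _, _, _, o, A.leftOrthogonal.le_shift 1 _ hU, N.le_shift 1 _ hV⟩

/-- The recollement `Y ⊓ A ⥤ Y ⥤ C / A`. -/
theorem isRecollement_lift [L.IsLocalization A.trW] {F : ObjectProperty C} [F.IsTriangulated]
    (hA : Decomposes A.leftOrthogonal A) (hA' : Decomposes A A.rightOrthogonal)
    (hN : Decomposes N Y) (hY : Y ≤ N.rightOrthogonal) (hNA : N ≤ A)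
    (hF : A.leftOrthogonal.extensionProduct N ≤ F) (hFY : Y ⊓ A ≤ F.rightOrthogonal) :
    IsRecollement (Y.lift (Y ⊓ A).ι fun X => X.property.1) (Y.ι ⋙ L) := by
  -- As `N ≤ A`, being orthogonal to `A` forces being orthogonal to `N`, and such objects lie in `Y`
  -- by the decomposition `(N, Y)`.
  have hAY : A.rightOrthogonal ≤ Y := fun X hX =>
    rightOrthogonal_le hN hY X fun _ f hZ => hX f (hNA _ hZ)
  have hYA : Decomposes F (Y ⊓ A) := hA.inf hN hNA hF
  let i : (Y ⊓ A).FullSubcategory ⥤ Y.FullSubcategory :=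
    Y.lift (Y ⊓ A).ι fun X => X.property.1
  obtain ⟨r, adjr, hr, hrf, hrf'⟩ := exists_rightAdjoint_localization L hA' le_rfl
  obtain ⟨l, ⟨adjl⟩⟩ := exists_leftAdjoint_localization L hA le_rfl
  obtain ⟨ρ, ⟨adjρ⟩⟩ := exists_leftAdjoint_ι hN hY
  let jR : D ⥤ Y.FullSubcategory := Y.lift r fun d => hAY _ (hr d)
  let adjR : Y.ι ⋙ L ⊣ jR := adjr.restrictFullyFaithful Y.fullyFaithfulι (.id D)
    (Functor.rightUnitor _ ).symm (Functor.leftUnitor _ )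
  let adjL : l ⋙ ρ ⊣ Y.ι ⋙ L := adjl.comp adjρ
  -- In an adjoint triple the left adjoint is fully faithful as soon as the right adjoint is, and
  -- `jR` is because `r` is.
  have hjL : (l ⋙ ρ).FullyFaithful :=
    (Adjunction.Triple.mk adjL adjR).fullyFaithfulEquiv.symm (.ofFullyFaithful jR)
  refine
    { isTriangulated_i := inferInstance
      isTriangulated_j := inferInstance
      full_i := inferInstance
      faithful_i := inferInstance
      exists_leftAdjoint_i := ?_
      exists_rightAdjoint_i := ?_
      exists_leftAdjoint_j := ⟨_, ⟨adjL⟩, hjL.full, hjL.faithful⟩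
      exists_rightAdjoint_j := ⟨jR, ⟨adjR⟩, inferInstance, inferInstance⟩
      isZero_obj_iff := fun X => ?_ }
  · obtain ⟨l', ⟨adjl'⟩⟩ := exists_leftAdjoint_ι hYA hFY
    exact ⟨Y.ι ⋙ l', ⟨adjl'.restrictFullyFaithful Y.fullyFaithfulι (.id _)
      (Functor.rightUnitor _).symm (Functor.leftUnitor _)⟩⟩
  · choose B J f g k hT hB hJ using hA'
    -- The third term of the triangle is in `A.rightOrthogonal ≤ Y`, so the `A`-part of an object of
    -- `Y` stays in `Y`. The coreflection onto `A` thus restricts to `Y`.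
    have hBY : ∀ X : Y.FullSubcategory, Y (B X.obj) := fun X =>
      Y.ext_of_isTriangulatedClosed₁ _ (hT X.obj) X.property (hAY _ (hJ _))
    obtain ⟨l', adj, -⟩ := exists_rightAdjoint_of_universal i
      (fun X => ⟨B X.obj, hBY X, hB X.obj⟩) (fun X => Y.homMk (f X.obj)) (fun X Z => by
        have := postcomp_bijective (Q := A.rightOrthogonal) (hT X.obj) (hJ X.obj)
          (Y := Z.obj) (fun _ g h => h g Z.property.2)
        refine ⟨fun φ ψ h => ?_, fun φ => ?_⟩
        · ext
          exact this.1 (congrArg (fun t => t.hom) h)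
        · obtain ⟨ψ, hψ⟩ := this.2 φ.hom
          exact ⟨(Y ⊓ A).homMk ψ, by ext; exact hψ⟩)
    exact ⟨l', ⟨adj⟩⟩
  · refine (isZero_obj_iff_of_decomposes L hA' X.obj).trans ⟨fun h => ⟨⟨X.obj, X.property, h⟩, ⟨Iso.refl _⟩⟩, ?_⟩
    rintro ⟨Z, ⟨e⟩⟩
    exact A.prop_of_iso (Y.ι.mapIso e) Z.property.2

end Recollement

end Decomposition

/-! ### Transport of recollements along triangulated equivalences -/

section Transport

variable {T' T T'' S' S : Type*} [Category* T'] [Category* T] [Category* T''] [Category* S']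
  [Category* S]
  [HasZeroObject T'] [HasShift T' ℤ] [Preadditive T'] [∀ n : ℤ, (shiftFunctor T' n).Additive]
  [Pretriangulated T'] [IsTriangulated T']
  [HasZeroObject T] [HasShift T ℤ] [Preadditive T] [∀ n : ℤ, (shiftFunctor T n).Additive]
  [Pretriangulated T] [IsTriangulated T]
  [HasZeroObject T''] [HasShift T'' ℤ] [Preadditive T''] [∀ n : ℤ, (shiftFunctor T'' n).Additive]
  [Pretriangulated T''] [IsTriangulated T'']
  [HasZeroObject S'] [HasShift S' ℤ] [Preadditive S'] [∀ n : ℤ, (shiftFunctor S' n).Additive]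
  [Pretriangulated S'] [IsTriangulated S']
  [HasZeroObject S] [HasShift S ℤ] [Preadditive S] [∀ n : ℤ, (shiftFunctor S n).Additive]
  [Pretriangulated S] [IsTriangulated S]

/-- Recollements can be transported along triangulated equivalences. -/
theorem IsRecollement.transport {i : T' ⥤ T} {j : T ⥤ T''} [i.CommShift ℤ] [j.CommShift ℤ]
    (h : IsRecollement i j) (E' : T' ≌ S') (E : T ≌ S)
    [E'.functor.CommShift ℤ] [E'.inverse.CommShift ℤ] [E'.CommShift ℤ] [E'.functor.IsTriangulated]
    [E.functor.CommShift ℤ] [E.functor.IsTriangulated]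
    (j' : S ⥤ T'') [j'.CommShift ℤ] [j'.IsTriangulated] (e : E.functor ⋙ j' ≅ j) :
    IsRecollement (E'.inverse ⋙ i ⋙ E.functor) j' := by
  have := h.isTriangulated_i
  have := h.full_i
  have := h.faithful_i
  have := Equivalence.IsTriangulated.mk' E' inferInstance
  let e' : E.inverse ⋙ j ≅ j' := Functor.isoWhiskerLeft E.inverse e.symm ≪≫
    (Functor.associator _ _ _).symm ≪≫ Functor.isoWhiskerRight E.counitIso j' ≪≫ j'.leftUnitor
  obtain ⟨iL, ⟨adjiL⟩⟩ := h.exists_leftAdjoint_i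
  obtain ⟨iR, ⟨adjiR⟩⟩ := h.exists_rightAdjoint_i
  obtain ⟨jL, ⟨adjjL⟩, _, _⟩ := h.exists_leftAdjoint_j
  obtain ⟨jR, ⟨adjjR⟩, _, _⟩ := h.exists_rightAdjoint_j
  exact
    { isTriangulated_i := inferInstance
      isTriangulated_j := inferInstance
      full_i := inferInstance
      faithful_i := inferInstance
      exists_leftAdjoint_i :=
        ⟨_, ⟨(E.symm.toAdjunction.comp adjiL).comp E'.toAdjunction⟩⟩
      exists_rightAdjoint_i :=
        ⟨_, ⟨E'.symm.toAdjunction.comp (adjiR.comp E.toAdjunction)⟩⟩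
      exists_leftAdjoint_j :=
        ⟨_, ⟨(adjjL.comp E.toAdjunction).ofNatIsoRight e'⟩, inferInstance, inferInstance⟩
      exists_rightAdjoint_j :=
        ⟨_, ⟨(E.symm.toAdjunction.comp adjjR).ofNatIsoLeft e'⟩, inferInstance, inferInstance⟩
      isZero_obj_iff X := by
        rw [← (e'.app X).isZero_iff]
        refine (h.isZero_obj_iff (E.inverse.obj X)).trans ⟨?_, ?_⟩
        · rintro ⟨Z, ⟨f⟩⟩
          exact ⟨E'.functor.obj Z, ⟨E.functor.mapIso (i.mapIso (E'.unitIso.symm.app Z) ≪≫ f) ≪≫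
            E.counitIso.app X⟩⟩
        · rintro ⟨Z, ⟨f⟩⟩
          exact ⟨E'.inverse.obj Z, ⟨E.unitIso.app _ ≪≫ E.inverse.mapIso f⟩⟩ }

/-- The comparison isomorphism between a functor and its transport along equivalences. -/
lemma exists_transport_iso (i : T' ⥤ T) [i.CommShift ℤ] (E' : T' ≌ S') (F : T ⥤ S)
    [E'.functor.CommShift ℤ] [E'.inverse.CommShift ℤ] [E'.CommShift ℤ] [F.CommShift ℤ] :
    ∃ e : E'.functor ⋙ (E'.inverse ⋙ i ⋙ F) ≅ i ⋙ F, NatTrans.CommShift e.hom ℤ := by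
  let e : E'.functor ⋙ (E'.inverse ⋙ i ⋙ F) ≅ i ⋙ F := (Functor.associator _ _ _).symm ≪≫
    Functor.isoWhiskerRight E'.unitIso.symm (i ⋙ F) ≪≫ (i ⋙ F).leftUnitor
  refine ⟨e, ?_⟩
  have : NatTrans.CommShift E'.unitIso.inv ℤ := inferInstance
  dsimp [e]
  infer_instance

/-- Recollements transported along equivalences. -/
theorem IsRecollement.exists_of_equivalence {i : T' ⥤ T} {j : T ⥤ T''} [i.CommShift ℤ]
    [j.CommShift ℤ] (h : IsRecollement i j) (F' : T' ⥤ S') (F : T ⥤ S) [F'.IsEquivalence]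
    [F.IsEquivalence] [F'.CommShift ℤ] [F'.IsTriangulated] [F.CommShift ℤ] [F.IsTriangulated]
    (j' : S ⥤ T'') [j'.CommShift ℤ] [j'.IsTriangulated] (e : F ⋙ j' ≅ j) :
    ∃ (i' : S' ⥤ S) (_ : i'.CommShift ℤ), IsRecollement i' j' ∧
      ∃ e : F' ⋙ i' ≅ i ⋙ F, NatTrans.CommShift e.hom ℤ := by
  let _ : F'.asEquivalence.functor.CommShift ℤ := (inferInstance : F'.CommShift ℤ)
  let _ : F'.asEquivalence.inverse.CommShift ℤ := F'.asEquivalence.commShiftInverse ℤ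
  have : F'.asEquivalence.CommShift ℤ := F'.asEquivalence.commShift_of_functor ℤ
  have : F'.asEquivalence.functor.IsTriangulated := (inferInstance : F'.IsTriangulated)
  let _ : F.asEquivalence.functor.CommShift ℤ := (inferInstance : F.CommShift ℤ)
  have : F.asEquivalence.functor.IsTriangulated := (inferInstance : F.IsTriangulated)
  exact ⟨_, inferInstance, h.transport F'.asEquivalence F.asEquivalence j' e,
    exists_transport_iso i F'.asEquivalence F⟩

end Transport

/-! ### Compact objects -/

section Compact

/-- Every morphism from `G` to a coproduct is a finite sum of morphisms through the summands. -/
def IsFinitary {C : Type*} [Category* C] [Preadditive C] [HasCoproducts.{u} C] (G : C) : Prop :=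
  ∀ (J : Type u) (X : J → C) (f : G ⟶ ∐ X),
    ∃ (s : Finset J) (g : ∀ j, G ⟶ X j), f = ∑ j ∈ s, g j ≫ Sigma.ι X j

/-- The projections onto the summands make the finite expressions unique. So maps from `G` into the
coproduct form the direct sum of the groups of maps into the summands, which is the coproduct of
abelian groups. -/
lemma isCompactObj_of_finite_sum {T : Type*} [Category* T] [Preadditive T] (G : T)
    (h : ∀ (J : Type u) (K : Discrete J ⥤ T) (c : Cocone K) (_ : IsColimit c) (f : G ⟶ c.pt),
      ∃ (s : Finset J) (g : ∀ j, G ⟶ K.obj ⟨j⟩), f = ∑ j ∈ s, g j ≫ c.ι.app ⟨j⟩) :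
    IsCompactObj.{u} G := by
  intro J
  classical
  refine ⟨fun {K} => ⟨fun {c} hc => ⟨?_⟩⟩⟩
  let p : ∀ j, c.pt ⟶ K.obj ⟨j⟩ := fun j => hc.desc ⟨_, Discrete.natTrans (fun k =>
    if h : k = ⟨j⟩ then eqToHom (by rw [h]; rfl) else 0)⟩
  have hp : ∀ j, c.ι.app ⟨j⟩ ≫ p j = 𝟙 _ := fun j => by simp [p]
  have hp' : ∀ j k, k ≠ j → c.ι.app ⟨k⟩ ≫ p j = 0 := fun j k hk => by simp [p, hk]
  let φ : (Π₀ j, (G ⟶ K.obj ⟨j⟩)) →+ (G ⟶ c.pt) := DFinsupp.sumAddHom fun j =>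
    { toFun g := g ≫ c.ι.app ⟨j⟩, map_zero' := by simp, map_add' := by simp }
  have φ_single : ∀ j (g : G ⟶ K.obj ⟨j⟩), φ (DFinsupp.single j g) = g ≫ c.ι.app ⟨j⟩ :=
    fun j g => by simp [φ]
  have φ_p : ∀ (x : Π₀ j, (G ⟶ K.obj ⟨j⟩)) (j : J), φ x ≫ p j = x j := fun x j => by
    induction x using DFinsupp.induction with
    | h0 => simp
    | ha k g x _ _ ih =>
      rw [map_add, Preadditive.add_comp, ih, φ_single, DFinsupp.add_apply, Category.assoc]
      congr 1
      by_cases hk : k = j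
      · subst hk; rw [hp]; simp
      · rw [hp' _ _ hk, DFinsupp.single_eq_of_ne (Ne.symm hk), comp_zero]
  have hφ : Function.Bijective φ := by
    refine ⟨fun x y hxy => DFinsupp.ext fun j => ?_, fun f => ?_⟩
    · rw [← φ_p, hxy, φ_p]
    · obtain ⟨s, g, hg⟩ := h J K c hc f
      exact ⟨∑ j ∈ s, DFinsupp.single j (g j), by simp [map_sum, φ_single, hg]⟩
  let e := AddEquiv.ofBijective φ hφ
  let t : ∀ (s : Cocone (K ⋙ preadditiveCoyoneda.obj (op G))) (j : J),
      (G ⟶ K.obj ⟨j⟩) →+ s.pt := fun s j => (s.ι.app ⟨j⟩).hom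
  refine
    { desc s := AddCommGrpCat.ofHom ((DFinsupp.sumAddHom (t s)).comp e.symm.toAddMonoidHom)
      fac s := ?_
      uniq s m hm := ?_ }
  · rintro ⟨j⟩
    ext g
    have : e.symm (g ≫ c.ι.app ⟨j⟩) = DFinsupp.single j g := by
      rw [AddEquiv.symm_apply_eq]; exact (φ_single j g).symm
    change DFinsupp.sumAddHom (t s) (e.symm (g ≫ c.ι.app ⟨j⟩)) = _
    rw [this]
    exact DFinsupp.sumAddHom_single _ _ _
  · ext f
    obtain ⟨x, rfl⟩ := e.surjective f
    let m' : (G ⟶ c.pt) →+ s.pt := m.hom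
    change m' (e x) = DFinsupp.sumAddHom (t s) (e.symm (e x))
    rw [AddEquiv.symm_apply_apply]
    induction x using DFinsupp.induction with
    | h0 => simp
    | ha k g x _ _ ih =>
      rw [map_add, map_add, map_add, ih, DFinsupp.sumAddHom_single]
      congr 1
      refine (congrArg m' (φ_single k g)).trans ?_
      exact congrArg (fun a => a.hom g) (hm ⟨k⟩)

/-- A map from `Q.obj G` to a coproduct is moved to `Q.obj (∐ x)` with the `x j` in `X`, lifted to
`C`, split there into finitely many summands, and pushed back. Fullness is needed only on `X`, which
must be closed under coproducts and represent every object. For the K-flat quotient, `X` is the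
class of acyclic complexes. -/
lemma isCompactObj_map {C T : Type*} [Category* C] [Category* T] [Preadditive C] [Preadditive T]
    [HasCoproducts.{u} C] (Q : C ⥤ T) [Q.Additive]
    [∀ J : Type u, PreservesColimitsOfShape (Discrete J) Q] (X : ObjectProperty C)
    (hX : ∀ (J : Type u) (x : J → C), (∀ j, X (x j)) → X (∐ x))
    (hX' : ∀ t : T, ∃ c, X c ∧ Nonempty (Q.obj c ≅ t)) {G : C} (hG : IsFinitary.{u} G)
    (surj : ∀ c, X c → Function.Surjective (Q.map : (G ⟶ c) → _)) :
    IsCompactObj.{u} (Q.obj G) := by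
  refine isCompactObj_of_finite_sum _ fun J K c hc f => ?_
  choose x hx e using fun j => hX' (K.obj ⟨j⟩)
  replace e := fun j => (e j).some
  let ψ : c.pt ⟶ Q.obj (∐ x) := hc.desc ⟨_, Discrete.natTrans (fun ⟨j⟩ =>
    (e j).inv ≫ Q.map (Sigma.ι x j))⟩
  let φ : Q.obj (∐ x) ⟶ c.pt := (isColimitOfPreserves Q (coproductIsCoproduct x)).desc
    ⟨_, Discrete.natTrans (fun ⟨j⟩ => (e j).hom ≫ c.ι.app ⟨j⟩)⟩
  have hφ : ∀ j, Q.map (Sigma.ι x j) ≫ φ = (e j).hom ≫ c.ι.app ⟨j⟩ := fun j =>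
    (isColimitOfPreserves Q (coproductIsCoproduct x)).fac _ ⟨j⟩
  have hψ : ψ ≫ φ = 𝟙 _ := hc.hom_ext fun ⟨j⟩ => by
    rw [hc.fac_assoc]
    simp [hφ]
  obtain ⟨f', hf'⟩ := surj _ (hX J x hx) (f ≫ ψ)
  obtain ⟨s, g, hg⟩ := hG J x f'
  refine ⟨s, fun j => Q.map (g j) ≫ (e j).hom, ?_⟩
  rw [← Category.comp_id f, ← hψ, ← Category.assoc, ← hf', hg, Q.map_sum, Preadditive.sum_comp]
  refine Finset.sum_congr rfl fun j _ => ?_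
  rw [Q.map_comp, Category.assoc, hφ, Category.assoc]

variable {C : Type*} [Category.{u} C] [HasZeroObject C] [HasShift C ℤ] [Preadditive C]
  [∀ n : ℤ, (shiftFunctor C n).Additive] [Pretriangulated C] [IsTriangulated C]
  {T : Type*} [Category* T] [HasZeroObject T] [HasShift T ℤ] [Preadditive T]
  [∀ n : ℤ, (shiftFunctor T n).Additive] [Pretriangulated T] [IsTriangulated T]

/-- The quotient `T` is a reflective subcategory of `C` through the right adjoint `r`, whose values
lie in `Y`. Coproducts, smallness of the Hom-sets and the generation test are all inherited along
`r`. -/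
theorem isCompactlyGenerated_localization [HasCoproducts.{u} C] {N Y : ObjectProperty C}
    [N.IsTriangulated] (hN : Decomposes N Y) (hY : Y ≤ N.rightOrthogonal)
    (Q : C ⥤ T) [Q.IsLocalization N.trW] [Q.Additive] [Q.CommShift ℤ]
    (X : ObjectProperty C) (hX : ∀ (J : Type u) (x : J → C), (∀ j, X (x j)) → X (∐ x))
    (hX' : Y ≤ X) {ι : Type u} (G : ι → C) (hG : ∀ a, IsFinitary.{u} (G a))
    (surj : ∀ a c, X c → Function.Surjective (Q.map : (G a ⟶ c) → _))
    (gen : ∀ Z, Y Z → (∀ (a : ι) (n : ℤ) (f : G a ⟶ Z⟦n⟧), f = 0) → IsZero Z) :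
    IsCompactlyGenerated.{u} T := by
  obtain ⟨r, adj, hr, _, _⟩ := exists_rightAdjoint_localization Q hN hY
  have iso : ∀ t : T, Nonempty (Q.obj (r.obj t) ≅ t) := fun t => ⟨asIso (adj.counit.app t)⟩
  refine ⟨⟨fun a b => ?_⟩, fun J => ?_, ι, fun a => Q.obj (G a), fun a => ?_, fun t ht => ?_⟩
  · exact small_map (Functor.FullyFaithful.ofFullyFaithful r).homEquiv
  · have := (adj.isLeftAdjoint).1
    have : Reflective r := ⟨Q, adj⟩
    exact hasColimitsOfShape_of_reflective r
  · have : ∀ J : Type u, PreservesColimitsOfShape (Discrete J) Q := fun J =>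
      adj.leftAdjoint_preservesColimits.1
    exact isCompactObj_map Q X hX (fun t => ⟨_, hX' _ (hr t), iso t⟩) (hG a) (surj a)
  · refine IsZero.of_iso (Q.map_isZero (gen _ (hr t) fun a n f => ?_)) (iso t).some.symm
    have hZ : N.rightOrthogonal ((r.obj t)⟦n⟧) := N.rightOrthogonal.le_shift n _ (hY _ (hr t))
    refine (ObjectProperty.rightOrthogonal.map_bijective_of_isTriangulated hZ Q _).1 ?_
    have := ht a n (Q.map f ≫ (Q.commShiftIso n).hom.app _ ≫ (iso t).some.hom⟦n⟧')
    rw [Q.map_zero]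
    rw [← cancel_mono ((Q.commShiftIso n).hom.app _ ≫ (iso t).some.hom⟦n⟧')]
    exact this.trans zero_comp.symm

end Compact

/-- Dependent choice for sequences of types. -/
lemma exists_seq_of_forall_exists {S : ℕ → Type*} (r : ∀ n, S n → S (n + 1) → Prop)
    (hr : ∀ n x, ∃ y, r n x y) (x₀ : S 0) :
    ∃ x : ∀ n, S n, x 0 = x₀ ∧ ∀ n, r n (x n) (x (n + 1)) := by
  choose f hf using hr
  exact ⟨fun n => Nat.rec x₀ (fun n x => f n x) n, rfl, fun n => hf n _⟩

/-! ### Exactness of Hom in a distinguished triangle -/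

section TriangleLemmas

variable {C : Type*} [Category* C] [HasZeroObject C] [HasShift C ℤ] [Preadditive C]
  [∀ n : ℤ, (shiftFunctor C n).Additive] [Pretriangulated C] {X Y Z W : C} {f : X ⟶ Y} {g : Y ⟶ Z}
  {h : Z ⟶ X⟦(1 : ℤ)⟧}

lemma yoneda_exact₂ (hT : Triangle.mk f g h ∈ distTriang C) (φ : Y ⟶ W)
    (hφ : f ≫ φ = 0) : ∃ ψ : Z ⟶ W, φ = g ≫ ψ :=
  Triangle.yoneda_exact₂ _ hT φ hφ

lemma yoneda_exact₃ (hT : Triangle.mk f g h ∈ distTriang C) (φ : Z ⟶ W)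
    (hφ : g ≫ φ = 0) : ∃ ψ : X⟦(1 : ℤ)⟧ ⟶ W, φ = h ≫ ψ :=
  Triangle.yoneda_exact₃ _ hT φ hφ

lemma yoneda_exact₁ (hT : Triangle.mk f g h ∈ distTriang C) (φ : X⟦(1 : ℤ)⟧ ⟶ W)
    (hφ : h ≫ φ = 0) :
    ∃ ψ : Y⟦(1 : ℤ)⟧ ⟶ W, φ = (-f⟦(1 : ℤ)⟧') ≫ ψ :=
  Triangle.yoneda_exact₃ _ (rot_of_distTriang _ hT) φ hφ

lemma coyoneda_exact₃ (hT : Triangle.mk f g h ∈ distTriang C) (φ : W ⟶ Z)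
    (hφ : φ ≫ h = 0) : ∃ ψ : W ⟶ Y, φ = ψ ≫ g :=
  Triangle.coyoneda_exact₃ _ hT φ hφ

lemma prop_of_distTriang₃ (P : ObjectProperty C) [P.IsTriangulatedClosed₃]
    [P.IsClosedUnderIsomorphisms] (hT : Triangle.mk f g h ∈ distTriang C) (hX : P X) (hY : P Y) :
    P Z :=
  P.ext_of_isTriangulatedClosed₃ _ hT hX hY

end TriangleLemmas

/-! ### Localization away from a set of compact objects -/

section Telescope

variable {C : Type*} [Category.{u} C] [HasZeroObject C] [HasShift C ℤ] [Preadditive C]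
  [∀ n : ℤ, (shiftFunctor C n).Additive] [Pretriangulated C] [HasCoproducts.{u} C]
  {A : ObjectProperty C} [A.IsTriangulated] {ι : Type u} {G : ι → C}

/-- One stage of the telescope. The cone of the sum of all maps from the `G a` to `X` kills these
maps, and its fibre is a coproduct of objects `G a`, hence left orthogonal to `A`. -/
lemma exists_ghost (hA : ∀ Z, A Z ↔ ∀ a (f : G a ⟶ Z), f = 0) (X : C) :
    ∃ (X' B : C) (b : B ⟶ X) (t : X ⟶ X') (d : X' ⟶ B⟦(1 : ℤ)⟧),
      Triangle.mk b t d ∈ distTriang C ∧ A.leftOrthogonal B ∧ ∀ a (f : G a ⟶ X), f ≫ t = 0 := by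
  let y : (Σ a, (G a ⟶ X)) → C := fun j => G j.1
  let b : ∐ y ⟶ X := Sigma.desc fun j => j.2
  obtain ⟨X', t, d, hT⟩ := distinguished_cocone_triangle b
  refine ⟨X', _, b, t, d, hT, fun Z f hZ => ?_, fun a f => ?_⟩
  · exact Sigma.hom_ext _ _ fun j => ((hA Z).1 hZ j.1 _).trans comp_zero.symm
  · have : f = Sigma.ι y ⟨a, f⟩ ≫ b := by simp [b, y]
    rw [this, Category.assoc]
    have h : b ≫ t = 0 := comp_distTriang_mor_zero₁₂ _ hT
    rw [h, comp_zero]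

/-- Iterating `exists_ghost` gives a sequence `X n`, with homotopy colimit `H`. By finiteness every
map from `G a` to the coproduct of the `X n` is killed by the shift map `s`, so `H` lies in `A`.
Each stage induces bijections on maps to objects of `A`, and so does `X 0 ⟶ H`; its fibre is then
left orthogonal to `A`. -/
theorem decomposes_leftOrthogonal (hG : ∀ a, IsFinitary.{u} (G a))
    (hs : ∀ a, ∃ b, Nonempty (G a ≅ (G b)⟦(1 : ℤ)⟧))
    (hA : ∀ Z, A Z ↔ ∀ a (f : G a ⟶ Z), f = 0) : Decomposes A.leftOrthogonal A := by
  intro X₀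
  choose nx B b t d hT hB ht using exists_ghost hA
  have t_inj : ∀ {X Z : C} (hZ : A Z) (ψ : nx X ⟶ Z), t X ≫ ψ = 0 → ψ = 0 := by
    intro X Z hZ ψ hψ
    obtain ⟨χ, rfl⟩ := yoneda_exact₃ (hT X) ψ hψ
    rw [A.leftOrthogonal.le_shift 1 _ (hB X) χ hZ, comp_zero]
  have t_surj : ∀ {X Z : C} (hZ : A Z) (ψ : X ⟶ Z), ∃ χ : nx X ⟶ Z, ψ = t X ≫ χ :=
    fun {X Z} hZ ψ => yoneda_exact₂ (hT X) ψ (hB X _ hZ)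
  obtain ⟨X, hX₀, tr, tr_surj, tr_inj, tr_ghost⟩ : ∃ (X : ℕ → C) (_ : X 0 = X₀)
      (tr : ∀ n, X n ⟶ X (n + 1)),
      (∀ n {Z : C} (_ : A Z) (ψ : X n ⟶ Z), ∃ χ, ψ = tr n ≫ χ) ∧
      (∀ n {Z : C} (_ : A Z) (ψ : X (n + 1) ⟶ Z), tr n ≫ ψ = 0 → ψ = 0) ∧
      (∀ n a (f : G a ⟶ X n), f ≫ tr n = 0) :=
    ⟨fun n => Nat.rec X₀ (fun _ Y => nx Y) n, rfl, fun n => t _, fun n _ => t_surj,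
      fun n _ => t_inj, fun n => ht _⟩
  subst hX₀
  let x : ULift.{u} ℕ → C := fun n => X n.down
  let S : C := ∐ x
  let inj : ∀ n, X n ⟶ S := fun n => Sigma.ι x ⟨n⟩
  let s : S ⟶ S := Sigma.desc fun n => tr n.down ≫ inj (n.down + 1)
  have inj_s : ∀ n, inj n ≫ s = tr n ≫ inj (n + 1) := fun n => by simp [inj, s]
  have S_ext : ∀ {Z : C} (f g : S ⟶ Z), (∀ n, inj n ≫ f = inj n ≫ g) → f = g :=
    fun f g h => Sigma.hom_ext _ _ fun n => h n.down
  have gs : ∀ a (g : G a ⟶ S), g ≫ s = 0 := fun a g => by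
    obtain ⟨I, k, rfl⟩ := hG a _ x g
    rw [Preadditive.sum_comp]
    refine Finset.sum_eq_zero fun n _ => ?_
    rw [Category.assoc]
    change k n ≫ inj n.down ≫ s = 0
    rw [inj_s, ← Category.assoc]
    rw [tr_ghost n.down a (k n), zero_comp]
  -- The family `G` is closed under desuspension, which turns a map to `S⟦1⟧` into the shift of a
  -- map to `S`.
  have gs' : ∀ a (g : G a ⟶ S⟦(1 : ℤ)⟧), g ≫ s⟦(1 : ℤ)⟧' = 0 := fun a g => by
    obtain ⟨b, ⟨e⟩⟩ := hs a
    obtain ⟨h, hh⟩ := (shiftFunctor C (1 : ℤ)).map_surjective (e.inv ≫ g)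
    rw [← cancel_epi e.inv, ← Category.assoc, ← hh, ← Functor.map_comp, gs, Functor.map_zero,
      comp_zero]
  obtain ⟨H, p, δ, hH⟩ := distinguished_cocone_triangle (𝟙 S - s)
  have hp : s ≫ p = p := by
    have : (𝟙 S - s) ≫ p = 0 := comp_distTriang_mor_zero₁₂ _ hH
    rwa [Preadditive.sub_comp, Category.id_comp, sub_eq_zero, eq_comm] at this
  have hAH : A H := by
    rw [hA]
    intro a f
    -- The map `f ≫ δ` is killed both by `(𝟙 S - s)⟦1⟧'` and by `s⟦1⟧'`, hence by the identity.
    have h1 : f ≫ δ = 0 := by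
      have h2 : δ ≫ (𝟙 S - s)⟦(1 : ℤ)⟧' = 0 := comp_distTriang_mor_zero₃₁ _ hH
      have h3 : (f ≫ δ) ≫ (𝟙 S - s)⟦(1 : ℤ)⟧' = 0 := by rw [Category.assoc, h2, comp_zero]
      rwa [Functor.map_sub, Preadditive.comp_sub, gs', sub_zero, CategoryTheory.Functor.map_id,
        Category.comp_id] at h3
    obtain ⟨g, hg⟩ := coyoneda_exact₃ hH f h1
    rw [hg, ← hp, ← Category.assoc, gs, zero_comp]
  obtain ⟨L, a, c, hL⟩ := distinguished_cocone_triangle₁ (inj 0 ≫ p)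
  refine ⟨L, H, a, inj 0 ≫ p, c, hL, ?_, hAH⟩
  have surj : ∀ {Z : C} (hZ : A Z) (ψ : X 0 ⟶ Z), ∃ χ : H ⟶ Z, ψ = (inj 0 ≫ p) ≫ χ := by
    intro Z hZ ψ
    obtain ⟨ψ', h0, hψ'⟩ := exists_seq_of_forall_exists (S := fun n => X n ⟶ Z)
      (fun n f g => f = tr n ≫ g) (fun n f => tr_surj n hZ f) ψ
    let ψS : S ⟶ Z := Sigma.desc fun n => ψ' n.down
    have hψS : ∀ n, inj n ≫ ψS = ψ' n := fun n => by simp [inj, ψS]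
    obtain ⟨χ, hχ⟩ := yoneda_exact₂ hH ψS (S_ext _ _ fun n => by
      rw [Preadditive.sub_comp, Category.id_comp, Preadditive.comp_sub, ← Category.assoc, inj_s,
        Category.assoc, hψS, hψS, ← hψ', sub_self, comp_zero])
    exact ⟨χ, by rw [Category.assoc, ← hχ, hψS, h0]⟩
  have inj' : ∀ {Z : C} (hZ : A Z) (ψ : H ⟶ Z), (inj 0 ≫ p) ≫ ψ = 0 → ψ = 0 := by
    intro Z hZ ψ hψ
    have h1 : ∀ n : ℕ, inj n ≫ p ≫ ψ = 0 := fun n => by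
      induction n with
      | zero => rw [← Category.assoc, hψ]
      | succ n ih =>
        refine tr_inj n hZ _ ?_
        rw [← Category.assoc, ← inj_s, Category.assoc, ← Category.assoc s, hp, ih]
    obtain ⟨ψ', hψ'⟩ := yoneda_exact₃ hH ψ
      (S_ext _ _ fun n => (h1 n).trans comp_zero.symm)
    obtain ⟨ε⟩ : Nonempty (Z ≅ (Z⟦(-1 : ℤ)⟧)⟦(1 : ℤ)⟧) :=
      ⟨(shiftEquiv C (1 : ℤ)).counitIso.symm.app Z⟩
    obtain ⟨φ, hφ⟩ : ∃ φ : S ⟶ Z⟦(-1 : ℤ)⟧,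
        φ⟦(1 : ℤ)⟧' = ψ' ≫ ε.hom :=
      (shiftFunctor C (1 : ℤ)).map_surjective _
    have hZ' : A (Z⟦(-1 : ℤ)⟧) := A.le_shift (-1) _ hZ
    -- This is the vanishing of the lim¹ term: the equation `inj n ≫ φ = χ n - tr n ≫ χ (n + 1)` is
    -- solved recursively from `χ 0 = 0`, every map to an object of `A` extending along `tr n`.
    -- Hence `φ` factors through `𝟙 S - s`.
    obtain ⟨χ, -, hχ⟩ := exists_seq_of_forall_exists (S := fun n => X n ⟶ Z⟦(-1 : ℤ)⟧)
      (fun n f g => f - inj n ≫ φ = tr n ≫ g) (fun n f => tr_surj n hZ' _) 0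
    have key : φ = (𝟙 S - s) ≫ Sigma.desc fun n => χ n.down := S_ext _ _ fun n => by
      have hn : ∀ n, inj n ≫ (Sigma.desc fun n => χ n.down) = χ n := fun n => by simp [inj]
      rw [Preadditive.sub_comp, Category.id_comp, Preadditive.comp_sub, ← Category.assoc, inj_s,
        Category.assoc, hn, hn, ← hχ]
      abel
    have h2 : δ ≫ (𝟙 S - s)⟦(1 : ℤ)⟧' = 0 := comp_distTriang_mor_zero₃₁ _ hH
    rw [hψ', ← cancel_mono ε.hom, Category.assoc, ← hφ, key,
      Functor.map_comp, ← Category.assoc, h2, zero_comp, zero_comp]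
  -- In the long exact sequence of `L ⟶ X 0 ⟶ H`, injectivity for `Z⟦1⟧` and surjectivity for `Z`
  -- together leave no nonzero map from `L` to `Z`.
  intro Z φ hZ
  have h1 : c ≫ φ⟦(1 : ℤ)⟧' = 0 := inj' (A.le_shift 1 _ hZ) _ (by
    have h : (inj 0 ≫ p) ≫ c = 0 := comp_distTriang_mor_zero₂₃ _ hL
    rw [← Category.assoc, h, zero_comp])
  obtain ⟨ψ, hψ⟩ := yoneda_exact₁ hL _ h1
  obtain ⟨ψ', rfl⟩ := (shiftFunctor C (1 : ℤ)).map_surjective ψ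
  obtain ⟨χ, rfl⟩ := surj hZ ψ'
  apply (shiftFunctor C (1 : ℤ)).map_injective
  rw [hψ, Functor.map_zero]
  have h : a ≫ (inj 0 ≫ p) = 0 := comp_distTriang_mor_zero₁₂ _ hL
  rw [Preadditive.neg_comp, ← Functor.map_comp, ← Category.assoc, h, zero_comp, Functor.map_zero,
    neg_zero]

end Telescope

/-! ### Coproducts in the homotopy category -/

section HomotopyCoproducts

variable {V : Type*} [Category* V] [Preadditive V] {ι : Type*} {c : ComplexShape ι}

section

variable {J : Type*} [HasCoproductsOfShape J V] {X : J → HomologicalComplex V c}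
  {b : Cofan X} (hb : IsColimit b)

/-- The degree `i` component of a coproduct of complexes is a coproduct. -/
def cofanDesc (i : ι) {T : V} (g : ∀ j, (X j).X i ⟶ T) : b.pt.X i ⟶ T :=
  (isColimitOfPreserves (HomologicalComplex.eval V c i) hb).desc
    ⟨T, Discrete.natTrans fun ⟨j⟩ => g j⟩

lemma cofan_fac (i : ι) {T : V} (g : ∀ j, (X j).X i ⟶ T) (j : J) :
    (b.inj j).f i ≫ cofanDesc hb i g = g j :=
  (isColimitOfPreserves (HomologicalComplex.eval V c i) hb).fac _ ⟨j⟩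

lemma cofan_hom_ext (hb : IsColimit b) (i : ι) {T : V} (g h : b.pt.X i ⟶ T)
    (H : ∀ j, (b.inj j).f i ≫ g = (b.inj j).f i ≫ h) : g = h :=
  (isColimitOfPreserves (HomologicalComplex.eval V c i) hb).hom_ext fun ⟨j⟩ => H j

/-- A morphism from a coproduct of complexes is null-homotopic if its components are. -/
def homotopyOfCofan {T : HomologicalComplex V c} (f : b.pt ⟶ T)
    (h : ∀ j, Homotopy (b.inj j ≫ f) 0) : Homotopy f 0 where
  hom i k := cofanDesc hb i fun j => (h j).hom i k
  zero i k hik := cofan_hom_ext hb _ _ _ fun j => by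
    rw [cofan_fac, (h j).zero i k hik, comp_zero]
  comm i := cofan_hom_ext hb _ _ _ fun j => by
    have := (h j).comm i
    simp only [HomologicalComplex.comp_f, HomologicalComplex.zero_f, add_zero] at this ⊢
    rw [this, Preadditive.comp_add]
    congr 1
    · simp only [dNext, AddMonoidHom.mk'_apply]
      rw [← Category.assoc, (b.inj j).comm, Category.assoc, cofan_fac]
    · simp only [prevD, AddMonoidHom.mk'_apply]
      rw [← Category.assoc, cofan_fac]

end

/-- The image in the homotopy category of a coproduct cofan of complexes is a coproduct. -/
def isColimitQuotientCofan {J : Type*} [HasCoproductsOfShape J V]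
    {X : J → HomologicalComplex V c} {b : Cofan X} (hb : IsColimit b) :
    IsColimit (Cofan.mk ((HomotopyCategory.quotient V c).obj b.pt)
      (fun j => (HomotopyCategory.quotient V c).map (b.inj j))) := by
  refine Cofan.IsColimit.mk _ (fun s => (HomotopyCategory.quotient V c).map
    (Cofan.IsColimit.desc hb fun j => ((HomotopyCategory.quotient V c).map_surjective
      (X := X j) (Y := s.pt.as) (s.inj j)).choose)) (fun s j => ?_) (fun s m hm => ?_)
  · refine ((HomotopyCategory.quotient V c).map_comp _ _).symm.trans ?_
    rw [Cofan.IsColimit.fac]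
    exact ((HomotopyCategory.quotient V c).map_surjective (X := X j) (Y := s.pt.as)
      (s.inj j)).choose_spec
  · obtain ⟨m', rfl⟩ := (HomotopyCategory.quotient V c).map_surjective
      (X := b.pt) (Y := s.pt.as) m
    refine HomotopyCategory.eq_of_homotopy _ _ (Homotopy.equivSubZero.symm
      (homotopyOfCofan hb _ fun j => HomotopyCategory.homotopyOfEq _ _ ?_))
    rw [Preadditive.comp_sub, Functor.map_sub, Functor.map_zero, sub_eq_zero,
      Cofan.IsColimit.fac]
    refine ((HomotopyCategory.quotient V c).map_comp _ _).trans ((hm j).trans ?_)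
    exact ((HomotopyCategory.quotient V c).map_surjective (X := X j) (Y := s.pt.as)
      (s.inj j)).choose_spec.symm

instance [HasCoproducts.{w} V] : HasCoproducts.{w} (HomotopyCategory V c) :=
  hasCoproducts_of_colimit_cofans (fun {J} (_ : J → HomotopyCategory V c) => _)
    (fun {J} (X : J → HomotopyCategory V c) => isColimitQuotientCofan (X := fun j => (X j).as)
      (coproductIsCoproduct (fun j => (X j).as)))

end HomotopyCoproducts

/-! ### Finiteness of stalk complexes on finitely generated modules -/

section Stalks

variable {R : Type u} [Ring R]

/-- The elements fixed by all large finite partial sums form a submodule containing the image of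
each summand. The summands are jointly epimorphic, so the quotient by this submodule is zero. -/
lemma exists_finset_sum_eq {J : Type u} (X : J → CochainComplex (ModuleCat.{u} R) ℤ)
    (p : ∀ j, (∐ X) ⟶ X j) (hp : ∀ j, Sigma.ι X j ≫ p j = 𝟙 _)
    (hp' : ∀ j k, k ≠ j → Sigma.ι X k ≫ p j = 0) (i : ℤ) (x : (∐ X).X i) :
    ∃ s : Finset J, ∀ s', s ⊆ s' →
      (∑ j ∈ s', (p j ≫ Sigma.ι X j).f i).hom x = x := by
  classical
  let S : Submodule R ((∐ X).X i) :=
    { carrier := {x | ∃ s : Finset J, ∀ s', s ⊆ s' → (∑ j ∈ s', (p j ≫ Sigma.ι X j).f i).hom x = x}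
      zero_mem' := ⟨∅, fun s' _ => map_zero _⟩
      add_mem' := by
        rintro x y ⟨s, hs⟩ ⟨t, ht⟩
        exact ⟨s ∪ t, fun s' h => by
          rw [map_add, hs s' (Finset.union_subset_left h), ht s' (Finset.union_subset_right h)]⟩
      smul_mem' := by
        rintro r x ⟨s, hs⟩
        exact ⟨s, fun s' h => by rw [map_smul, hs s' h]⟩ }
  suffices h : ModuleCat.ofHom S.mkQ = 0 by
    have : S.mkQ x = 0 := congrArg (fun f => f.hom x) h
    exact (Submodule.Quotient.mk_eq_zero S).1 this
  refine cofan_hom_ext (coproductIsCoproduct X) i _ _ fun j => ?_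
  ext y
  refine (Submodule.Quotient.mk_eq_zero S).2 ⟨{j}, fun s' hs' => ?_⟩
  have : (Sigma.ι X j).f i ≫ (∑ k ∈ s', (p k ≫ Sigma.ι X k).f i) = (Sigma.ι X j).f i := by
    rw [Preadditive.comp_sum, Finset.sum_eq_single j]
    · rw [← HomologicalComplex.comp_f, reassoc_of% hp j]
    · intro k _ hk
      rw [← HomologicalComplex.comp_f, reassoc_of% hp' k j hk.symm, zero_comp]; rfl
    · intro h; exact (h (hs' (Finset.mem_singleton_self j))).elim
  exact congrArg (fun f => f.hom y) this

/-- The stalk complex with the module `F` in degree `i`, in the homotopy category. -/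
abbrev stalk (i : ℤ) (F : ModuleCat.{u} R) : K R :=
  (HomotopyCategory.quotient _ _).obj ((HomologicalComplex.single _ (ComplexShape.up ℤ) i).obj F)

/-- Each element of the image of a finite generating set lies in finitely many summands, and
coproducts in K(R) are computed on complexes. -/
lemma isFinitary_stalk (i : ℤ) (F : ModuleCat.{u} R) [Module.Finite R F] :
    IsFinitary.{u} (stalk i F) := by
  classical
  intro J X f
  let Y : J → CochainComplex (ModuleCat.{u} R) ℤ := fun j => (X j).as
  let Q := HomotopyCategory.quotient (ModuleCat.{u} R) (ComplexShape.up ℤ)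
  let hY := isColimitQuotientCofan (coproductIsCoproduct Y)
  let e : Q.obj (∐ Y) ≅ ∐ X := hY.coconePointUniqueUpToIso (coproductIsCoproduct X)
  obtain ⟨g, hg⟩ := Q.map_surjective (f ≫ e.inv)
  let p : ∀ j, (∐ Y) ⟶ Y j := fun j => Sigma.desc fun k =>
    if h : k = j then eqToHom (by rw [h]) else 0
  have hp : ∀ j, Sigma.ι Y j ≫ p j = 𝟙 _ := fun j => by simp [p]
  have hp' : ∀ j k, k ≠ j → Sigma.ι Y k ≫ p j = 0 := fun j k hk => by simp [p, hk]
  obtain ⟨t, ht⟩ := Module.Finite.fg_top (R := R) (M := F)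
  let φ : F ⟶ (∐ Y).X i := (HomologicalComplex.singleObjXSelf (ComplexShape.up ℤ) i F).inv ≫ g.f i
  choose s hs using fun x => exists_finset_sum_eq Y p hp hp' i (φ.hom x)
  have key : g = ∑ j ∈ t.biUnion s, g ≫ p j ≫ Sigma.ι Y j := by
    apply HomologicalComplex.from_single_hom_ext
    rw [← cancel_epi (HomologicalComplex.singleObjXSelf (ComplexShape.up ℤ) i F).inv,
      ← Preadditive.comp_sum, HomologicalComplex.comp_f, ← Category.assoc]
    change φ = φ ≫ _
    apply ModuleCat.hom_ext
    refine LinearMap.ext_on (s := (t : Set F)) ht fun x hx => ?_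
    have := hs x _ (Finset.subset_biUnion_of_mem s hx)
    refine this.symm.trans ?_
    change _ = ModuleCat.Hom.hom _ (φ.hom x)
    congr 2
    exact (map_sum (HomologicalComplex.eval (ModuleCat.{u} R) (ComplexShape.up ℤ) i).mapAddHom
      (fun j => p j ≫ Sigma.ι Y j) _).symm
  refine ⟨t.biUnion s, fun j => Q.map (g ≫ p j), ?_⟩
  rw [← cancel_mono e.inv, ← hg, Preadditive.sum_comp]
  conv_lhs => rw [key, Functor.map_sum]
  refine Finset.sum_congr rfl fun j _ => ?_
  have h : Sigma.ι X j ≫ e.inv = Q.map (Sigma.ι Y j) :=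
    hY.comp_coconePointUniqueUpToIso_inv (coproductIsCoproduct X) ⟨j⟩
  calc Q.map (g ≫ p j ≫ Sigma.ι Y j) = Q.map (g ≫ p j) ≫ Q.map (Sigma.ι Y j) := by
        rw [← Q.map_comp, Category.assoc]
    _ = Q.map (g ≫ p j) ≫ Sigma.ι X j ≫ e.inv := congrArg (Q.map (g ≫ p j) ≫ ·) h.symm
    _ = _ := (Category.assoc _ _ _).symm

end Stalks

/-! ### Character modules over an arbitrary ring -/

section Characters

variable {R : Type u} [Ring R]

/-- The group `ℚ/ℤ`. -/
abbrev QZ : Type := AddCircle (1 : ℚ)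

lemma exists_character_extension {A B : Type*} [AddCommGroup A] [AddCommGroup B] (f : A →+ B)
    (hf : Function.Injective f) (χ : A →+ QZ) : ∃ χ' : B →+ QZ, ∀ a, χ' (f a) = χ a := by
  obtain ⟨χ', h⟩ := CharacterModule.dual_surjective_of_injective (R := ℤ) f.toIntLinearMap hf χ
  exact ⟨χ', fun a => DFunLike.congr_fun h a⟩

lemma exists_character_ne_zero {B : Type*} [AddCommGroup B] (S : AddSubgroup B) {b : B}
    (hb : b ∉ S) : ∃ χ : B →+ QZ, (∀ s ∈ S, χ s = 0) ∧ χ b ≠ 0 := by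
  obtain ⟨c, hc⟩ := CharacterModule.exists_character_apply_ne_zero_of_ne_zero
    (a := (QuotientAddGroup.mk b : B ⧸ S)) (by rwa [Ne, QuotientAddGroup.eq_zero_iff])
  refine ⟨AddMonoidHom.comp c (QuotientAddGroup.mk' S), fun s hs => ?_, hc⟩
  change c (QuotientAddGroup.mk s) = 0
  rw [(QuotientAddGroup.eq_zero_iff s).2 hs]
  exact map_zero c

/-- An exact complex of abelian groups can be recognised by its characters. -/
lemma exact_of_characters {A B C : Type*} [AddCommGroup A] [AddCommGroup B] [AddCommGroup C]
    (f : A →+ B) (g : B →+ C)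
    (h : ∀ χ : B →+ QZ, (∀ a, χ (f a) = 0) → ∃ χ' : C →+ QZ, ∀ b, χ b = χ' (g b))
    {b : B} (hb : g b = 0) : ∃ a, f a = b := by
  by_contra hn
  obtain ⟨χ, h₁, h₂⟩ := exists_character_ne_zero f.range (b := b) (by simpa using hn)
  obtain ⟨χ', h'⟩ := h χ fun a => h₁ _ ⟨a, rfl⟩
  exact h₂ (by rw [h', hb, map_zero])

lemma characters_of_exact {A B C : Type*} [AddCommGroup A] [AddCommGroup B] [AddCommGroup C]
    (f : A →+ B) (g : B →+ C) (h : ∀ b, g b = 0 → ∃ a, f a = b)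
    (χ : B →+ QZ) (hχ : ∀ a, χ (f a) = 0) : ∃ χ' : C →+ QZ, ∀ b, χ' (g b) = χ b := by
  obtain ⟨χ', h'⟩ := exists_character_extension (QuotientAddGroup.kerLift g)
    (QuotientAddGroup.kerLift_injective g) (QuotientAddGroup.lift g.ker χ fun b hb => by
      obtain ⟨a, rfl⟩ := h b hb
      exact hχ a)
  exact ⟨χ', fun b => h' (QuotientAddGroup.mk b)⟩

/-- A linear map between the underlying modules, as a morphism. -/
abbrev mkHom {S : Type u} [Ring S] {M N : ModuleCat.{u} S} (f : M →ₗ[S] N) : M ⟶ N :=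
  ModuleCat.ofHom f

/-- The character module of a left module, a right module. -/
def dualL (N : ModuleCat.{u} R) : ModuleCat.{u} Rᵐᵒᵖ :=
  letI : Module Rᵐᵒᵖ (N →+ QZ) :=
    { smul r φ := φ.comp (DistribSMul.toAddMonoidHom N r.unop)
      one_smul φ := by ext n; exact congrArg φ (one_smul R n)
      mul_smul r s φ := by ext n; exact congrArg φ (mul_smul s.unop r.unop n)
      smul_zero r := rfl
      smul_add r φ ψ := rfl
      add_smul r s φ := by
        ext n; exact (congrArg φ (add_smul r.unop s.unop n)).trans (map_add φ _ _)
      zero_smul φ := by ext n; exact (congrArg φ (zero_smul R n)).trans (map_zero φ) }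
  ModuleCat.of Rᵐᵒᵖ (N →+ QZ)

/-- Evaluation of characters. -/
def evL {N : ModuleCat.{u} R} : dualL N →+ N →+ QZ := AddMonoidHom.id (N →+ QZ)

/-- A character, as an element of the character module. -/
def mkL {N : ModuleCat.{u} R} (f : N →+ QZ) : dualL N := f

@[simp] lemma evL_mkL {N : ModuleCat.{u} R} (f : N →+ QZ) : evL (mkL f) = f := rfl

lemma dualL_ext {N : ModuleCat.{u} R} {φ ψ : dualL N} (h : ∀ n, evL φ n = evL ψ n) : φ = ψ :=
  AddMonoidHom.ext h

/-- Precomposition of characters with a linear map. -/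
def dualLMap {N N' : ModuleCat.{u} R} (f : N ⟶ N') : dualL N' ⟶ dualL N :=
  mkHom
    { toFun φ := mkL ((evL φ).comp f.hom.toAddMonoidHom)
      map_add' φ ψ := dualL_ext fun n => by simp
      map_smul' r φ := dualL_ext fun n => by
        exact congrArg (evL φ) (map_smul f.hom r.unop n).symm }

/-- The character module of a right module, a left module. -/
def dualR (M : ModuleCat.{u} Rᵐᵒᵖ) : ModuleCat.{u} R :=
  letI : Module R (M →+ QZ) :=
    { smul r φ := φ.comp (DistribSMul.toAddMonoidHom M (MulOpposite.op r))
      one_smul φ := by ext n; exact congrArg φ (one_smul Rᵐᵒᵖ n)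
      mul_smul r s φ := by
        ext n; exact congrArg φ (mul_smul (MulOpposite.op s) (MulOpposite.op r) n)
      smul_zero r := rfl
      smul_add r φ ψ := rfl
      add_smul r s φ := by
        ext n
        exact (congrArg φ (add_smul (MulOpposite.op r) (MulOpposite.op s) n)).trans (map_add φ _ _)
      zero_smul φ := by ext n; exact (congrArg φ (zero_smul Rᵐᵒᵖ n)).trans (map_zero φ) }
  ModuleCat.of R (M →+ QZ)

/-- Evaluation of characters. -/
def evR {M : ModuleCat.{u} Rᵐᵒᵖ} : dualR M →+ M →+ QZ := AddMonoidHom.id (M →+ QZ)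

/-- A character, as an element of the character module. -/
def mkR {M : ModuleCat.{u} Rᵐᵒᵖ} (f : M →+ QZ) : dualR M := f

@[simp] lemma evR_mkR {M : ModuleCat.{u} Rᵐᵒᵖ} (f : M →+ QZ) : evR (mkR f) = f := rfl

lemma dualR_ext {M : ModuleCat.{u} Rᵐᵒᵖ} {φ ψ : dualR M} (h : ∀ n, evR φ n = evR ψ n) : φ = ψ :=
  AddMonoidHom.ext h

@[simp] lemma evR_smul {M : ModuleCat.{u} Rᵐᵒᵖ} (r : R) (φ : dualR M) (m : M) :
    evR (r • φ) m = evR φ (MulOpposite.op r • m) := rfl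

/-- Precomposition of characters with a linear map. -/
def dualRMap {M M' : ModuleCat.{u} Rᵐᵒᵖ} (f : M ⟶ M') : dualR M' ⟶ dualR M :=
  mkHom
    { toFun φ := mkR ((evR φ).comp f.hom.toAddMonoidHom)
      map_add' φ ψ := dualR_ext fun n => by simp
      map_smul' r φ := dualR_ext fun n => by
        exact congrArg (evR φ) (map_smul f.hom (MulOpposite.op r) n).symm }

lemma dualL_hom_ext {M : ModuleCat.{u} Rᵐᵒᵖ} {N : ModuleCat.{u} R} {f g : M ⟶ dualL N}
    (h : ∀ m n, evL (f.hom m) n = evL (g.hom m) n) : f = g :=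
  ModuleCat.hom_ext (LinearMap.ext fun m => dualL_ext (h m))

lemma dualR_hom_ext {M : ModuleCat.{u} Rᵐᵒᵖ} {N : ModuleCat.{u} R} {f g : N ⟶ dualR M}
    (h : ∀ n m, evR (f.hom n) m = evR (g.hom n) m) : f = g :=
  ModuleCat.hom_ext (LinearMap.ext fun n => dualR_ext (h n))

lemma dualLMap_comp {N N' N'' : ModuleCat.{u} R} (f : N ⟶ N') (g : N' ⟶ N'') :
    dualLMap (f ≫ g) = dualLMap g ≫ dualLMap f := rfl

lemma dualRMap_comp {N N' N'' : ModuleCat.{u} Rᵐᵒᵖ} (f : N ⟶ N') (g : N' ⟶ N'') :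
    dualRMap (f ≫ g) = dualRMap g ≫ dualRMap f := rfl

lemma dualLMap_add {N N' : ModuleCat.{u} R} (f g : N ⟶ N') :
    dualLMap (f + g) = dualLMap f + dualLMap g :=
  dualL_hom_ext fun φ n => map_add (evL φ) (f.hom n) (g.hom n)

lemma dualRMap_add {N N' : ModuleCat.{u} Rᵐᵒᵖ} (f g : N ⟶ N') :
    dualRMap (f + g) = dualRMap f + dualRMap g :=
  dualR_hom_ext fun φ n => map_add (evR φ) (f.hom n) (g.hom n)

lemma dualLMap_zero {N N' : ModuleCat.{u} R} : dualLMap (0 : N ⟶ N') = 0 :=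
  dualL_hom_ext fun φ _ => map_zero (evL φ)

/-- Evaluation, from a left module to its bidual. -/
def unitL (N : ModuleCat.{u} R) : N ⟶ dualR (dualL N) :=
  mkHom
    { toFun n := mkR (evL.flip n)
      map_add' n n' := dualR_ext fun φ => by simp
      map_smul' r n := dualR_ext fun φ => rfl }

@[simp] lemma evR_unitL {N : ModuleCat.{u} R} (n : N) (φ : dualL N) :
    evR ((unitL N).hom n) φ = evL φ n := rfl

/-- Evaluation, from a right module to its bidual. -/
def unitR (M : ModuleCat.{u} Rᵐᵒᵖ) : M ⟶ dualL (dualR M) :=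
  mkHom
    { toFun n := mkL (evR.flip n)
      map_add' n n' := dualL_ext fun φ => by simp
      map_smul' r n := dualL_ext fun φ => rfl }

/-- The bidual of a left module. -/
@[simps]
def bidual (R : Type u) [Ring R] : ModuleCat.{u} R ⥤ ModuleCat.{u} R where
  obj N := dualR (dualL N)
  map f := dualRMap (dualLMap f)
  map_id _ := rfl
  map_comp _ _ := rfl

instance : (bidual R).Additive where
  map_add {_ _ f g} := by
    rw [bidual_map, dualLMap_add, dualRMap_add]
    rfl

/-! ### Characters of tensor products -/

/-- The character of `M ⊗_R N` given by a linear map `N ⟶ M⁺`. -/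
def tensorCharR {M : ModuleCat.{u} Rᵐᵒᵖ} {N : ModuleCat.{u} R} (g : N ⟶ dualR M) :
    TensorOver R M N →+ QZ :=
  QuotientAddGroup.lift _ (TensorProduct.liftAddHom
      (((evR (M := M)).comp g.hom.toAddMonoidHom).flip) (fun r m n => by simp)) <| by
    rw [balancing, AddSubgroup.closure_le]
    rintro _ ⟨m, r, n, rfl⟩
    change _ = _
    rw [map_sub, sub_eq_zero]
    change evR (g.hom n) (MulOpposite.op r • m) = evR (g.hom (r • n)) m
    rw [map_smul g.hom, evR_smul]

lemma mk_tmul_smul (M : ModuleCat.{u} Rᵐᵒᵖ) (N : ModuleCat.{u} R) (r : R) (m : M) (n : N) :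
    (QuotientAddGroup.mk (TensorProduct.tmul ℤ m (r • n)) : TensorOver R M N) =
      QuotientAddGroup.mk (TensorProduct.tmul ℤ (MulOpposite.op r • m) n) := by
  symm
  rw [← sub_eq_zero, ← QuotientAddGroup.mk_sub, QuotientAddGroup.eq_zero_iff]
  exact AddSubgroup.subset_closure ⟨m, r, n, rfl⟩

/-- The canonical biadditive map to `M ⊗_R N`. -/
def tensorMk (M : ModuleCat.{u} Rᵐᵒᵖ) (N : ModuleCat.{u} R) : N →+ M →+ TensorOver R M N :=
  AddMonoidHom.mk' (fun n => AddMonoidHom.mk'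
    (fun m => QuotientAddGroup.mk (TensorProduct.tmul ℤ m n))
    (fun m m' => by rw [TensorProduct.add_tmul, QuotientAddGroup.mk_add]))
    (fun x y => by
      ext m
      exact congrArg QuotientAddGroup.mk (TensorProduct.tmul_add m x y))

/-- The linear map `N ⟶ M⁺` given by a character of `M ⊗_R N`. -/
def homOfTensorCharR {M : ModuleCat.{u} Rᵐᵒᵖ} {N : ModuleCat.{u} R}
    (χ : TensorOver R M N →+ QZ) : N ⟶ dualR M :=
  mkHom
    { toFun n := mkR (χ.comp (tensorMk M N n))
      map_add' n n' := dualR_ext fun m => by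
        rw [map_add, AddMonoidHom.comp_add]; rfl
      map_smul' r n := dualR_ext fun m => congrArg χ (mk_tmul_smul M N r m n) }

/-- The linear map `M ⟶ N⁺` given by a character of `M ⊗_R N`. -/
def homOfTensorCharL {M : ModuleCat.{u} Rᵐᵒᵖ} {N : ModuleCat.{u} R}
    (χ : TensorOver R M N →+ QZ) : M ⟶ dualL N :=
  mkHom
    { toFun m := mkL (χ.comp ((tensorMk M N).flip m))
      map_add' n n' := dualL_ext fun m => by
        rw [map_add, AddMonoidHom.comp_add]; rfl
      map_smul' r m := dualL_ext fun n => congrArg χ (mk_tmul_smul M N r.unop m n).symm }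

/-- The character of `M ⊗_R N` given by a linear map `M ⟶ N⁺`. -/
def tensorCharL {M : ModuleCat.{u} Rᵐᵒᵖ} {N : ModuleCat.{u} R} (g : M ⟶ dualL N) :
    TensorOver R M N →+ QZ :=
  tensorCharR (unitL N ≫ dualRMap g)

lemma tensor_char_ext {M : ModuleCat.{u} Rᵐᵒᵖ} {N : ModuleCat.{u} R}
    {A : Type*} [AddCommGroup A] {a b : TensorOver R M N →+ A}
    (h : ∀ (m : M) (n : N), a (QuotientAddGroup.mk (TensorProduct.tmul ℤ m n)) =
      b (QuotientAddGroup.mk (TensorProduct.tmul ℤ m n))) : a = b := by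
  refine QuotientAddGroup.addMonoidHom_ext _ ?_
  ext x
  induction x with
  | zero => simp
  | add x y hx hy => rw [map_add, map_add, hx, hy]
  | tmul m n => exact h m n

/-- Character modules are pure-injective. -/
lemma isPureInjective_dualR (M : ModuleCat.{u} Rᵐᵒᵖ) : IsPureInjective R (dualR M) := by
  intro A B f hf g
  obtain ⟨χ, hχ⟩ := exists_character_extension (((tensor R).obj M).map f).hom (hf M) (tensorCharR g)
  exact ⟨homOfTensorCharR χ, dualR_hom_ext fun a m =>
    hχ (QuotientAddGroup.mk (TensorProduct.tmul ℤ m a))⟩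

end Characters

/-! ### Purity and systems of linear equations -/

section Purity

open TensorProduct

/-- A vanishing criterion for elements of a tensor product of abelian groups. -/
lemma exists_of_sum_tmul_eq_zero {M N : Type*} [AddCommGroup M] [AddCommGroup N] {ι : Type*}
    [Fintype ι] (m : ι → M) (n : ι → N) (h : ∑ i, m i ⊗ₜ[ℤ] n i = 0) :
    ∃ (k l : ℕ) (a : ι → Fin k → ℤ) (b : Fin l → Fin k → ℤ) (y : Fin k → N) (μ : Fin l → M),
      (∀ i, n i = ∑ j, a i j • y j) ∧ (∀ e, ∑ j, b e j • y j = 0) ∧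
      ∀ j, ∑ i, a i j • m i + ∑ e, b e j • μ e = 0 := by
  classical
  let P : Submodule ℤ M := Submodule.span ℤ (Set.range m)
  have hP : P.FG := Submodule.fg_span (Set.finite_range m)
  let m' : ι → P := fun i => ⟨m i, Submodule.subset_span ⟨i, rfl⟩⟩
  -- The sum already vanishes over some finitely generated `Q`. The criterion for a trivial
  -- vanishing wants generators of `Q`, so they are adjoined with partner `0`; they become the `μ`.
  obtain ⟨Q, hPQ, ⟨s, hs⟩, hQ⟩ := TensorProduct.eq_zero_of_fg_of_subtype_eq_zero hP
    (t := ∑ i, m' i ⊗ₜ[ℤ] n i) (by simpa [m'] using h)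
  let e := s.equivFin
  have hs' : ∀ x : s, (x : M) ∈ Q := fun x => hs ▸ Submodule.subset_span x.2
  let m'' : ι ⊕ s → Q := Sum.elim (fun i => Submodule.inclusion hPQ (m' i)) fun x => ⟨x, hs' x⟩
  have hspan : Submodule.span ℤ (Set.range m'') = ⊤ := by
    apply Submodule.map_injective_of_injective Q.injective_subtype
    rw [Submodule.map_span, Submodule.map_top, Submodule.range_subtype]
    apply le_antisymm
    · rw [Submodule.span_le]
      rintro _ ⟨x, _, rfl⟩
      exact x.2
    · refine hs.symm.le.trans (Submodule.span_le.2 fun x hx => ?_)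
      exact Submodule.subset_span ⟨m'' (Sum.inr ⟨x, hx⟩), ⟨_, rfl⟩, rfl⟩
  obtain ⟨k, a, y, h₁, h₂⟩ := TensorProduct.vanishesTrivially_of_sum_tmul_eq_zero ℤ
    (m := m'') (n := Sum.elim n fun _ => 0) hspan (by
      rw [Fintype.sum_sum_type]
      simpa [m''] using hQ)
  refine ⟨k, s.card, fun i j => a (Sum.inl i) j, fun i j => a (Sum.inr (e.symm i)) j, y,
    fun i => e.symm i, fun i => h₁ (Sum.inl i), fun i => (h₁ (Sum.inr (e.symm i))).symm,
    fun j => ?_⟩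
  have := congrArg (Submodule.subtype Q) (h₂ j)
  rw [Fintype.sum_sum_type, map_add, map_sum, map_sum] at this
  rw [e.symm.sum_comp (fun x : s => a (Sum.inr x) j • (x : M))]
  exact this

variable {R : Type u} [Ring R]

lemma exists_sum_of_mem_balancing {M : ModuleCat.{u} Rᵐᵒᵖ} {N : ModuleCat.{u} R}
    {t : M ⊗[ℤ] N} (ht : t ∈ balancing R M N) :
    ∃ (l : ℕ) (m : Fin l → M) (r : Fin l → R) (n : Fin l → N),
      t = ∑ i, ((MulOpposite.op (r i) • m i) ⊗ₜ[ℤ] n i - m i ⊗ₜ[ℤ] (r i • n i)) := by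
  induction ht using AddSubgroup.closure_induction with
  | mem x hx =>
    obtain ⟨m, r, n, rfl⟩ := hx
    exact ⟨1, fun _ => m, fun _ => r, fun _ => n, by simp⟩
  | zero => exact ⟨0, Fin.elim0, Fin.elim0, Fin.elim0, by simp⟩
  | add x y _ _ hx hy =>
    obtain ⟨l, m, r, n, rfl⟩ := hx
    obtain ⟨l', m', r', n', rfl⟩ := hy
    exact ⟨l + l', Fin.append m m', Fin.append r r', Fin.append n n', by
      simp only [Fin.sum_univ_add, Fin.append_left, Fin.append_right]⟩
  | neg x _ hx =>
    obtain ⟨l, m, r, n, rfl⟩ := hx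
    refine ⟨l, fun i => - m i, r, n, ?_⟩
    rw [← Finset.sum_neg_distrib]
    refine Finset.sum_congr rfl fun i _ => ?_
    rw [smul_neg, TensorProduct.neg_tmul, TensorProduct.neg_tmul]
    abel

/-- A vanishing criterion for elements of `M ⊗_R N`. -/
lemma exists_of_tensor_eq_zero {M : ModuleCat.{u} Rᵐᵒᵖ} {N : ModuleCat.{u} R} {ι : Type*}
    [Fintype ι] (m : ι → M) (n : ι → N)
    (h : (QuotientAddGroup.mk (∑ i, m i ⊗ₜ[ℤ] n i) : TensorOver R M N) = 0) :
    ∃ (k : ℕ) (κ : Type) (_ : Fintype κ) (a : ι → Fin k → R) (b : κ → Fin k → R) (y : Fin k → N)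
      (μ : κ → M),
      (∀ i, n i = ∑ j, a i j • y j) ∧ (∀ e, ∑ j, b e j • y j = 0) ∧
      ∀ j, ∑ i, MulOpposite.op (a i j) • m i + ∑ e, MulOpposite.op (b e j) • μ e = 0 := by
  classical
  obtain ⟨l, m', r, n', h'⟩ := exists_sum_of_mem_balancing ((QuotientAddGroup.eq_zero_iff _).1 h)
  -- Moving the balancing relations to the left gives one vanishing sum over ℤ, built from the given
  -- tensors, the `-(m' r) ⊗ n'` and the `m' ⊗ r n'`.
  obtain ⟨k, l', a, b, y, μ, h₁, h₂, h₃⟩ := exists_of_sum_tmul_eq_zero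
    (Sum.elim m (Sum.elim (fun i => - (MulOpposite.op (r i) • m' i)) m'))
    (Sum.elim n (Sum.elim n' (fun i => r i • n' i))) (by
      simp only [Fintype.sum_sum_type, Sum.elim_inl, Sum.elim_inr]
      rw [h', ← Finset.sum_add_distrib, ← Finset.sum_add_distrib]
      refine Finset.sum_eq_zero fun i _ => ?_
      rw [TensorProduct.neg_tmul]
      abel)
  -- The criterion expresses both `n'` and `r n'` through the `y j`. Comparing `r` times the first
  -- expression with the second gives the additional relations of index `Sum.inl`, with multipliers
  -- `-m'`.
  refine ⟨k, Fin l ⊕ Fin l', inferInstance, fun i j => (a (Sum.inl i) j : R),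
    Sum.elim (fun i j => r i * (a (.inr (.inl i)) j : R) - (a (.inr (.inr i)) j : R))
      (fun e j => (b e j : R)), y, Sum.elim (fun i => - m' i) μ, fun i => ?_, ?_, fun j => ?_⟩
  · simpa only [Int.cast_smul_eq_zsmul, Sum.elim_inl] using h₁ (Sum.inl i)
  · rintro (i | e)
    · have e₁ : n' i = _ := h₁ (.inr (.inl i))
      have e₂ : r i • n' i = _ := h₁ (.inr (.inr i))
      simp only [Sum.elim_inl, sub_smul, mul_smul, Int.cast_smul_eq_zsmul, Finset.sum_sub_distrib]
      rw [← e₂, ← Finset.smul_sum, ← e₁, sub_self]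
    · simpa only [Int.cast_smul_eq_zsmul, Sum.elim_inr] using h₂ e
  · have := h₃ j
    simp only [Fintype.sum_sum_type, Sum.elim_inl, Sum.elim_inr] at this ⊢
    rw [← this]
    simp only [MulOpposite.op_sub, MulOpposite.op_mul, MulOpposite.op_intCast, sub_smul, mul_smul,
      Int.cast_smul_eq_zsmul, smul_neg, add_assoc, ← Finset.sum_add_distrib]
    congr 2
    refine Finset.sum_congr rfl fun i _ => ?_
    abel

/-- A linear map along which the solutions of finite systems of linear equations lift. -/
def LiftsSystems {N N' : ModuleCat.{u} R} (φ : N ⟶ N') (S : Submodule R N') : Prop :=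
  ∀ (n m : ℕ) (a : Fin m → Fin n → R) (x : Fin n → N'), (∀ i, x i ∈ S) →
    (∀ l, ∑ i, a l i • x i = 0) →
      ∃ y : Fin n → N, (∀ l, ∑ i, a l i • y i = 0) ∧ ∀ i, φ.hom (y i) = x i

lemma LiftsSystems.exists_lift {N N' : ModuleCat.{u} R} {φ : N ⟶ N'} {S : Submodule R N'}
    (h : LiftsSystems φ S) {ι κ : Type*} [Fintype ι] [Fintype κ] (a : κ → ι → R) (x : ι → N')
    (hx : ∀ i, x i ∈ S) (hax : ∀ l, ∑ i, a l i • x i = 0) :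
    ∃ y : ι → N, (∀ l, ∑ i, a l i • y i = 0) ∧ ∀ i, φ.hom (y i) = x i := by
  classical
  let e := Fintype.equivFin ι
  let e' := Fintype.equivFin κ
  obtain ⟨y, h₁, h₂⟩ := h _ _ (fun l i => a (e'.symm l) (e.symm i)) (x ∘ e.symm) (fun i => hx _)
    (fun l => by
      rw [← hax (e'.symm l)]
      exact e.symm.sum_comp (fun i => a (e'.symm l) i • x i))
  refine ⟨y ∘ e, fun l => ?_, fun i => ?_⟩
  · have := h₁ (e' l)
    rw [← this, ← e.sum_comp]
    simp
  · rw [Function.comp_apply, h₂]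
    simp

/-- The kernel of a map along which solutions of systems lift is pure. -/
lemma LiftsSystems.isPureMono {A B C : ModuleCat.{u} R} {f : A ⟶ B} {g : B ⟶ C}
    (hf : Function.Injective f.hom) (hfg : ∀ b, g.hom b = 0 ↔ ∃ a, f.hom a = b)
    {S : Submodule R C} (hS : ∀ b, g.hom b ∈ S) (h : LiftsSystems g S) : IsPureMono R f := by
  intro M
  rw [injective_iff_map_eq_zero]
  intro t ht
  obtain ⟨t, rfl⟩ := QuotientAddGroup.mk_surjective t
  obtain ⟨p, m, n, rfl⟩ := TensorProduct.exists_sum_tmul_eq t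
  have ht' : (QuotientAddGroup.mk (∑ i, m i ⊗ₜ[ℤ] f.hom (n i)) : TensorOver R M B) = 0 := by
    refine Eq.trans ?_ ht
    change _ = QuotientAddGroup.mk (TensorProduct.map _ _ (∑ i, m i ⊗ₜ[ℤ] n i))
    rw [map_sum]
    rfl
  obtain ⟨k, κ, _, a, b, y, μ, h₁, h₂, h₃⟩ := exists_of_tensor_eq_zero _ _ ht'
  -- Since `g` kills the image of `f`, the elements `g (y j)` solve the homogeneous system with rows
  -- `a` and `b`. Subtracting a lifted solution `w` moves the `y j` into `A` without changing the
  -- equations.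
  obtain ⟨w, hw₁, hw₂⟩ := h.exists_lift (Sum.elim a b) (fun j => g.hom (y j)) (fun j => hS _) (by
    rintro (i | e)
    · simp only [Sum.elim_inl, ← map_smul, ← map_sum]
      rw [← h₁, hfg]
      exact ⟨_, rfl⟩
    · simp only [Sum.elim_inr, ← map_smul, ← map_sum]
      rw [h₂, map_zero])
  have hz : ∀ j, ∃ z, f.hom z = y j - w j := fun j => by
    rw [← hfg, map_sub, hw₂, sub_self]
  choose z hz using hz
  have e₁ : ∀ i, n i = ∑ j, a i j • z j := fun i => hf (by
    have := hw₁ (.inl i)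
    simp only [Sum.elim_inl] at this
    rw [map_sum, h₁]
    simp only [map_smul, hz, smul_sub, Finset.sum_sub_distrib]
    rw [this, sub_zero])
  have e₂ : ∀ e, ∑ j, b e j • z j = 0 := fun e => hf (by
    have := hw₁ (.inr e)
    simp only [Sum.elim_inr] at this
    rw [map_sum, map_zero]
    simp only [map_smul, hz, smul_sub, Finset.sum_sub_distrib]
    rw [this, h₂, sub_zero])
  -- Coefficients pass across the tensor sign, so that the sum is regrouped by the `z j`; each `z j`
  -- is then paired with an expression that is zero by `h₃`.
  have key : ∀ (ι : Type) [Fintype ι] (c : ι → Fin k → R) (q : ι → M),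
      ∑ i, tensorMk M A (∑ j, c i j • z j) (q i) =
        ∑ j, tensorMk M A (z j) (∑ i, MulOpposite.op (c i j) • q i) := by
    intro ι _ c q
    simp only [map_sum, AddMonoidHom.finsetSum_apply]
    rw [Finset.sum_comm]
    exact Finset.sum_congr rfl fun j _ => Finset.sum_congr rfl fun i _ =>
      mk_tmul_smul M A (c i j) (q i) (z j)
  have e₃ : (QuotientAddGroup.mk (∑ i, m i ⊗ₜ[ℤ] n i) : TensorOver R M A) =
      ∑ i, tensorMk M A (n i) (m i) :=
    map_sum (QuotientAddGroup.mk' (balancing R M A)) _ _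
  rw [e₃]
  have := key κ b μ
  simp only [e₂, map_zero, AddMonoidHom.zero_apply, Finset.sum_const_zero] at this
  rw [Finset.sum_congr rfl fun i _ => by rw [e₁ i], key (Fin p) a m, ← add_zero (∑ j, _), this,
    ← Finset.sum_add_distrib]
  refine Finset.sum_eq_zero fun j _ => ?_
  rw [← map_add, h₃]
  exact map_zero (tensorMk M A (z j))

/-- Solutions of systems lift along `φ` if they lift along the bidual of `φ`. -/
lemma exists_lift_of_bidual {N N' : ModuleCat.{u} R} (φ : N ⟶ N') {n m : ℕ}
    (a : Fin m → Fin n → R) (v : Fin n → N') (w : Fin n → dualR (dualL N))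
    (hw : ∀ l, ∑ i, a l i • w i = 0)
    (h : ∀ i, (dualRMap (dualLMap φ)).hom (w i) = (unitL N').hom (v i)) :
    ∃ x : Fin n → N, (∀ l, ∑ i, a l i • x i = 0) ∧ ∀ i, φ.hom (x i) = v i := by
  classical
  -- A solution is a preimage of `(0, v)`. Otherwise a character kills the range of `T` but not `(0,
  -- v)`. Its components satisfy `φ⁺ ψ i = -∑ c l · a l i`, and pairing this with `w` contradicts `∑
  -- i, a l i • w i = 0`.
  let T : (Fin n → N) →+ (Fin m → N) × (Fin n → N') :=
    AddMonoidHom.mk' (fun x => (fun l => ∑ i, a l i • x i, fun i => φ.hom (x i))) (fun x y => by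
      ext <;> simp [smul_add, Finset.sum_add_distrib])
  by_cases hT : ((0, v) : (Fin m → N) × (Fin n → N')) ∈ T.range
  · obtain ⟨x, hx⟩ := hT
    exact ⟨x, fun l => congrFun (congrArg Prod.fst hx) l,
      fun i => congrFun (congrArg Prod.snd hx) i⟩
  · exfalso
    obtain ⟨χ, h₁, h₂⟩ := exists_character_ne_zero _ hT
    let c : Fin m → dualL N := fun l =>
      mkL (χ.comp ((AddMonoidHom.inl _ _).comp (AddMonoidHom.single (fun _ => N) l)))
    let ψ : Fin n → dualL N' := fun i =>
      mkL (χ.comp ((AddMonoidHom.inr _ _).comp (AddMonoidHom.single (fun _ => N') i)))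
    have hχ : ∀ p q, χ (p, q) = ∑ l, evL (c l) (p l) + ∑ i, evL (ψ i) (q i) := by
      intro p q
      have e : ((p, q) : (Fin m → N) × (Fin n → N')) =
          ∑ l, (Pi.single l (p l), 0) + ∑ i, (0, Pi.single i (q i)) := by
        ext j
        · simp [Prod.fst_sum, Finset.sum_apply]
        · simp [Prod.snd_sum, Finset.sum_apply]
      rw [e, map_add, map_sum, map_sum]
      rfl
    have hψ : ∀ i, (dualLMap φ).hom (ψ i) = - ∑ l, MulOpposite.op (a l i) • c l := by
      intro i
      rw [eq_neg_iff_add_eq_zero]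
      refine dualL_ext fun x => ?_
      have := h₁ _ ⟨Pi.single i x, rfl⟩
      rw [show T (Pi.single i x) = (fun l => a l i • x, Pi.single i (φ.hom x)) by
        ext j
        · change ∑ k, a j k • (Pi.single i x : Fin n → N) k = _
          rw [Finset.sum_eq_single i]
          · simp
          · intro k _ hk; simp [hk]
          · simp
        · change φ.hom ((Pi.single i x : Fin n → N) j) = (Pi.single i (φ.hom x) : Fin n → N') j
          by_cases hj : j = i
          · subst hj; simp
          · simp [hj], hχ] at this
      have e : ∑ j, evL (ψ j) ((Pi.single i (φ.hom x) : Fin n → N') j) = evL (ψ i) (φ.hom x) := by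
        rw [Finset.sum_eq_single i]
        · simp
        · intro k _ hk; simp [hk]
        · simp
      rw [e] at this
      rw [map_add, map_sum, AddMonoidHom.add_apply, AddMonoidHom.finsetSum_apply, add_comm]
      exact this
    apply h₂
    rw [hχ]
    simp only [Pi.zero_apply, map_zero, Finset.sum_const_zero, zero_add]
    have e₁ : ∀ i, evL (ψ i) (v i) = - ∑ l, evR (a l i • w i) (c l) := fun i => by
      rw [← evR_unitL, ← h]
      change evR (w i) ((dualLMap φ).hom (ψ i)) = _
      rw [hψ, map_neg, map_sum]
      rfl
    rw [Finset.sum_congr rfl fun i _ => e₁ i, Finset.sum_neg_distrib, Finset.sum_comm,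
      neg_eq_zero]
    refine Finset.sum_eq_zero fun l _ => ?_
    rw [← AddMonoidHom.finsetSum_apply, ← map_sum, hw, map_zero, AddMonoidHom.zero_apply]

end Purity

/-! ### Null-homotopic morphisms -/

section NullHomotopic

variable {V : Type*} [Category* V] [Preadditive V]

/-- The family `t` may take arbitrary values outside the degrees that a homotopy uses: the
truncation is made here once, which leaves witnesses free of side conditions. -/
lemma quotient_map_eq_zero_iff {X Y : CochainComplex V ℤ} (f : X ⟶ Y) :
    (HomotopyCategory.quotient V (ComplexShape.up ℤ)).map f = 0 ↔
      ∃ t : ∀ i j, X.X i ⟶ Y.X j, ∀ i j k, i + 1 = j → j + 1 = k →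
        f.f j = X.d j k ≫ t k j + t j i ≫ Y.d i j := by
  constructor
  · intro h
    let H := HomotopyCategory.homotopyOfEq f 0 (h.trans (Functor.map_zero _ _ _).symm)
    refine ⟨H.hom, fun i j k hij hjk => ?_⟩
    have := H.comm j
    rw [dNext_eq H.hom (show (ComplexShape.up ℤ).Rel j k from hjk),
      prevD_eq H.hom (show (ComplexShape.up ℤ).Rel i j from hij)] at this
    simpa using this
  · rintro ⟨t, ht⟩
    rw [← Functor.map_zero (HomotopyCategory.quotient V (ComplexShape.up ℤ))]
    refine HomotopyCategory.eq_of_homotopy _ _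
      { hom i j := if j + 1 = i then t i j else 0
        zero i j hij := if_neg hij
        comm j := ?_ }
    rw [dNext_eq _ (show (ComplexShape.up ℤ).Rel j (j + 1) from rfl),
      prevD_eq _ (show (ComplexShape.up ℤ).Rel (j - 1) j from sub_add_cancel j 1)]
    rw [ht (j - 1) j (j + 1) (by lia) rfl]
    simp

lemma isZero_quotient_iff {Y : CochainComplex V ℤ} :
    IsZero ((HomotopyCategory.quotient V (ComplexShape.up ℤ)).obj Y) ↔
      ∃ t : ∀ i j, Y.X i ⟶ Y.X j, ∀ i j k, i + 1 = j → j + 1 = k →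
        𝟙 (Y.X j) = Y.d j k ≫ t k j + t j i ≫ Y.d i j := by
  rw [IsZero.iff_id_eq_zero, ← CategoryTheory.Functor.map_id, quotient_map_eq_zero_iff]
  rfl

/-- A complex is contractible if all covariant Hom complexes out of objects are exact. -/
lemma exists_contraction {W : Type*} [Category* W] [Abelian W] {ι : Type*} {c : ComplexShape ι}
    (Y : HomologicalComplex W c) (hc : ∀ i, ∃ j, c.Rel i j)
    (h : ∀ i j k, c.Rel i j → c.Rel j k → ∀ (M : W) (f : M ⟶ Y.X j), f ≫ Y.d j k = 0 →
      ∃ g : M ⟶ Y.X i, g ≫ Y.d i j = f) :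
    ∃ t : ∀ i j, Y.X i ⟶ Y.X j, ∀ i j k, c.Rel i j → c.Rel j k →
      𝟙 (Y.X j) = Y.d j k ≫ t k j + t j i ≫ Y.d i j := by
  classical
  choose nx hnx using hc
  have hnx' : ∀ {i j}, c.Rel i j → j = nx i := fun h => c.next_eq h (hnx _)
  -- Exactness is applied to the inclusion of the cocycles itself. The lifts `s` split the complex,
  -- `q` is the resulting projection to cocycles, and `q` followed by `s` is the contraction.
  choose s hs using fun i => h i (nx i) (nx (nx i)) (hnx _) (hnx _) (kernel (Y.d (nx i) (nx (nx i))))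
    (kernel.ι _) (kernel.condition _)
  let p : ∀ i, Y.X i ⟶ kernel (Y.d (nx i) (nx (nx i))) := fun i => kernel.lift _ (Y.d i (nx i))
    (Y.d_comp_d _ _ _)
  have hp : ∀ i, p i ≫ kernel.ι _ = Y.d i (nx i) := fun i => kernel.lift_ι _ _ _
  have hker : ∀ i, kernel.ι (Y.d i (nx i)) ≫ p i = 0 := fun i => by
    rw [← cancel_mono (kernel.ι (Y.d (nx i) (nx (nx i)))), Category.assoc, hp, kernel.condition,
      zero_comp]
  let q : ∀ i, Y.X i ⟶ kernel (Y.d i (nx i)) := fun i => kernel.lift _ (𝟙 _ - p i ≫ s i) (by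
    rw [Preadditive.sub_comp, Category.id_comp, Category.assoc, hs, hp, sub_self])
  have hq : ∀ i, q i ≫ kernel.ι _ = 𝟙 _ - p i ≫ s i := fun i => kernel.lift_ι _ _ _
  have hq' : ∀ i, kernel.ι _ ≫ q i = 𝟙 _ := fun i => by
    rw [← cancel_mono (kernel.ι (Y.d i (nx i))), Category.assoc, hq, Preadditive.comp_sub,
      ← Category.assoc, hker, zero_comp, sub_zero, Category.comp_id, Category.id_comp]
  let t : ∀ i j, Y.X i ⟶ Y.X j := fun i j =>
    if h : i = nx j then eqToHom (by rw [h]) ≫ q (nx j) ≫ s j else 0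
  have ht : ∀ i, t (nx i) i = q (nx i) ≫ s i := fun i => by simp [t]
  refine ⟨t, fun i j k hij hjk => ?_⟩
  obtain rfl := hnx' hij
  obtain rfl := hnx' hjk
  rw [ht, ht, Category.assoc, hs, hq, ← hp, Category.assoc, reassoc_of% hq']
  abel

end NullHomotopic

/-! ### Pure acyclic complexes -/

section PureAcyclic

variable {R : Type u} [Ring R]

/-- A complex `X` such that solutions of systems of equations lift from cocycles. -/
def LiftsCocycles (X : CochainComplex (ModuleCat.{u} R) ℤ) : Prop :=
  ∀ i j k : ℤ, i + 1 = j → j + 1 = k → LiftsSystems (X.d i j) (LinearMap.ker (X.d j k).hom)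

lemma acyclic_iff_ab {X : CochainComplex AddCommGrpCat.{u} ℤ} :
    X.Acyclic ↔ ∀ i j k : ℤ, i + 1 = j → j + 1 = k → ∀ x : X.X j, (X.d j k).hom x = 0 →
      ∃ y, (X.d i j).hom y = x := by
  have key : ∀ i j k : ℤ, i + 1 = j → j + 1 = k →
      (X.ExactAt j ↔ ∀ x : X.X j, (X.d j k).hom x = 0 → ∃ y, (X.d i j).hom y = x) := by
    intro i j k hij hjk
    rw [X.exactAt_iff' i j k (by simp; lia) (by simp; lia)]
    exact ShortComplex.ab_exact_iff _
  exact ⟨fun h i j k hij hjk => (key i j k hij hjk).1 (h j),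
    fun h j => (key (j - 1) j (j + 1) (by lia) rfl).2 (h _ _ _ (by lia) rfl)⟩

lemma acyclic_iff {S : Type u} [Ring S] {X : CochainComplex (ModuleCat.{u} S) ℤ} :
    X.Acyclic ↔ ∀ i j k : ℤ, i + 1 = j → j + 1 = k → ∀ x : X.X j, (X.d j k).hom x = 0 →
      ∃ y, (X.d i j).hom y = x := by
  have key : ∀ i j k : ℤ, i + 1 = j → j + 1 = k →
      (X.ExactAt j ↔ ∀ x : X.X j, (X.d j k).hom x = 0 → ∃ y, (X.d i j).hom y = x) := by
    intro i j k hij hjk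
    rw [X.exactAt_iff' i j k (by simp; lia) (by simp; lia)]
    exact ShortComplex.moduleCat_exact_iff _
  exact ⟨fun h i j k hij hjk => (key i j k hij hjk).1 (h j),
    fun h j => (key (j - 1) j (j + 1) (by lia) rfl).2 (h _ _ _ (by lia) rfl)⟩

lemma isPureAcyclic_iff {X : CochainComplex (ModuleCat.{u} R) ℤ} :
    IsPureAcyclic R X ↔ ∀ (M : ModuleCat.{u} Rᵐᵒᵖ) (i j k : ℤ), i + 1 = j → j + 1 = k →
      ∀ x : TensorOver R M (X.X j), tensorMap (𝟙 M) (X.d j k) x = 0 →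
        ∃ y, tensorMap (𝟙 M) (X.d i j) y = x :=
  forall_congr' fun _ => acyclic_iff_ab

/-- The complex of character modules of a complex of left modules, with the differentials in the
opposite direction. -/
def dualLDown (X : CochainComplex (ModuleCat.{u} R) ℤ) :
    HomologicalComplex (ModuleCat.{u} Rᵐᵒᵖ) (ComplexShape.down ℤ) where
  X i := dualL (X.X i)
  d i j := dualLMap (X.d j i)
  shape i j hij := by rw [X.shape _ _ hij, dualLMap_zero]
  d_comp_d' i j k _ _ := by rw [← dualLMap_comp, X.d_comp_d, dualLMap_zero]

/-- The bidual of a pure acyclic complex is contractible. -/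
lemma IsPureAcyclic.exists_contraction_bidual {X : CochainComplex (ModuleCat.{u} R) ℤ}
    (hX : IsPureAcyclic R X) :
    ∃ t : ∀ i j, dualR (dualL (X.X i)) ⟶ dualR (dualL (X.X j)), ∀ i j k, i + 1 = j → j + 1 = k →
      𝟙 _ = dualRMap (dualLMap (X.d j k)) ≫ t k j + t j i ≫ dualRMap (dualLMap (X.d i j)) := by
  -- Maps from `M` to the dual of `X` are characters of `M ⊗_R X`, which is exact. So the dual
  -- itself is contractible, and dualising its contraction contracts the bidual.
  obtain ⟨t, ht⟩ := exists_contraction (dualLDown X) (fun i => ⟨i - 1, by simp⟩) (by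
    intro i j k hij hjk M f hf
    obtain ⟨χ, hχ⟩ := characters_of_exact (tensorMap (𝟙 M) (X.d k j)) (tensorMap (𝟙 M) (X.d j i))
      (isPureAcyclic_iff.1 hX M k j i hjk hij) (tensorCharL f) (DFunLike.congr_fun
        (f := (tensorCharL f).comp (tensorMap (𝟙 M) (X.d k j))) (g := 0)
        (tensor_char_ext fun m n => congrArg (fun φ => evL (φ.hom m) n) hf))
    exact ⟨homOfTensorCharL χ, dualL_hom_ext fun m n =>
      hχ (QuotientAddGroup.mk (TensorProduct.tmul ℤ m n))⟩)
  refine ⟨fun i j => dualRMap (t j i), fun i j k hij hjk => ?_⟩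
  have := congrArg dualRMap (ht k j i hjk hij)
  rw [dualRMap_add, add_comm] at this
  exact this

/-- A contraction of the bidual lifts its cocycles linearly, hence lifts solutions of systems;
`exists_lift_of_bidual` brings the lifts back to `X`. -/
lemma IsPureAcyclic.liftsCocycles {X : CochainComplex (ModuleCat.{u} R) ℤ}
    (hX : IsPureAcyclic R X) : LiftsCocycles X := by
  obtain ⟨t, ht⟩ := hX.exists_contraction_bidual
  intro i j k hij hjk n m a x hx hax
  refine exists_lift_of_bidual (X.d i j) a x (fun l => (t j i).hom ((unitL _).hom (x l))) ?_ ?_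
  · intro l
    simp only [← map_smul, ← map_sum]
    rw [hax, map_zero, map_zero]
  · intro l
    have h : (unitL (X.X j)).hom (x l) = _ :=
      congrArg (fun f => f.hom ((unitL (X.X j)).hom (x l))) (ht i j k hij hjk)
    refine Eq.trans ?_ h.symm
    have h0 : (dualRMap (dualLMap (X.d j k))).hom ((unitL (X.X j)).hom (x l)) = 0 := by
      change (unitL (X.X k)).hom ((X.d j k).hom (x l)) = 0
      rw [show (X.d j k).hom (x l) = 0 from hx l, map_zero]
    change _ = (t k j).hom ((dualRMap (dualLMap (X.d j k))).hom ((unitL (X.X j)).hom (x l))) + _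
    rw [h0, map_zero, zero_add]
    rfl

lemma LiftsCocycles.exists_lift {X : CochainComplex (ModuleCat.{u} R) ℤ}
    (hX : LiftsCocycles X) {i j k : ℤ} (hij : i + 1 = j) (hjk : j + 1 = k) (x : X.X j)
    (hx : (X.d j k).hom x = 0) : ∃ y, (X.d i j).hom y = x := by
  obtain ⟨y, -, hy⟩ := hX i j k hij hjk 1 0 Fin.elim0 (fun _ => x) (fun _ => hx) (fun l => l.elim0)
  exact ⟨y 0, hy 0⟩

lemma LiftsCocycles.acyclic {X : CochainComplex (ModuleCat.{u} R) ℤ}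
    (hX : LiftsCocycles X) : X.Acyclic :=
  acyclic_iff.2 fun _ _ _ hij hjk x hx => hX.exists_lift hij hjk x hx

/-- A linear map vanishing on the kernel of a surjection factors through it. -/
lemma exists_factor_of_surjective {A B C : ModuleCat.{u} R} (p : A ⟶ B) (h : A ⟶ C)
    (hp : Function.Surjective p.hom) (hh : ∀ a, p.hom a = 0 → h.hom a = 0) :
    ∃ q : B ⟶ C, p ≫ q = h := by
  refine ⟨mkHom ((LinearMap.ker p.hom).liftQ h.hom hh ∘ₗ
    (p.hom.quotKerEquivOfSurjective hp).symm.toLinearMap), ?_⟩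
  ext a
  have : (p.hom.quotKerEquivOfSurjective hp).symm (p.hom a) = Submodule.Quotient.mk a := by
    rw [LinearEquiv.symm_apply_eq]
    rfl
  exact (congrArg ((LinearMap.ker p.hom).liftQ h.hom hh) this).trans (Submodule.liftQ_apply _ _ _)

/-- The cocycles of degree `k` of a complex. -/
abbrev cocyclesIncl (X : CochainComplex (ModuleCat.{u} R) ℤ) (k l : ℤ) :
    ModuleCat.of R (LinearMap.ker (X.d k l).hom) ⟶ X.X k :=
  ModuleCat.ofHom (LinearMap.ker (X.d k l).hom).subtype

lemma LiftsCocycles.isPureMono {X : CochainComplex (ModuleCat.{u} R) ℤ}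
    (hX : LiftsCocycles X) {k l m : ℤ} (hkl : k + 1 = l) (hlm : l + 1 = m) :
    IsPureMono R (cocyclesIncl X k l) := by
  refine LiftsSystems.isPureMono (g := X.d k l) Subtype.val_injective (fun b => ?_)
    (fun b => ?_) (hX k l m hkl hlm)
  · exact ⟨fun h => ⟨⟨b, h⟩, rfl⟩, fun ⟨a, ha⟩ => ha ▸ a.2⟩
  · exact congrArg (fun f => f.hom b) (X.d_comp_d k l m)

/-- Maps from such a complex to a pure-injective module extend from coboundaries. -/
lemma LiftsCocycles.exists_extension {X : CochainComplex (ModuleCat.{u} R) ℤ}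
    (hX : LiftsCocycles X) {i j k : ℤ} (hij : i + 1 = j) (hjk : j + 1 = k) {I : ModuleCat.{u} R}
    (hI : IsPureInjective R I) (h : X.X j ⟶ I) (hh : X.d i j ≫ h = 0) :
    ∃ h' : X.X k ⟶ I, X.d j k ≫ h' = h := by
  let p : X.X j ⟶ ModuleCat.of R (LinearMap.ker (X.d k (k + 1)).hom) :=
    ModuleCat.ofHom (LinearMap.codRestrict _ (X.d j k).hom fun x =>
      LinearMap.congr_fun (congrArg ModuleCat.Hom.hom (X.d_comp_d j k (k + 1))) x)
  obtain ⟨q, hq⟩ := exists_factor_of_surjective p h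
    (fun z => by
      obtain ⟨y, hy⟩ := hX.exists_lift hjk rfl z.1 z.2
      exact ⟨y, Subtype.ext hy⟩)
    (fun x hx => by
      obtain ⟨y, rfl⟩ := hX.exists_lift hij hjk x (congrArg Subtype.val hx)
      exact congrArg (fun f => f.hom y) hh)
  obtain ⟨h', hh'⟩ := hI _ (hX.isPureMono (k := k) rfl rfl) q
  exact ⟨h', by rw [← hq, ← hh']; rfl⟩

/-- Characters of `M ⊗_R X` are maps from `X` to the character module of `M`. That module is
pure-injective, so these maps extend from the coboundaries, which are pure. -/
lemma LiftsCocycles.isPureAcyclic {X : CochainComplex (ModuleCat.{u} R) ℤ}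
    (hX : LiftsCocycles X) : IsPureAcyclic R X := by
  rw [isPureAcyclic_iff]
  intro M i j k hij hjk x hx
  refine exact_of_characters _ (tensorMap (𝟙 M) (X.d j k)) (fun χ hχ => ?_) hx
  obtain ⟨h', hh'⟩ := hX.exists_extension hij hjk (isPureInjective_dualR M) (homOfTensorCharR χ)
    (dualR_hom_ext fun n m => hχ (QuotientAddGroup.mk (TensorProduct.tmul ℤ m n)))
  refine ⟨tensorCharR h', DFunLike.congr_fun (f := χ)
    (g := (tensorCharR h').comp (tensorMap (𝟙 M) (X.d j k))) (tensor_char_ext fun m n => ?_)⟩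
  exact (congrArg (fun f => evR (f.hom n) m) hh').symm

lemma isPureAcyclic_iff_liftsCocycles {X : CochainComplex (ModuleCat.{u} R) ℤ} :
    IsPureAcyclic R X ↔ LiftsCocycles X :=
  ⟨fun h => h.liftsCocycles, fun h => h.isPureAcyclic⟩

/-! ### Finitely presented test modules -/

/-- Finite systems of linear equations over `R`. -/
abbrev FpIndex (R : Type u) : Type u := Σ (n m : ℕ), Fin m → Fin n → R

/-- The finitely presented module defined by a system of equations. -/
abbrev fpModule (a : FpIndex R) : ModuleCat.{u} R :=
  ModuleCat.of R ((Fin a.1 → R) ⧸ Submodule.span R (Set.range a.2.2))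

/-- The map from a finitely presented module given by a solution of the equations. -/
lemma exists_fpModule_hom (a : FpIndex R) {N : ModuleCat.{u} R} (x : Fin a.1 → N)
    (hx : ∀ l, ∑ i, a.2.2 l i • x i = 0) :
    ∃ f : fpModule a ⟶ N, ∀ i, f.hom (Submodule.Quotient.mk (Pi.single i 1)) = x i := by
  classical
  refine ⟨ModuleCat.ofHom (Submodule.liftQ _ (Fintype.linearCombination R x) ?_), fun i => ?_⟩
  · rw [Submodule.span_le]
    rintro _ ⟨l, rfl⟩
    exact hx l
  · change Fintype.linearCombination R x (Pi.single i 1) = x i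
    simp

lemma fpModule_sum_eq_zero (a : FpIndex R) (l : Fin a.2.1) :
    ∑ i, a.2.2 l i • (Submodule.Quotient.mk (Pi.single i 1) : fpModule a) = 0 := by
  have h : ∑ i, a.2.2 l i • (Pi.single i 1 : Fin a.1 → R) = a.2.2 l := by
    ext j
    simp [Finset.sum_apply, Pi.single_apply]
  have := map_sum (Submodule.span R (Set.range a.2.2)).mkQ
    (fun i => a.2.2 l i • (Pi.single i 1 : Fin a.1 → R)) Finset.univ
  rw [h] at this
  refine Eq.trans ?_ (this.symm.trans ((Submodule.Quotient.mk_eq_zero _).2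
    (Submodule.subset_span ⟨l, rfl⟩)))
  rfl

lemma fpModule_hom_ext (a : FpIndex R) {N : ModuleCat.{u} R} {f g : fpModule a ⟶ N}
    (h : ∀ i, f.hom (Submodule.Quotient.mk (Pi.single i 1)) =
      g.hom (Submodule.Quotient.mk (Pi.single i 1))) : f = g := by
  apply ModuleCat.hom_ext
  apply Submodule.linearMap_qext
  refine LinearMap.pi_ext' fun i => LinearMap.ext_ring (h i)

lemma stalk_map_eq_zero_iff {M : ModuleCat.{u} R} {X : CochainComplex (ModuleCat.{u} R) ℤ}
    {i j : ℤ} (hij : i + 1 = j)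
    (f : (HomologicalComplex.single (ModuleCat.{u} R) (ComplexShape.up ℤ) j).obj M ⟶ X) :
    (HomotopyCategory.quotient _ _).map f = 0 ↔ ∃ g : M ⟶ X.X i,
      g ≫ X.d i j = (HomologicalComplex.singleObjXSelf (ComplexShape.up ℤ) j M).inv ≫ f.f j := by
  let S := (HomologicalComplex.single (ModuleCat.{u} R) (ComplexShape.up ℤ) j).obj M
  let e := HomologicalComplex.singleObjXSelf (ComplexShape.up ℤ) j M
  have hS : ∀ (i k : ℤ), S.d i k = 0 := fun i k => HomologicalComplex.single_obj_d _ _ _ _ _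
  rw [quotient_map_eq_zero_iff]
  constructor
  · rintro ⟨t, ht⟩
    refine ⟨e.inv ≫ t j i, ?_⟩
    rw [Category.assoc, ← cancel_epi e.hom, e.hom_inv_id_assoc]
    refine Eq.trans ?_ (congrArg (e.hom ≫ e.inv ≫ ·) (ht i j (j + 1) hij rfl)).symm
    rw [show ((HomologicalComplex.single (ModuleCat.{u} R) (ComplexShape.up ℤ) j).obj M).d j (j + 1)
      = 0 from hS j (j + 1), zero_comp, zero_add]
    exact (e.hom_inv_id_assoc _).symm
  · rintro ⟨g, hg⟩
    obtain rfl : i = j - 1 := by lia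
    refine ⟨fun i k => if h : i = j ∧ k = j - 1 then
      eqToHom (by rw [h.1]) ≫ e.hom ≫ g ≫ eqToHom (by rw [h.2]) else 0, fun i l k hil hlk => ?_⟩
    rw [show ((HomologicalComplex.single (ModuleCat.{u} R) (ComplexShape.up ℤ) j).obj M).d l k = 0
      from hS l k, zero_comp, zero_add]
    by_cases hl : l = j
    · subst hl
      obtain rfl : i = l - 1 := by lia
      beta_reduce
      rw [dif_pos ⟨rfl, rfl⟩]
      simp only [eqToHom_refl, Category.id_comp, Category.comp_id, Category.assoc]
      refine Eq.trans ?_ (congrArg (e.hom ≫ ·) hg).symm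
      exact (e.hom_inv_id_assoc _).symm
    · exact (HomologicalComplex.isZero_single_obj_X _ _ _ _ hl).eq_of_src _ _

lemma single_comp_d {M : ModuleCat.{u} R} {X : CochainComplex (ModuleCat.{u} R) ℤ} {j : ℤ}
    (f : (HomologicalComplex.single (ModuleCat.{u} R) (ComplexShape.up ℤ) j).obj M ⟶ X) (k : ℤ) :
    ((HomologicalComplex.singleObjXSelf (ComplexShape.up ℤ) j M).inv ≫ f.f j) ≫ X.d j k = 0 := by
  rw [Category.assoc, f.comm, HomologicalComplex.single_obj_d, zero_comp, comp_zero]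

lemma stalk_hom_eq_zero_iff (M : ModuleCat.{u} R) (X : CochainComplex (ModuleCat.{u} R) ℤ) (j : ℤ) :
    (∀ f : stalk j M ⟶ (HomotopyCategory.quotient _ _).obj X, f = 0) ↔
      ∀ i k, i + 1 = j → j + 1 = k → ∀ f : M ⟶ X.X j,
        f ≫ X.d j k = 0 → ∃ g : M ⟶ X.X i, g ≫ X.d i j = f := by
  constructor
  · intro h i k hij hjk f hf
    obtain ⟨g, hg⟩ := (stalk_map_eq_zero_iff hij _).1 (h ((HomotopyCategory.quotient _ _).map
      (HomologicalComplex.mkHomFromSingle f (by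
        rintro l (hl : j + 1 = l)
        obtain rfl : k = l := by lia
        exact hf))))
    refine ⟨g, hg.trans ?_⟩
    rw [HomologicalComplex.mkHomFromSingle_f, Iso.inv_hom_id_assoc]
  · intro h f
    obtain ⟨f, rfl⟩ := (HomotopyCategory.quotient _ _).map_surjective f
    exact (stalk_map_eq_zero_iff (sub_add_cancel j 1) f).2
      (h (j - 1) (j + 1) (by lia) rfl _ (single_comp_d f _))

/-- A map from `fpModule a` is a solution of the system `a`. Thus lifting solutions from cocycles
means exactness of Hom out of finitely presented modules. This makes the pure acyclic complexes the
right orthogonal of a set of compact objects. -/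
lemma liftsCocycles_iff (X : CochainComplex (ModuleCat.{u} R) ℤ) :
    LiftsCocycles X ↔ ∀ (a : FpIndex R) (j : ℤ)
      (f : stalk j (fpModule a) ⟶ (HomotopyCategory.quotient _ _).obj X), f = 0 := by
  simp only [stalk_hom_eq_zero_iff]
  constructor
  · intro h a j i k hij hjk f hf
    obtain ⟨y, h₁, h₂⟩ := h i j k hij hjk _ _ a.2.2
      (fun i => f.hom (Submodule.Quotient.mk (Pi.single i 1)))
      (fun i => LinearMap.congr_fun (congrArg ModuleCat.Hom.hom hf) _)
      (fun l => by simp only [← map_smul, ← map_sum]; rw [fpModule_sum_eq_zero, map_zero])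
    obtain ⟨g, hg⟩ := exists_fpModule_hom a y h₁
    exact ⟨g, fpModule_hom_ext a fun i => (congrArg (X.d _ j).hom (hg i)).trans (h₂ i)⟩
  · intro h i j k hij hjk n m a x hx hax
    obtain ⟨f, hf⟩ := exists_fpModule_hom ⟨n, m, a⟩ x hax
    obtain ⟨g, hg⟩ := h ⟨n, m, a⟩ j i k hij hjk f (fpModule_hom_ext _ fun l =>
      (congrArg (X.d j k).hom (hf l)).trans ((hx l).trans rfl))
    refine ⟨fun l => g.hom (Submodule.Quotient.mk (Pi.single l 1)), fun l => ?_, fun l => ?_⟩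
    · simp only [← map_smul, ← map_sum]
      exact (congrArg g.hom (fpModule_sum_eq_zero ⟨n, m, a⟩ l)).trans (map_zero _)
    · exact (LinearMap.congr_fun (congrArg ModuleCat.Hom.hom hg) _).trans (hf l)

lemma pureAcyclic_iff (X : K R) :
    pureAcyclic R X ↔ ∀ (a : FpIndex R) (j : ℤ) (f : stalk j (fpModule a) ⟶ X), f = 0 :=
  isPureAcyclic_iff_liftsCocycles.trans (liftsCocycles_iff X.as)

instance : (pureAcyclic R).IsClosedUnderIsomorphisms where
  of_iso e h := by
    rw [pureAcyclic_iff] at h ⊢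
    intro a j f
    rw [← cancel_mono e.inv, h a j (f ≫ e.inv), zero_comp]

lemma pureAcyclic_le_acyclic :
    pureAcyclic R ≤ HomotopyCategory.subcategoryAcyclic (ModuleCat.{u} R) := fun X hX => by
  obtain ⟨X, rfl⟩ := HomotopyCategory.quotient_obj_surjective X
  rw [HomotopyCategory.quotient_obj_mem_subcategoryAcyclic_iff_acyclic]
  exact (isPureAcyclic_iff_liftsCocycles.1 hX).acyclic

/-! ### Morphisms from pure acyclic complexes -/

/-- Morphisms from a pure acyclic complex to a complex that is a retract of its bidual are
null-homotopic. -/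
lemma hom_eq_zero_of_bidual_retract {X Y : CochainComplex (ModuleCat.{u} R) ℤ}
    (hX : IsPureAcyclic R X) (ρ : ∀ i, dualR (dualL (Y.X i)) ⟶ Y.X i)
    (hρ : ∀ i, unitL (Y.X i) ≫ ρ i = 𝟙 _)
    (hd : ∀ i j, dualRMap (dualLMap (Y.d i j)) ≫ ρ j = ρ i ≫ Y.d i j)
    (f : (HomotopyCategory.quotient _ (ComplexShape.up ℤ)).obj X ⟶
      (HomotopyCategory.quotient _ _).obj Y) : f = 0 := by
  obtain ⟨f, rfl⟩ := (HomotopyCategory.quotient _ _).map_surjective f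
  obtain ⟨t, ht⟩ := hX.exists_contraction_bidual
  rw [quotient_map_eq_zero_iff]
  -- By naturality of the unit, `f` is the unit followed by the bidual of `f` and `ρ`. The
  -- contraction `t` is inserted in the bidual of `X`, the source.
  refine ⟨fun i j => unitL _ ≫ t i j ≫ dualRMap (dualLMap (f.f j)) ≫ ρ j, fun i j k hij hjk => ?_⟩
  have nat : ∀ {M N : ModuleCat.{u} R} (g : M ⟶ N),
      g ≫ unitL N = unitL M ≫ dualRMap (dualLMap g) := fun _ => rfl
  have e₁ : f.f j = unitL _ ≫ dualRMap (dualLMap (f.f j)) ≫ ρ j := by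
    rw [← Category.assoc, ← nat, Category.assoc, hρ, Category.comp_id]
  rw [e₁, ← Category.id_comp (dualRMap (dualLMap (f.f j))), ht i j k hij hjk]
  simp only [Preadditive.add_comp, Preadditive.comp_add, Category.assoc]
  rw [← Category.assoc (X.d j k), nat]
  simp only [Category.assoc]
  congr 3
  rw [← Category.assoc (dualRMap _), ← dualRMap_comp, ← dualLMap_comp, ← f.comm, dualLMap_comp,
    dualRMap_comp, Category.assoc, hd]

end PureAcyclic

/-! ### Pure acyclic complexes of pure-injective modules are contractible -/

section Filtration

variable {R : Type u} [Ring R]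

/-- Lifting a linear map along a well-ordered chain of submodules, step by step. -/
lemma exists_lift_of_filtration {P Y Y' : Type*} [AddCommGroup P] [AddCommGroup Y] [AddCommGroup Y']
    [Module R P] [Module R Y] [Module R Y'] {J : Type*} [LinearOrder J] [WellFoundedLT J] (τ : J)
    (B : J → Submodule R P) (hB : Monotone B) (f : P →ₗ[R] Y) (d : Y' →ₗ[R] Y)
    (step : ∀ t < τ, ∀ g : P →ₗ.[R] Y', g.domain = ⨆ s < t, B s → (∀ x, d (g x) = f x) →
      ∃ g' : P →ₗ.[R] Y', g ≤ g' ∧ g'.domain = B t ∧ ∀ x, d (g' x) = f x) :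
    ∃ g : P →ₗ.[R] Y', g.domain = ⨆ s < τ, B s ∧ ∀ x, d (g x) = f x := by
  let S : Set (P →ₗ.[R] Y') := {g | (∃ D : Set J, IsLowerSet D ∧ D ⊆ Set.Iio τ ∧
    g.domain = ⨆ s ∈ D, B s) ∧ ∀ x, d (g x) = f x}
  obtain ⟨g, ⟨⟨D₀, hD₀, hD₀τ, hgD₀⟩, hg⟩, hmax⟩ : ∃ g, Maximal (· ∈ S) g := by
    refine zorn_le₀ S fun c hcS hc => ?_
    obtain rfl | hne := c.eq_empty_or_nonempty
    · exact ⟨⊥, ⟨⟨∅, isLowerSet_empty, Set.empty_subset _, by simp; rfl⟩, fun x => by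
        obtain ⟨x, hx⟩ := x
        obtain rfl := (Submodule.mem_bot R).1 hx
        exact (congrArg d (map_zero _)).trans ((map_zero d).trans (map_zero f).symm)⟩, by simp⟩
    · choose D hD hDτ hgD using fun g : c => (hcS g.2).1
      refine ⟨LinearPMap.sSup c hc.directedOn, ⟨⟨⋃ g, D g, isLowerSet_iUnion hD,
        Set.iUnion_subset hDτ, ?_⟩, fun x => ?_⟩, fun g hg => LinearPMap.le_sSup _ hg⟩
      · rw [LinearPMap.domain_sSup, sSup_image', iSup_iUnion]
        exact iSup_congr hgD
      · obtain ⟨g, hgc, hxg⟩ := (LinearPMap.mem_domain_sSup_iff hne hc.directedOn).1 x.2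
        rw [← (LinearPMap.le_sSup hc.directedOn hgc).2 (x := ⟨x, hxg⟩) rfl]
        exact (hcS hgc).2 ⟨x, hxg⟩
  -- The index set supplied by membership in `S` may omit steps where `B` does not grow. It is
  -- replaced by the largest lower set whose submodules lie in the domain, so that enlarging the
  -- domain to `B t` really puts `t` in it.
  let D : Set J := {s | s < τ ∧ ∀ s' ≤ s, B s' ≤ g.domain}
  have hD : IsLowerSet D := fun a b hba ha =>
    ⟨hba.trans_lt ha.1, fun s' hs' => ha.2 s' (hs'.trans hba)⟩
  have hDτ : D ⊆ Set.Iio τ := fun s hs => hs.1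
  have hgD : g.domain = ⨆ s ∈ D, B s := by
    refine le_antisymm ?_ (iSup₂_le fun s hs => hs.2 s le_rfl)
    rw [hgD₀]
    refine biSup_mono fun s hs => ⟨hD₀τ hs, fun s' hs' => ?_⟩
    rw [hgD₀]
    exact le_iSup₂_of_le s' (hD₀ hs' hs) le_rfl
  have hDmem : ∀ t, t < τ → (∀ s ≤ t, B s ≤ g.domain) → t ∈ D := fun t h h' => ⟨h, h'⟩
  clear_value D
  by_cases h : Set.Iio τ ⊆ D
  · obtain rfl : D = Set.Iio τ := hDτ.antisymm h
    exact ⟨g, hgD, hg⟩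
  · exfalso
    obtain ⟨t, ⟨ht, htD⟩, hmin⟩ := WellFounded.has_min (wellFounded_lt (α := J)) (Set.Iio τ \ D)
      (Set.sdiff_nonempty.2 h)
    have hDt : D = Set.Iio t := by
      ext s
      refine ⟨fun hs => not_le.1 fun hts => htD (hD hts hs), fun hs => ?_⟩
      by_contra hsD
      exact hmin s ⟨lt_trans hs ht, hsD⟩ hs
    obtain ⟨g', hgg', hg'B, hg'⟩ := step t ht g (by rw [hgD, hDt]; rfl) hg
    have hle := hmax (y := g') ⟨⟨Set.Iic t, isLowerSet_Iic t, fun s hs => lt_of_le_of_lt hs ht, by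
      rw [hg'B]
      exact le_antisymm (le_iSup₂_of_le t le_rfl le_rfl) (iSup₂_le fun s hs => hB hs)⟩, hg'⟩ hgg'
    exact htD (hDmem t ht fun s hs => (hB hs).trans (hg'B.symm.le.trans hle.1))

/-- The cocycles of the complex of morphisms from `M` to `Y` are coboundaries. -/
def LiftsFrom (Y : CochainComplex (ModuleCat.{u} R) ℤ) (M : Type u) [AddCommGroup M] [Module R M] :
    Prop :=
  ∀ i j k : ℤ, i + 1 = j → j + 1 = k → ∀ f : M →ₗ[R] Y.X j, (∀ x, (Y.d j k).hom (f x) = 0) →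
    ∃ g : M →ₗ[R] Y.X i, ∀ x, (Y.d i j).hom (g x) = f x

variable {Y : CochainComplex (ModuleCat.{u} R) ℤ}

lemma LiftsFrom.directSum {J : Type u} [DecidableEq J] {X : J → Type u}
    [∀ j, AddCommGroup (X j)] [∀ j, Module R (X j)] (h : ∀ j, LiftsFrom Y (X j)) :
    LiftsFrom Y (DirectSum J X) := by
  intro i j k hij hjk f hf
  choose g hg using fun s => h s i j k hij hjk (f ∘ₗ DirectSum.lof R J X s) fun x => hf _
  refine ⟨DirectSum.toModule R J _ g, LinearMap.congr_fun
    (f := (Y.d i j).hom ∘ₗ DirectSum.toModule R J _ g) (g := f)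
    (DirectSum.linearMap_ext R fun s => LinearMap.ext fun x => ?_)⟩
  simpa [DirectSum.toModule_lof] using hg s x

lemma LiftsFrom.of_linearEquiv {M N : Type u} [AddCommGroup M] [Module R M]
    [AddCommGroup N] [Module R N] (e : M ≃ₗ[R] N) (h : LiftsFrom Y M) : LiftsFrom Y N := by
  intro i j k hij hjk f hf
  obtain ⟨g, hg⟩ := h i j k hij hjk (f ∘ₗ e.toLinearMap) fun x => hf _
  exact ⟨g ∘ₗ e.symm.toLinearMap, fun x => (hg _).trans (by simp)⟩

/-- Linear maps to pure-injective modules extend from the kernels of maps along which systems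
lift. -/
lemma LiftsSystems.exists_extension {E Q I : ModuleCat.{u} R} {ψ : E ⟶ Q} (hψ : LiftsSystems ψ ⊤)
    (hI : IsPureInjective R I) (g : LinearMap.ker ψ.hom →ₗ[R] I) :
    ∃ h : E →ₗ[R] I, ∀ x (hx : ψ.hom x = 0), h x = g ⟨x, hx⟩ := by
  obtain ⟨h, hh⟩ := hI (ModuleCat.ofHom (LinearMap.ker ψ.hom).subtype)
    (hψ.isPureMono Subtype.val_injective (fun b => ⟨fun h => ⟨⟨b, h⟩, rfl⟩, fun ⟨a, ha⟩ => ha ▸ a.2⟩)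
      fun _ => Submodule.mem_top) (ModuleCat.ofHom g)
  exact ⟨h.hom, fun x hx => LinearMap.congr_fun (congrArg ModuleCat.Hom.hom hh) ⟨x, hx⟩⟩

lemma exists_linear_factor {A B C : Type*} [AddCommGroup A] [AddCommGroup B] [AddCommGroup C]
    [Module R A] [Module R B] [Module R C] (p : A →ₗ[R] B) (h : A →ₗ[R] C)
    (hp : Function.Surjective p) (hh : ∀ a, p a = 0 → h a = 0) :
    ∃ q : B →ₗ[R] C, ∀ a, q (p a) = h a := by
  refine ⟨(LinearMap.ker p).liftQ h hh ∘ₗ (p.quotKerEquivOfSurjective hp).symm.toLinearMap,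
    fun a => ?_⟩
  have : (p.quotKerEquivOfSurjective hp).symm (p a) = Submodule.Quotient.mk a := by
    rw [LinearEquiv.symm_apply_eq]
    rfl
  exact (congrArg ((LinearMap.ker p).liftQ h hh) this).trans (Submodule.liftQ_apply _ _ _)

/-! ### The canonical pure presentation of the colimit of a chain of quotients -/

section Presentation

variable {F : Type u} [AddCommGroup F] [Module R F] {J : Type u} [LinearOrder J] (r : J → F)

/-- The span of the relations up to `t`. -/
def relIic (t : J) : Submodule R F := Submodule.span R (r '' Set.Iic t)

/-- The span of the relations before `t`. -/
def relIio (t : J) : Submodule R F := Submodule.span R (r '' Set.Iio t)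

lemma relIic_mono : Monotone (relIic (R := R) r) := fun _ _ h =>
  Submodule.span_mono (Set.image_mono (Set.Iic_subset_Iic.2 h))

lemma relIic_le_relIio {s t : J} (h : s < t) : relIic (R := R) r s ≤ relIio r t :=
  Submodule.span_mono (Set.image_mono fun _ hx => lt_of_le_of_lt hx h)

lemma exists_mem_relIic {t : J} (ht : ∃ s, s < t) {x : F} (hx : x ∈ relIio (R := R) r t) :
    ∃ s < t, x ∈ relIic (R := R) r s := by
  induction hx using Submodule.span_induction with
  | mem x hx =>
    obtain ⟨s, hs, rfl⟩ := hx
    exact ⟨s, hs, Submodule.subset_span ⟨s, le_rfl, rfl⟩⟩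
  | zero => exact ht.imp fun s hs => ⟨hs, Submodule.zero_mem _⟩
  | add x y _ _ hx hy =>
    obtain ⟨s, hs, hx⟩ := hx
    obtain ⟨s', hs', hy⟩ := hy
    exact ⟨max s s', max_lt hs hs', Submodule.add_mem _ (relIic_mono r (le_max_left _ _) hx)
      (relIic_mono r (le_max_right _ _) hy)⟩
  | smul a x _ hx =>
    obtain ⟨s, hs, hx⟩ := hx
    exact ⟨s, hs, Submodule.smul_mem _ a hx⟩

/-- The direct sum of the partial quotients. -/
abbrev PartialSum : Type u := DirectSum J fun t => F ⧸ relIic (R := R) r t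

/-- The direct sum of the partial quotients before `t`. -/
abbrev PartialSumLt (t : J) : Type u :=
  DirectSum (Set.Iio t) fun s => F ⧸ relIic (R := R) r s.1

/-- The class of `x` in the summand of index `t`. -/
def cls (t : J) : F →ₗ[R] PartialSum (R := R) r :=
  DirectSum.lof R J (fun t => F ⧸ relIic (R := R) r t) t ∘ₗ Submodule.mkQ _

lemma cls_eq_zero {t : J} {x : F} (hx : x ∈ relIic (R := R) r t) : cls (R := R) r t x = 0 := by
  rw [cls, LinearMap.comp_apply, Submodule.mkQ_apply, (Submodule.Quotient.mk_eq_zero _).2 hx,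
    map_zero]

/-- The relations between the partial quotients up to `t`. -/
def relations (t : J) : Submodule R (PartialSum (R := R) r) :=
  Submodule.span R {p | ∃ (s s' : J) (_ : s ≤ s') (_ : s' ≤ t) (x : F),
    p = cls r s x - cls r s' x}

lemma relations_mono : Monotone (relations (R := R) r) := fun _ _ h =>
  Submodule.span_mono fun _ ⟨s, s', hs, hs', x, hx⟩ => ⟨s, s', hs, hs'.trans h, x, hx⟩

lemma cls_sub_mem {s s' t : J} (h : s ≤ s') (h' : s' < t) (x : F) :
    cls (R := R) r s x - cls r s' x ∈ ⨆ s < t, relations (R := R) r s :=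
  Submodule.mem_iSup_of_mem s' (Submodule.mem_iSup_of_mem h'
    (Submodule.subset_span ⟨s, s', h, le_rfl, x, rfl⟩))

/-- The isomorphism from the sum of the partial quotients before `t` to the relations. -/
def toRelations (t : J) : PartialSumLt (R := R) r t →ₗ[R] PartialSum (R := R) r :=
  DirectSum.toModule R _ _ fun s => Submodule.liftQ _ (cls r s.1 - cls r t) fun x hx => by
    rw [LinearMap.mem_ker, LinearMap.sub_apply, cls_eq_zero r hx,
      cls_eq_zero r (relIic_mono r (le_of_lt s.2) hx), sub_zero]

/-- The canonical map from the sum of the partial quotients before `t`. -/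
def toQuotient (t : J) : PartialSumLt (R := R) r t →ₗ[R] F ⧸ relIio (R := R) r t :=
  DirectSum.toModule R _ _ fun s => Submodule.factor (relIic_le_relIio r s.2)

/-- The class of `x` in the summand of index `s < t`. -/
def clsLt {s t : J} (h : s < t) : F →ₗ[R] PartialSumLt (R := R) r t :=
  DirectSum.lof R (Set.Iio t) (fun s => F ⧸ relIic (R := R) r s.1) ⟨s, h⟩ ∘ₗ Submodule.mkQ _

lemma toRelations_clsLt {s t : J} (h : s < t) (x : F) :
    toRelations r t (clsLt (R := R) r h x) = cls r s x - cls r t x := by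
  simp only [toRelations, clsLt, LinearMap.comp_apply, DirectSum.toModule_lof]
  rfl

lemma toQuotient_clsLt {s t : J} (h : s < t) (x : F) :
    toQuotient r t (clsLt (R := R) r h x) = Submodule.Quotient.mk x := by
  simp only [toQuotient, clsLt, LinearMap.comp_apply, DirectSum.toModule_lof]
  rfl

lemma partialSumLt_induction {t : J} {p : PartialSumLt (R := R) r t → Prop} (h0 : p 0)
    (h₁ : ∀ (s : J) (h : s < t) (x : F), p (clsLt r h x)) (h₂ : ∀ x y, p x → p y → p (x + y))
    (x) : p x := by
  induction x using DirectSum.induction_on with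
  | zero => exact h0
  | of s x =>
    obtain ⟨x, rfl⟩ := Submodule.Quotient.mk_surjective _ x
    exact h₁ s.1 s.2 x
  | add x y hx hy => exact h₂ x y hx hy

lemma range_toRelations (t : J) : LinearMap.range (toRelations (R := R) r t) = relations r t := by
  apply le_antisymm
  · rintro _ ⟨x, rfl⟩
    induction x using partialSumLt_induction with
    | h0 => rw [map_zero]; exact Submodule.zero_mem _
    | h₁ s h x =>
      rw [toRelations_clsLt]
      exact Submodule.subset_span ⟨s, t, h.le, le_rfl, x, rfl⟩
    | h₂ x y hx hy => rw [map_add]; exact Submodule.add_mem _ hx hy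
  · refine Submodule.span_le.2 ?_
    have key : ∀ s ≤ t, ∀ x, cls (R := R) r s x - cls r t x ∈
        LinearMap.range (toRelations (R := R) r t) := by
      intro s hs x
      obtain rfl | hs := hs.eq_or_lt
      · rw [sub_self]; exact Submodule.zero_mem _
      · exact ⟨_, toRelations_clsLt r hs x⟩
    rintro _ ⟨s, s', h, h', x, rfl⟩
    have := Submodule.sub_mem _ (key s (h.trans h') x) (key s' h' x)
    rwa [sub_sub_sub_cancel_right] at this

/-- Together with `range_toRelations`, this identifies `relations r t`, modulo the earlier
relations, with `F ⧸ relIio r t`. The filtration of the kernel of the presentation thus has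
subquotients presented by initial segments of the relations. -/
lemma toRelations_mem_iff {t : J} (ht : ∃ s, s < t) (x : PartialSumLt (R := R) r t) :
    toRelations r t x ∈ ⨆ s < t, relations (R := R) r s ↔ toQuotient r t x = 0 := by
  classical
  constructor
  · intro h
    -- The map `p` kills the summands of index at least `t` and all earlier relations, yet recovers
    -- `toQuotient` from `toRelations`.
    let p : PartialSum (R := R) r →ₗ[R] F ⧸ relIio (R := R) r t :=
      DirectSum.toModule R _ _ fun s =>
        if h : s < t then Submodule.factor (relIic_le_relIio r h) else 0
    have hp : ∀ s (_ : s < t) x, p (cls r s x) = Submodule.Quotient.mk x := fun s h x => by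
      simp only [p, cls, LinearMap.comp_apply, DirectSum.toModule_lof, dif_pos h]
      rfl
    have hp' : ∀ x, p (cls r t x) = 0 := fun x => by
      simp only [p, cls, LinearMap.comp_apply, DirectSum.toModule_lof, dif_neg (lt_irrefl t)]
      rfl
    have h₁ : ∀ x, p (toRelations r t x) = toQuotient r t x := fun x => by
      induction x using partialSumLt_induction with
      | h0 => simp only [map_zero]
      | h₁ s h x => rw [toRelations_clsLt, toQuotient_clsLt, map_sub, hp s h, hp', sub_zero]
      | h₂ x y hx hy => rw [map_add, map_add, map_add, hx, hy]
    have h₂ : (⨆ s < t, relations (R := R) r s) ≤ LinearMap.ker p := by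
      refine iSup₂_le fun s hs => Submodule.span_le.2 ?_
      rintro _ ⟨s', s'', h, h', x, rfl⟩
      change p _ = 0
      rw [map_sub, hp _ (h.trans_lt (h'.trans_lt hs)), hp _ (h'.trans_lt hs), sub_self]
    rw [← h₁]
    exact h₂ h
  · intro hx
    -- Modulo earlier relations all classes of one element of `F` in indices below `t` agree, so
    -- every sum collapses to a single index `s`.
    have key : ∀ x : PartialSumLt (R := R) r t, ∃ s < t, ∃ y : F,
        toQuotient r t x = Submodule.Quotient.mk y ∧
        toRelations r t x - (cls r s y - cls r t y) ∈ ⨆ s < t, relations (R := R) r s := by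
      intro x
      induction x using partialSumLt_induction with
      | h0 =>
        obtain ⟨s, hs⟩ := ht
        exact ⟨s, hs, 0, by rw [map_zero]; rfl, by simp⟩
      | h₁ s h x =>
        exact ⟨s, h, x, toQuotient_clsLt r h x, by
          rw [toRelations_clsLt, sub_self]; exact Submodule.zero_mem _⟩
      | h₂ x x' hx hx' =>
        obtain ⟨s, hs, y, h₁, h₂⟩ := hx
        obtain ⟨s', hs', y', h₁', h₂'⟩ := hx'
        refine ⟨max s s', max_lt hs hs', y + y', by rw [map_add, h₁, h₁']; rfl, ?_⟩
        have e₁ := cls_sub_mem (R := R) r (le_max_left s s') (max_lt hs hs') y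
        have e₂ := cls_sub_mem (R := R) r (le_max_right s s') (max_lt hs hs') y'
        have := Submodule.add_mem _ (Submodule.add_mem _ h₂ h₂') (Submodule.add_mem _ e₁ e₂)
        convert! this using 1
        simp only [map_add]
        abel
    obtain ⟨s, hs, y, h₁, h₂⟩ := key x
    obtain ⟨s', hs', hy⟩ := exists_mem_relIic r ht
      ((Submodule.Quotient.mk_eq_zero _).1 (h₁.symm.trans hx))
    have e₁ := cls_sub_mem (R := R) r (le_max_left s s') (max_lt hs hs') y
    rw [cls_eq_zero r (relIic_mono r (le_max_right s s') hy), sub_zero] at e₁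
    have h₃ : cls (R := R) r t y = 0 := cls_eq_zero r (relIic_mono r hs'.le hy)
    rw [h₃, sub_zero] at h₂
    exact (Submodule.sub_mem_iff_left _ e₁).1 h₂

/-- The target is a directed colimit of the `F ⧸ relIic r s` with `s < t`. A finite system solved in
the colimit is already solved at one stage, so the kernel of `toQuotient` is pure. -/
lemma liftsSystems_toQuotient {t : J} (ht : ∃ s, s < t) :
    LiftsSystems (R := R) (ModuleCat.ofHom (toQuotient (R := R) r t)) ⊤ := by
  intro n m a x _ hax
  choose y hy using fun i => Submodule.Quotient.mk_surjective _ (x i)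
  have h₁ : ∀ l, ∑ i, a l i • y i ∈ relIio (R := R) r t := fun l => by
    rw [← Submodule.Quotient.mk_eq_zero, ← hax l, ← Submodule.mkQ_apply, map_sum]
    exact Finset.sum_congr rfl fun i _ => by rw [map_smul, Submodule.mkQ_apply, hy]
  choose s hs hs' using fun l => exists_mem_relIic r ht (h₁ l)
  obtain ⟨s₀, hs₀, hle⟩ : ∃ s₀ < t, ∀ l, s l ≤ s₀ := by
    obtain ⟨q, hq⟩ := ht
    let T : Finset J := insert q (Finset.univ.image s)
    have hT : T.Nonempty := ⟨q, Finset.mem_insert_self _ _⟩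
    refine ⟨T.max' hT, ?_, fun l => T.le_max' _ (Finset.mem_insert_of_mem
      (Finset.mem_image_of_mem s (Finset.mem_univ l)))⟩
    rw [Finset.max'_lt_iff]
    intro z hz
    rw [Finset.mem_insert, Finset.mem_image] at hz
    obtain rfl | ⟨l, -, rfl⟩ := hz
    exacts [hq, hs l]
  refine ⟨fun i => clsLt r hs₀ (y i), fun l => ?_, fun i => ?_⟩
  · simp only [← map_smul, ← map_sum]
    rw [clsLt, LinearMap.comp_apply, Submodule.mkQ_apply, (Submodule.Quotient.mk_eq_zero _).2
      (relIic_mono r (hle l) (hs' l)), map_zero]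
  · exact (toQuotient_clsLt r hs₀ (y i)).trans (hy i)

end Presentation

end Filtration

/-! ### Lifting cocycles by induction on the number of relations -/

section Periodicity

variable {R : Type u} [Ring R] {Y : CochainComplex (ModuleCat.{u} R) ℤ}

lemma exists_linear_factor_range {A B C : Type*} [AddCommGroup A] [AddCommGroup B] [AddCommGroup C]
    [Module R A] [Module R B] [Module R C] (p : A →ₗ[R] B) (h : A →ₗ[R] C)
    (hh : ∀ a, p a = 0 → h a = 0) :
    ∃ q : LinearMap.range p →ₗ[R] C, ∀ a, q ⟨p a, a, rfl⟩ = h a :=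
  exists_linear_factor p.rangeRestrict h p.surjective_rangeRestrict
    fun a ha => hh a (congrArg Subtype.val ha)

section

variable {F : Type u} [AddCommGroup F] [Module R F] {J : Type u} [LinearOrder J] (r : J → F)

lemma toQuotient_surjective {t : J} (ht : ∃ s, s < t) :
    Function.Surjective (toQuotient (R := R) r t) := fun x => by
  obtain ⟨x, rfl⟩ := Submodule.Quotient.mk_surjective _ x
  obtain ⟨s, hs⟩ := ht
  exact ⟨_, toQuotient_clsLt r hs x⟩

/-- Extension of a partial lift from the relations before `t` to the relations up to `t`. -/
lemma exists_lift_step (hY : ∀ n, IsPureInjective R (Y.X n)) {i j k : ℤ} (hij : i + 1 = j)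
    (hjk : j + 1 = k) (t : J) (h : LiftsFrom Y (F ⧸ relIio (R := R) r t))
    (f : PartialSum (R := R) r →ₗ[R] Y.X j) (hf : ∀ x ∈ relations r t, (Y.d j k).hom (f x) = 0)
    (g : PartialSum (R := R) r →ₗ.[R] Y.X i) (hg : g.domain = ⨆ s < t, relations r s)
    (hgf : ∀ x, (Y.d i j).hom (g x) = f x) :
    ∃ g' : PartialSum (R := R) r →ₗ.[R] Y.X i, g ≤ g' ∧ g'.domain = relations r t ∧
      ∀ x, (Y.d i j).hom (g' x) = f x := by
  have hle : (⨆ s < t, relations (R := R) r s) ≤ relations r t :=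
    iSup₂_le fun s hs => relations_mono r hs.le
  by_cases ht : ∃ s, s < t
  · have hdom : ∀ {x}, toQuotient r t x = 0 → toRelations r t x ∈ g.domain := fun hx => by
      rw [hg]; exact (toRelations_mem_iff r ht _).2 hx
    -- Pulled back along `toRelations`, `g` lives on the pure kernel of `toQuotient` and extends to
    -- `h₁`. The error `f ∘ toRelations - d h₁` vanishes on that kernel, descends to a cocycle on `F
    -- ⧸ relIio r t`, and is corrected there by `e`.
    obtain ⟨h₁, hh₁⟩ : ∃ h₁ : PartialSumLt (R := R) r t →ₗ[R] Y.X i,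
        ∀ x (hx : toQuotient r t x = 0), h₁ x = g ⟨toRelations r t x, hdom hx⟩ := (liftsSystems_toQuotient (R := R) r ht).exists_extension (hY i)
      (g.toFun ∘ₗ LinearMap.codRestrict g.domain
        (toRelations r t ∘ₗ (LinearMap.ker (toQuotient r t)).subtype) fun x => hdom x.2)
    obtain ⟨e', he'⟩ := exists_linear_factor (toQuotient r t)
      (f ∘ₗ toRelations r t - (Y.d i j).hom ∘ₗ h₁) (toQuotient_surjective r ht) (fun x hx => by
        rw [LinearMap.sub_apply, LinearMap.comp_apply, LinearMap.comp_apply, hh₁ x hx, sub_eq_zero]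
        exact (hgf ⟨_, hdom hx⟩).symm)
    have hdd : ∀ y, (Y.d j k).hom ((Y.d i j).hom y) = 0 := fun y =>
      LinearMap.congr_fun (congrArg ModuleCat.Hom.hom (Y.d_comp_d i j k)) y
    have hrel : ∀ x, toRelations r t x ∈ relations (R := R) r t := fun x =>
      range_toRelations (R := R) r t ▸ ⟨x, rfl⟩
    obtain ⟨e, he⟩ := h i j k hij hjk e' (fun y => by
      obtain ⟨x, rfl⟩ := toQuotient_surjective r ht y
      rw [he', LinearMap.sub_apply, map_sub, LinearMap.comp_apply, LinearMap.comp_apply,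
        hf _ (hrel x), hdd, sub_zero])
    have hker : ∀ x, toRelations (R := R) r t x = 0 → toQuotient r t x = 0 := fun x hx => by
      rw [← toRelations_mem_iff r ht, hx]
      exact Submodule.zero_mem _
    have hval : ∀ x (hx : toQuotient r t x = 0),
        (h₁ + e ∘ₗ toQuotient r t) x = g ⟨toRelations r t x, hdom hx⟩ := fun x hx => by
      rw [LinearMap.add_apply, LinearMap.comp_apply, hx, map_zero, add_zero]
      exact hh₁ x hx
    obtain ⟨q, hq⟩ := exists_linear_factor_range (toRelations r t) (h₁ + e ∘ₗ toQuotient r t)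
      (fun x hx => by
        rw [hval x (hker x hx)]
        exact (congrArg g (Subtype.ext hx)).trans (map_zero g.toFun))
    refine ⟨⟨LinearMap.range (toRelations r t), q⟩, ⟨?_, ?_⟩, range_toRelations r t, ?_⟩
    · change g.domain ≤ LinearMap.range (toRelations r t)
      rw [hg, range_toRelations]
      exact hle
    · rintro ⟨x, hx⟩ ⟨y, z, hz⟩ (hxy : x = y)
      subst hxy hz
      refine Eq.symm ((hq z).trans (hval z ?_))
      rwa [← toRelations_mem_iff r ht, ← hg]
    · rintro ⟨_, x, rfl⟩
      refine (congrArg (Y.d i j).hom (hq x)).trans ?_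
      rw [LinearMap.add_apply, map_add, LinearMap.comp_apply, he, he', LinearMap.sub_apply,
        LinearMap.comp_apply, LinearMap.comp_apply]
      abel
  -- When `t` is minimal the only generators of `relations r t` are differences `cls r t x - cls r t
  -- x`, so there is nothing to extend.
  · refine ⟨g, le_rfl, ?_, hgf⟩
    rw [hg]
    refine le_antisymm hle (Submodule.span_le.2 ?_)
    rintro _ ⟨s, s', hss', hs't, x, rfl⟩
    obtain rfl : s = t := (hss'.trans hs't).eq_of_not_lt fun hs => ht ⟨s, hs⟩
    obtain rfl := le_antisymm hss' hs't
    rw [sub_self]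
    exact Submodule.zero_mem _

/-- A dimension shift along the pure presentation of `F ⧸ relIio r τ`. A lift `G₀` exists on the
direct sum of the partial quotients. Its restriction to the kernel is a cocycle one degree lower,
which is lifted along the filtration by the `relations`, extended by pure-injectivity, and used to
correct `G₀`. -/
lemma liftsFrom_quotient_relIio [WellFoundedLT J] (hY : ∀ n, IsPureInjective R (Y.X n)) {τ : J}
    (hτ : ∃ s, s < τ) (h₁ : ∀ t < τ, LiftsFrom Y (F ⧸ relIic (R := R) r t))
    (h₂ : ∀ t < τ, LiftsFrom Y (F ⧸ relIio (R := R) r t)) :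
    LiftsFrom Y (F ⧸ relIio (R := R) r τ) := by
  classical
  intro i j k hij hjk f hf
  obtain ⟨G₀, hG₀⟩ := LiftsFrom.directSum (J := Set.Iio τ)
    (X := fun s => F ⧸ relIic (R := R) r s.1) (fun s => h₁ s.1 s.2) i j k hij hjk
    (f ∘ₗ toQuotient r τ) fun x => hf _
  -- The value `0` on the summand `τ` makes `G ∘ toRelations` equal to `G₀`, since `toRelations`
  -- sends a class of index `s` to its difference with the class of index `τ`.
  let G : PartialSum (R := R) r →ₗ[R] Y.X i := DirectSum.toModule R _ _ fun s =>
    if h : s < τ then G₀ ∘ₗ DirectSum.lof R (Set.Iio τ) (fun s => F ⧸ relIic (R := R) r s.1) ⟨s, h⟩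
    else 0
  have hG : ∀ s (h : s < τ) x, G (cls r s x) = G₀ (clsLt r h x) := fun s h x => by
    simp only [G, cls, LinearMap.comp_apply, DirectSum.toModule_lof, dif_pos h]
    rfl
  have hG' : ∀ x, G (cls r τ x) = 0 := fun x => by
    simp only [G, cls, LinearMap.comp_apply, DirectSum.toModule_lof, dif_neg (lt_irrefl τ)]
    rfl
  have hGφ : ∀ x, G (toRelations r τ x) = G₀ x := fun x => by
    induction x using partialSumLt_induction with
    | h0 => simp only [map_zero]
    | h₁ s h x => rw [toRelations_clsLt, map_sub, hG s h, hG', sub_zero]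
    | h₂ x y hx hy => rw [map_add, map_add, map_add, hx, hy]
  have hGK : ∀ t < τ, ∀ x ∈ relations (R := R) r t, (Y.d i j).hom (G x) = 0 := fun t ht => by
    have : relations (R := R) r t ≤ LinearMap.ker ((Y.d i j).hom ∘ₗ G) := by
      refine Submodule.span_le.2 ?_
      rintro _ ⟨s, s', h, h', x, rfl⟩
      change (Y.d i j).hom (G _) = 0
      rw [map_sub, map_sub, hG _ (h.trans_lt (h'.trans_lt ht)), hG _ (h'.trans_lt ht), hG₀, hG₀,
        LinearMap.comp_apply, LinearMap.comp_apply, toQuotient_clsLt, toQuotient_clsLt, sub_self]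
    exact this
  obtain ⟨g, hg, hgG⟩ := exists_lift_of_filtration τ (relations (R := R) r) (relations_mono r) G
    (Y.d (i - 1) i).hom fun t ht g hg hgG =>
      exists_lift_step r hY (by lia) hij t (h₂ t ht) G (hGK t ht) g hg hgG
  have hdom : ∀ {x}, toQuotient r τ x = 0 → toRelations r τ x ∈ g.domain := fun hx => by
    rw [hg]; exact (toRelations_mem_iff r hτ _).2 hx
  obtain ⟨H, hH⟩ := (liftsSystems_toQuotient (R := R) r hτ).exists_extension (hY (i - 1))
    (g.toFun ∘ₗ LinearMap.codRestrict g.domain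
      (toRelations r τ ∘ₗ (LinearMap.ker (toQuotient r τ)).subtype) fun x => hdom x.2)
  obtain ⟨q, hq⟩ := exists_linear_factor (toQuotient r τ) (G₀ - (Y.d (i - 1) i).hom ∘ₗ H)
    (toQuotient_surjective r hτ) (fun x hx => by
      rw [LinearMap.sub_apply, LinearMap.comp_apply, hH x hx, sub_eq_zero, ← hGφ]
      exact (hgG ⟨_, hdom hx⟩).symm)
  refine ⟨q, fun y => ?_⟩
  obtain ⟨x, rfl⟩ := toQuotient_surjective r hτ y
  have hdd : ∀ y, (Y.d i j).hom ((Y.d (i - 1) i).hom y) = 0 := fun y =>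
    LinearMap.congr_fun (congrArg ModuleCat.Hom.hom (Y.d_comp_d (i - 1) i j)) y
  rw [hq, LinearMap.sub_apply, map_sub, LinearMap.comp_apply, hdd, sub_zero, hG₀]
  rfl

end

/-- Only finitely many basis vectors occur in the relations. Their images are lifted together as the
solution of a finite system; the remaining basis vectors are free and are lifted one at a time. -/
lemma liftsFrom_quotient_finite (h : LiftsCocycles Y) {σ : Type u} (S : Set (σ →₀ R))
    (hS : S.Finite) : LiftsFrom Y ((σ →₀ R) ⧸ Submodule.span R S) := by
  classical
  intro i j k hij hjk f hf
  have := hS.fintype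
  let S₀ : Finset σ := Finset.univ.biUnion fun ρ : S => ρ.1.support
  let x : σ → Y.X j := fun s => f (Submodule.Quotient.mk (Finsupp.single s 1))
  have hsum : ∀ (ρ : S) {N : Type u} [AddCommGroup N] [Module R N] (y : σ → N),
      ∑ s : S₀, ρ.1 s • y s = Finsupp.linearCombination R y ρ.1 := by
    intro ρ N _ _ y
    rw [Finset.sum_coe_sort S₀ (fun s => ρ.1 s • y s), Finsupp.linearCombination_apply]
    exact (Finsupp.sum_of_support_subset _ (Finset.subset_biUnion_of_mem
      (fun ρ : S => ρ.1.support) (Finset.mem_univ ρ)) (fun s a => a • y s) (by simp)).symm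
  have hx : Finsupp.linearCombination R x = f ∘ₗ Submodule.mkQ _ := by
    ext s
    simp [x]
  obtain ⟨y, hy₁, hy₂⟩ := (h i j k hij hjk).exists_lift (fun (ρ : S) (s : S₀) => ρ.1 s)
    (fun s => x s) (fun s => hf _) (fun ρ => by
      rw [hsum ρ x, hx, LinearMap.comp_apply, Submodule.mkQ_apply,
        (Submodule.Quotient.mk_eq_zero _).2 (Submodule.subset_span ρ.2), map_zero])
  choose z hz using fun s => h.exists_lift hij hjk (x s) (hf _)
  let y' : σ → Y.X i := fun s => if h : s ∈ S₀ then y ⟨s, h⟩ else z s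
  have hy' : ∀ s, (Y.d i j).hom (y' s) = x s := fun s => by
    by_cases hs : s ∈ S₀
    · simpa only [y', dif_pos hs] using hy₂ ⟨s, hs⟩
    · simpa only [y', dif_neg hs] using hz s
  refine ⟨Submodule.liftQ _ (Finsupp.linearCombination R y') (Submodule.span_le.2 fun ρ hρ => ?_),
    fun v => ?_⟩
  · change Finsupp.linearCombination R y' ρ = 0
    rw [← hsum ⟨ρ, hρ⟩ y', ← hy₁ ⟨ρ, hρ⟩]
    refine Finset.sum_congr rfl fun s _ => ?_
    simp only [y', dif_pos s.2]
  · obtain ⟨v, rfl⟩ := Submodule.Quotient.mk_surjective _ v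
    rw [Submodule.liftQ_apply, ← Submodule.mkQ_apply, ← LinearMap.comp_apply f, ← hx,
      ← LinearMap.comp_apply]
    congr 1
    ext s
    simp [hy']

/-- For infinite `S`, the relations are enumerated by the initial ordinal of the cardinal of `S`.
Every proper initial segment is smaller, so the induction hypothesis covers all partial quotients
and `liftsFrom_quotient_relIio` passes to the whole. -/
lemma liftsFrom_quotient_span (hY : ∀ n, IsPureInjective R (Y.X n)) (h : LiftsCocycles Y)
    {σ : Type u} (κ : Cardinal.{u}) : ∀ (S : Set (σ →₀ R)), Cardinal.mk S ≤ κ →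
      LiftsFrom Y ((σ →₀ R) ⧸ Submodule.span R S) := by
  induction κ using WellFoundedLT.induction with
  | ind κ ih =>
    intro S hS
    obtain hlt | rfl := hS.lt_or_eq
    · exact ih _ hlt S le_rfl
    obtain hfin | hinf := S.finite_or_infinite
    · exact liftsFrom_quotient_finite h S hfin
    have hinf' : Cardinal.aleph0 ≤ Cardinal.mk S := Cardinal.infinite_iff.1 hinf.to_subtype
    let T := (Cardinal.mk S).ord.ToType
    obtain ⟨e⟩ : Nonempty (T ≃ S) := Cardinal.eq.1 (by simp [T])
    -- A top element is adjoined so that all of `S` is the set of relations before `⊤`. The value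
    -- `0` at `⊤` adds no relation.
    let r : WithTop T → (σ →₀ R) := fun t => t.recTopCoe 0 fun t => (e t).1
    have hcard : ∀ t < (⊤ : WithTop T), Cardinal.mk (Set.Iic t) < Cardinal.mk S := by
      intro t ht
      induction t using WithTop.recTopCoe with
      | top => exact absurd ht (lt_irrefl _)
      | coe t =>
        have : Set.Iic (t : WithTop T) = (fun s : T => (s : WithTop T)) '' Set.Iic t := by
          ext s
          induction s using WithTop.recTopCoe with
          | top => simp
          | coe s => simp
        rw [this]
        refine Cardinal.mk_image_le.trans_lt ?_
        rw [← Set.Iio_insert]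
        exact (Cardinal.mk_insert_le).trans_lt (Cardinal.add_lt_of_lt hinf'
          (by simpa [T] using Cardinal.mk_Iio_lt t) (Cardinal.one_lt_aleph0.trans_le hinf'))
    have hS' : Submodule.span R S = relIio (R := R) r ⊤ := by
      rw [relIio]
      congr 1
      ext x
      constructor
      · intro hx
        exact ⟨(e.symm ⟨x, hx⟩ : T), WithTop.coe_lt_top _, by simp [r]⟩
      · rintro ⟨t, ht, rfl⟩
        induction t using WithTop.recTopCoe with
        | top => exact absurd (Set.mem_Iio.1 ht) (lt_irrefl _)
        | coe t => exact (e t).2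
    rw [hS']
    have : Nonempty T := ⟨e.symm ⟨_, hinf.nonempty.some_mem⟩⟩
    refine liftsFrom_quotient_relIio r hY ⟨_, WithTop.coe_lt_top (Classical.arbitrary T)⟩
      (fun t ht => ?_) (fun t ht => ?_)
    · exact ih _ ((Cardinal.mk_image_le (f := r) (s := Set.Iic t)).trans_lt (hcard t ht)) _ le_rfl
    · exact ih _ ((Cardinal.mk_image_le (f := r) (s := Set.Iio t)).trans_lt
        ((Cardinal.mk_le_mk_of_subset Set.Iio_subset_Iic_self).trans_lt (hcard t ht))) _ le_rfl

lemma liftsFrom_of_isPureInjective (hY : ∀ n, IsPureInjective R (Y.X n)) (h : LiftsCocycles Y)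
    (M : Type u) [AddCommGroup M] [Module R M] : LiftsFrom Y M := by
  -- The module is presented by all its elements as generators and all the relations among them.
  have := liftsFrom_quotient_span hY h (σ := M) _
    (LinearMap.ker (Finsupp.linearCombination R (id : M → M)) : Set (M →₀ R)) le_rfl
  rw [Submodule.span_eq] at this
  exact this.of_linearEquiv (LinearMap.quotKerEquivOfSurjective _
    (Finsupp.linearCombination_id_surjective R M))

/-- A pure acyclic complex of pure-injective modules is contractible. -/
theorem isZero_of_isPureInjective (hY : ∀ n, IsPureInjective R (Y.X n)) (h : IsPureAcyclic R Y) :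
    IsZero ((HomotopyCategory.quotient _ (ComplexShape.up ℤ)).obj Y) := by
  rw [isZero_quotient_iff]
  refine exists_contraction Y (fun i => ⟨i + 1, rfl⟩) fun i j k hij hjk M f hf => ?_
  obtain ⟨g, hg⟩ := liftsFrom_of_isPureInjective hY h.liftsCocycles M i j k hij hjk f.hom
    (fun x => LinearMap.congr_fun (congrArg ModuleCat.Hom.hom hf) x)
  exact ⟨mkHom g, ModuleCat.hom_ext (LinearMap.ext hg)⟩

end Periodicity

/-! ### Decompositions from towers -/

section Tower

variable {C : Type*} [Category* C] [HasZeroObject C] [HasShift C ℤ] [Preadditive C]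
  [∀ n : ℤ, (shiftFunctor C n).Additive] [Pretriangulated C] [IsTriangulated C]

/-- The third object of a distinguished triangle on a split epimorphism `q` is the shift of its
kernel `i`. -/
lemma isIso_of_split {K Y Z Q : C} {q : Y ⟶ Z} {g : Z ⟶ Q} {h : Q ⟶ Y⟦(1 : ℤ)⟧}
    (hT : Triangle.mk q g h ∈ distTriang C) (i : K ⟶ Y) (r : Y ⟶ K) (s : Z ⟶ Y)
    (hir : i ≫ r = 𝟙 _) (hsq : s ≫ q = 𝟙 _) (hiq : i ≫ q = 0) (hid : r ≫ i + q ≫ s = 𝟙 _) :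
    IsIso (h ≫ r⟦(1 : ℤ)⟧') := by
  have hqg : q ≫ g = 0 := comp_distTriang_mor_zero₁₂ _ hT
  have hhq : h ≫ q⟦(1 : ℤ)⟧' = 0 := comp_distTriang_mor_zero₃₁ _ hT
  have hg : g = 0 := by rw [← Category.id_comp g, ← hsq, Category.assoc, hqg, comp_zero]
  have hiq' : i⟦(1 : ℤ)⟧' ≫ q⟦(1 : ℤ)⟧' = 0 := by rw [← Functor.map_comp, hiq, Functor.map_zero]
  obtain ⟨v, hv⟩ : ∃ v : K⟦(1 : ℤ)⟧ ⟶ Q, i⟦(1 : ℤ)⟧' = v ≫ h :=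
    Triangle.coyoneda_exact₁ _ hT (i⟦(1 : ℤ)⟧') hiq'
  refine ⟨v, ?_, ?_⟩
  · obtain ⟨w, hw⟩ := coyoneda_exact₃ hT ((h ≫ r⟦(1 : ℤ)⟧') ≫ v - 𝟙 Q) (by
      rw [Preadditive.sub_comp, Category.assoc, ← hv, Category.assoc, ← Functor.map_comp,
        Category.id_comp, eq_sub_of_add_eq hid, Functor.map_sub, CategoryTheory.Functor.map_id,
        Preadditive.comp_sub, Functor.map_comp, reassoc_of% hhq, zero_comp, sub_zero,
        Category.comp_id, sub_self])
    rwa [hg, comp_zero, sub_eq_zero] at hw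
  · rw [← Category.assoc, ← hv, ← Functor.map_comp, hir, CategoryTheory.Functor.map_id]

/-- Decompositions obtained from towers of maps that are detected by a family of objects. -/
theorem decomposes_of_detecting [HasProductsOfShape ℕ C] {J : Type*} {G : J → C}
    (hs : ∀ a, ∃ b, Nonempty (G a ≅ (G b)⟦(1 : ℤ)⟧)) {N Y : ObjectProperty C}
    (hN : ∀ Z, N Z ↔ ∀ a (f : G a ⟶ Z), f = 0) [Y.IsTriangulated] [Y.IsClosedUnderIsomorphisms]
    (hprod : ∀ x : ℕ → C, (∀ n, Y (x n)) → Y (∏ᶜ x))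
    (emb : ∀ X : C, ∃ (Z : C) (c : X ⟶ Z), Y Z ∧ ∀ a (f : G a ⟶ X), f ≫ c = 0 → f = 0) :
    Decomposes N Y := by
  -- The tower computes a cone, which produces a decomposition of `X₀⟦1⟧`; it is applied to a
  -- desuspension.
  suffices key : ∀ X₀ : C, N.extensionProduct Y (X₀⟦(1 : ℤ)⟧) by
    intro X
    exact (N.extensionProduct Y).prop_of_iso
      ((shiftFunctorCompIsoId C (-1 : ℤ) 1 (by lia)).app X) (key (X⟦(-1 : ℤ)⟧))
  intro X₀
  -- The fibre of a detecting map `c` works: a map from `G a` to the fibre becomes zero after `c`,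
  -- hence is already zero in `X`.
  have step : ∀ X : C, ∃ (X' : C) (t : X' ⟶ X), Y.trW t ∧ ∀ a (f : G a ⟶ X'), f ≫ t = 0 := by
    intro X
    obtain ⟨Z, c, hZ, hc⟩ := emb X
    obtain ⟨X', t, h, hT⟩ := distinguished_cocone_triangle₁ c
    refine ⟨X', t, ⟨_, _, _, hT, hZ⟩, fun a f => hc a _ ?_⟩
    rw [Category.assoc, show t ≫ c = 0 from comp_distTriang_mor_zero₁₂ _ hT, comp_zero]
  choose nx t ht ht' using step
  obtain ⟨X, hX₀, tr, htr, htr'⟩ : ∃ (X : ℕ → C) (_ : X 0 = X₀) (tr : ∀ n, X (n + 1) ⟶ X n),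
      (∀ n, Y.trW (tr n)) ∧ ∀ n a (f : G a ⟶ X (n + 1)), f ≫ tr n = 0 :=
    ⟨fun n => Nat.rec X₀ (fun _ X => nx X) n, rfl, fun n => t _, fun n => ht _,
      fun n a f => ht' _ a f⟩
  subst hX₀
  let q : ∀ n, X n ⟶ X 0 := fun n => Nat.rec (𝟙 _) (fun n q => tr n ≫ q) n
  have hq : ∀ n, q (n + 1) = tr n ≫ q n := fun n => rfl
  have hqW : ∀ n, Y.trW (q n) := fun n => by
    induction n with
    | zero => exact MorphismProperty.id_mem _ _
    | succ n ih => rw [hq]; exact MorphismProperty.comp_mem _ _ _ (htr n) ih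
  let S : C := ∏ᶜ X
  let S₀ : C := ∏ᶜ fun _ : ℕ => X 0
  let s : S ⟶ S := Pi.lift fun n => Pi.π X (n + 1) ≫ tr n
  let s₀ : S₀ ⟶ S₀ := Pi.lift fun n => Pi.π _ (n + 1)
  have s_π : ∀ n, s ≫ Pi.π X n = Pi.π X (n + 1) ≫ tr n := fun n => by simp [s]
  have s₀_π : ∀ n, s₀ ≫ Pi.π _ n = Pi.π (fun _ : ℕ => X 0) (n + 1) := fun n => by simp [s₀]
  -- Maps into a product are tested componentwise, so no compactness of the `G a` is involved.
  have gs : ∀ a (g : G a ⟶ S), g ≫ s = 0 := fun a g => by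
    refine Pi.hom_ext _ _ fun n => ?_
    rw [Category.assoc, s_π, ← Category.assoc, htr', zero_comp]
  have gs' : ∀ a (g : G a ⟶ S⟦(1 : ℤ)⟧), g ≫ s⟦(1 : ℤ)⟧' = 0 := fun a g => by
    obtain ⟨b, ⟨e⟩⟩ := hs a
    obtain ⟨h, hh⟩ := (shiftFunctor C (1 : ℤ)).map_surjective (e.inv ≫ g)
    rw [← cancel_epi e.inv, ← Category.assoc, ← hh, ← Functor.map_comp, gs, Functor.map_zero,
      comp_zero]
  obtain ⟨Q, g₁, h₁, hT₁⟩ := distinguished_cocone_triangle (𝟙 S - s)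
  obtain ⟨Q₀, g₂, h₂, hT₂⟩ := distinguished_cocone_triangle (𝟙 S₀ - s₀)
  have hQ : N Q := by
    rw [hN]
    intro a f
    have h₀ : f ≫ h₁ = 0 := by
      have h : h₁ ≫ (𝟙 S - s)⟦(1 : ℤ)⟧' = 0 := comp_distTriang_mor_zero₃₁ _ hT₁
      rw [Functor.map_sub, CategoryTheory.Functor.map_id, Preadditive.comp_sub, Category.comp_id,
        sub_eq_zero] at h
      rw [h, ← Category.assoc, gs']
    obtain ⟨k, rfl⟩ := coyoneda_exact₃ hT₁ f h₀
    have h : (𝟙 S - s) ≫ g₁ = 0 := comp_distTriang_mor_zero₁₂ _ hT₁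
    rw [Preadditive.sub_comp, Category.id_comp, sub_eq_zero] at h
    rw [h, ← Category.assoc, gs, zero_comp]
  -- The cones of the maps `q n` to the constant tower lie in `Y`, and so does their product; this
  -- bounds the cone of the induced map `Q ⟶ Q₀`.
  have hb : Y.trW (Limits.Pi.map q) := by
    choose Z g h hT hZ using hqW
    exact ⟨_, _, _, productTriangle_distinguished (fun n => Triangle.mk (q n) (g n) (h n)) hT,
      hprod _ hZ⟩
  obtain ⟨c, hc⟩ : ∃ c : Q ⟶ Q₀, Y.trW c := by
    obtain ⟨c, hc, -, -⟩ := MorphismProperty.compatible_with_triangulation (W := Y.trW) _ _ hT₁ hT₂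
      (Limits.Pi.map q) (Limits.Pi.map q) hb hb (by
        refine Pi.hom_ext _ _ fun n => ?_
        change ((𝟙 S - s) ≫ Limits.Pi.map q) ≫ _ = (Limits.Pi.map q ≫ (𝟙 S₀ - s₀)) ≫ _
        simp only [Preadditive.sub_comp, Preadditive.comp_sub, Category.id_comp,
          Category.assoc, Limits.Pi.map_π]
        rw [reassoc_of% s_π, s₀_π, Limits.Pi.map_π, hq, Category.id_comp, Limits.Pi.map_π])
    exact ⟨c, hc⟩
  let π₀ : S₀ ⟶ X 0 := Pi.π _ 0
  -- On the constant tower `𝟙 - s₀` is a split epimorphism whose kernel is the diagonal copy of `X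
  -- 0`. A section is given by minus the partial sums, so `Q₀` is `(X 0)⟦1⟧`.
  have hiso : IsIso (h₂ ≫ π₀⟦(1 : ℤ)⟧') := isIso_of_split hT₂ (Pi.lift fun _ => 𝟙 _) π₀
    (Pi.lift fun n => - ∑ m ∈ Finset.range n, Pi.π _ m) (by simp [π₀]) ?_ ?_ ?_
  · obtain ⟨Z, g, h, hT, hZ⟩ := (MorphismProperty.cancel_right_of_respectsIso Y.trW c
      (h₂ ≫ π₀⟦(1 : ℤ)⟧')).2 hc
    exact ⟨_, _, _, _, _, hT, hQ, hZ⟩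
  · refine Pi.hom_ext _ _ fun n => ?_
    simp only [Preadditive.sub_comp, Preadditive.comp_sub, Category.comp_id, Category.id_comp,
      Category.assoc, s₀_π, Pi.lift_π, Finset.sum_range_succ]
    abel
  · refine Pi.hom_ext _ _ fun n => ?_
    simp only [Preadditive.sub_comp, Preadditive.comp_sub, Category.comp_id,
      Category.assoc, s₀_π, Pi.lift_π, sub_self, zero_comp]
  · refine Pi.hom_ext _ _ fun n => ?_
    have h : ∀ m, (𝟙 S₀ - s₀) ≫ Pi.π (fun _ : ℕ => X 0) m = Pi.π _ m - Pi.π _ (m + 1) := fun m => by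
      rw [Preadditive.sub_comp, Category.id_comp, s₀_π]
    simp only [Preadditive.add_comp, Category.comp_id, Category.id_comp,
      Category.assoc, Pi.lift_π, Preadditive.comp_neg, Preadditive.comp_sum]
    rw [Finset.sum_congr rfl fun m _ => h m, Finset.sum_range_sub']
    abel

end Tower

/-! ### Products in the homotopy category -/

section HomotopyProducts

variable {V : Type*} [Category* V] [Preadditive V] {ι : Type*} {c : ComplexShape ι}

section

variable {J : Type*} [HasProductsOfShape J V] {X : J → HomologicalComplex V c}
  {b : Fan X} (hb : IsLimit b)

/-- The degree `i` component of a product of complexes is a product. -/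
def fanLift (i : ι) {T : V} (g : ∀ j, T ⟶ (X j).X i) : T ⟶ b.pt.X i :=
  (isLimitOfPreserves (HomologicalComplex.eval V c i) hb).lift
    ⟨T, Discrete.natTrans fun ⟨j⟩ => g j⟩

lemma fan_fac (i : ι) {T : V} (g : ∀ j, T ⟶ (X j).X i) (j : J) :
    fanLift hb i g ≫ (b.proj j).f i = g j :=
  (isLimitOfPreserves (HomologicalComplex.eval V c i) hb).fac _ ⟨j⟩

lemma fan_hom_ext (hb : IsLimit b) (i : ι) {T : V} (g h : T ⟶ b.pt.X i)
    (H : ∀ j, g ≫ (b.proj j).f i = h ≫ (b.proj j).f i) : g = h :=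
  (isLimitOfPreserves (HomologicalComplex.eval V c i) hb).hom_ext fun ⟨j⟩ => H j

/-- A morphism to a product of complexes is null-homotopic if its components are. -/
def homotopyOfFan {T : HomologicalComplex V c} (f : T ⟶ b.pt)
    (h : ∀ j, Homotopy (f ≫ b.proj j) 0) : Homotopy f 0 where
  hom i k := fanLift hb k fun j => (h j).hom i k
  zero i k hik := fan_hom_ext hb _ _ _ fun j => by
    rw [fan_fac, (h j).zero i k hik, zero_comp]
  comm i := fan_hom_ext hb _ _ _ fun j => by
    have := (h j).comm i
    simp only [HomologicalComplex.comp_f, HomologicalComplex.zero_f, add_zero] at this ⊢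
    rw [this, Preadditive.add_comp]
    congr 1
    · simp only [dNext, AddMonoidHom.mk'_apply]
      rw [Category.assoc, fan_fac]
    · simp only [prevD, AddMonoidHom.mk'_apply]
      rw [Category.assoc, ← (b.proj j).comm, ← Category.assoc, fan_fac]

end

/-- The image in the homotopy category of a product fan of complexes is a product. -/
def isLimitQuotientFan {J : Type*} [HasProductsOfShape J V]
    {X : J → HomologicalComplex V c} {b : Fan X} (hb : IsLimit b) :
    IsLimit (Fan.mk ((HomotopyCategory.quotient V c).obj b.pt)
      (fun j => (HomotopyCategory.quotient V c).map (b.proj j))) := by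
  refine Fan.IsLimit.mk _ (fun s => (HomotopyCategory.quotient V c).map
    (Fan.IsLimit.lift hb fun j => ((HomotopyCategory.quotient V c).map_surjective
      (X := s.pt.as) (Y := X j) (s.proj j)).choose)) (fun s j => ?_) (fun s m hm => ?_)
  · refine ((HomotopyCategory.quotient V c).map_comp _ _).symm.trans ?_
    rw [Fan.IsLimit.fac]
    exact ((HomotopyCategory.quotient V c).map_surjective (X := s.pt.as) (Y := X j)
      (s.proj j)).choose_spec
  · obtain ⟨m', rfl⟩ := (HomotopyCategory.quotient V c).map_surjective
      (X := s.pt.as) (Y := b.pt) m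
    refine HomotopyCategory.eq_of_homotopy _ _ (Homotopy.equivSubZero.symm
      (homotopyOfFan hb _ fun j => HomotopyCategory.homotopyOfEq _ _ ?_))
    rw [Preadditive.sub_comp, Functor.map_sub, Functor.map_zero, sub_eq_zero,
      Fan.IsLimit.fac]
    refine ((HomotopyCategory.quotient V c).map_comp _ _).trans ((hm j).trans ?_)
    exact ((HomotopyCategory.quotient V c).map_surjective (X := s.pt.as) (Y := X j)
      (s.proj j)).choose_spec.symm

lemma hasProductsOfShape_homotopyCategory (J : Type*) [HasProductsOfShape J V] :
    HasProductsOfShape J (HomotopyCategory V c) where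
  has_limit F := by
    have : HasLimit (Discrete.functor (F.obj ∘ Discrete.mk)) :=
      ⟨⟨⟨_, isLimitQuotientFan (X := fun j => (F.obj ⟨j⟩).as)
        (productIsProduct (fun j => (F.obj ⟨j⟩).as))⟩⟩⟩
    exact hasLimit_of_iso Discrete.natIsoFunctor.symm

end HomotopyProducts

/-! ### K-projective and K-injective resolutions -/

section Resolutions

variable {R : Type u} [Ring R]

instance : HasProductsOfShape ℕ (K R) := hasProductsOfShape_homotopyCategory ℕ

lemma rightOrthogonal_pi {C : Type*} [Category* C] [HasZeroMorphisms C] {J : Type*}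
    (P : ObjectProperty C) (x : J → C) [HasProduct x] (hx : ∀ j, P.rightOrthogonal (x j)) :
    P.rightOrthogonal (∏ᶜ x) := fun _ f hY =>
  Pi.hom_ext _ _ fun j => (hx j (f ≫ Pi.π x j) hY).trans zero_comp.symm

lemma kPI_pi (x : ℕ → K R) (hx : ∀ n, kPI R (x n)) : kPI R (∏ᶜ x) := by
  choose y hy e using hx
  let Y : ℕ → CochainComplex (ModuleCat.{u} R) ℤ := fun n => (y n).as
  refine ⟨(HomotopyCategory.quotient _ _).obj (∏ᶜ Y), fun n A B f hf g => ?_,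
    ⟨Pi.mapIso (fun n => (e n).some) ≪≫ (productIsProduct y).conePointUniqueUpToIso
      (isLimitQuotientFan (productIsProduct Y))⟩⟩
  choose h hh using fun j => hy j n f hf (g ≫ (Pi.π Y j).f n)
  exact ⟨fanLift (productIsProduct Y) n h, fan_hom_ext (productIsProduct Y) n _ _ fun j =>
    (Category.assoc _ _ _).trans ((congrArg (f ≫ ·) (fan_fac (productIsProduct Y) n h j)).trans
      (hh j))⟩

lemma nonempty_stalk_iso_shift (j : ℤ) (M : ModuleCat.{u} R) :
    Nonempty (stalk j M ≅ (stalk (j + 1) M)⟦(1 : ℤ)⟧) :=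
  ⟨(((HomotopyCategory.singleFunctors (ModuleCat.{u} R)).shiftIso 1 j (j + 1)
    (add_comm _ _)).app M).symm⟩

lemma acyclic_iff_stalk (X : K R) :
    HomotopyCategory.subcategoryAcyclic (ModuleCat.{u} R) X ↔
      ∀ (j : ULift.{u} ℤ) (f : stalk j.down (ModuleCat.of R R) ⟶ X), f = 0 := by
  obtain ⟨X, rfl⟩ := HomotopyCategory.quotient_obj_surjective X
  rw [HomotopyCategory.quotient_obj_mem_subcategoryAcyclic_iff_acyclic, acyclic_iff]
  have ext : ∀ {N : ModuleCat.{u} R} {f g : ModuleCat.of R R ⟶ N}, f.hom 1 = g.hom 1 → f = g :=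
    fun h => ModuleCat.hom_ext (LinearMap.ext_ring h)
  have mk : ∀ {N : ModuleCat.{u} R} (x : N), ∃ f : ModuleCat.of R R ⟶ N, f.hom 1 = x :=
    fun x => ⟨ModuleCat.ofHom (LinearMap.toSpanSingleton R _ x), one_smul R x⟩
  simp only [stalk_hom_eq_zero_iff]
  constructor
  · rintro h ⟨j⟩ i k hij hjk f hf
    obtain ⟨y, hy⟩ := h i j k hij hjk (f.hom 1) (LinearMap.congr_fun (congrArg ModuleCat.Hom.hom hf) 1)
    obtain ⟨g, hg⟩ := mk y
    exact ⟨g, ext ((congrArg (X.d i j).hom hg).trans hy)⟩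
  · intro h i j k hij hjk x hx
    obtain ⟨f, hf⟩ := mk x
    obtain ⟨g, hg⟩ := h ⟨j⟩ i k hij hjk f (ext ((congrArg (X.d j k).hom hf).trans hx))
    exact ⟨g.hom 1, (LinearMap.congr_fun (congrArg ModuleCat.Hom.hom hg) 1).trans hf⟩

/-- Every complex has a K-projective resolution. -/
lemma decomposes_leftOrthogonal_acyclic :
    Decomposes (HomotopyCategory.subcategoryAcyclic (ModuleCat.{u} R)).leftOrthogonal
      (HomotopyCategory.subcategoryAcyclic (ModuleCat.{u} R)) :=
  decomposes_leftOrthogonal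
    (G := fun j : ULift.{u} ℤ => stalk j.down (ModuleCat.of R R))
    (fun j => isFinitary_stalk j.down (ModuleCat.of R R))
    (fun j => ⟨⟨j.down + 1⟩, nonempty_stalk_iso_shift _ _⟩) acyclic_iff_stalk

/-- Complexes of injectives with zero differential are K-injective. -/
lemma rightOrthogonal_of_injective (C : CochainComplex (ModuleCat.{u} R) ℤ)
    [∀ n, Injective (C.X n)] (hC : ∀ i j, C.d i j = 0) :
    (HomotopyCategory.subcategoryAcyclic (ModuleCat.{u} R)).rightOrthogonal
      ((HomotopyCategory.quotient _ _).obj C) := by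
  intro W f hW
  obtain ⟨W, rfl⟩ := HomotopyCategory.quotient_obj_surjective W
  rw [HomotopyCategory.quotient_obj_mem_subcategoryAcyclic_iff_acyclic] at hW
  obtain ⟨f, rfl⟩ := (HomotopyCategory.quotient _ _).map_surjective f
  have key : ∀ k j, ∃ t : W.X k ⟶ C.X j, j + 1 = k → W.d j k ≫ t = f.f j := by
    intro k j
    by_cases hjk : j + 1 = k
    · have hex : (W.sc' (j - 1) j k).Exact := by
        rw [← W.exactAt_iff' (j - 1) j k (by simp) (by simpa using hjk)]
        exact hW j
      obtain ⟨t, ht⟩ : ∃ t, W.d j k ≫ t = f.f j :=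
        ⟨hex.descToInjective (f.f j) (by
          change W.d _ _ ≫ _ = 0
          rw [← f.comm, hC, comp_zero]), hex.comp_descToInjective _ _⟩
      exact ⟨t, fun _ => ht⟩
    · exact ⟨0, fun h => (hjk h).elim⟩
  choose t ht using key
  rw [quotient_map_eq_zero_iff]
  exact ⟨t, fun i j k _ hjk => by rw [hC, comp_zero, add_zero, ht k j hjk]⟩

/-- Each degree maps to an injective containing the cokernel of the incoming differential. With zero
differentials on the target, a cocycle maps to zero only if it is a coboundary, so cohomology is
detected, and the target is K-injective. -/
lemma exists_hom_injective (X : K R) :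
    ∃ (Z : K R) (c : X ⟶ Z),
      (HomotopyCategory.subcategoryAcyclic (ModuleCat.{u} R)).rightOrthogonal Z ∧
      ∀ (j : ULift.{u} ℤ) (f : stalk j.down (ModuleCat.of R R) ⟶ X), f ≫ c = 0 → f = 0 := by
  obtain ⟨X, rfl⟩ := HomotopyCategory.quotient_obj_surjective X
  let E : ℤ → ModuleCat.{u} R := fun k => Injective.under (cokernel (X.d (k - 1) k))
  let C : CochainComplex (ModuleCat.{u} R) ℤ :=
    { X := E
      d _ _ := 0 }
  let φ : ∀ k, X.X k ⟶ E k := fun k => cokernel.π _ ≫ Injective.ι _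
  have hφ : ∀ i k, i + 1 = k → X.d i k ≫ φ k = 0 := by
    intro i k hik
    obtain rfl : i = k - 1 := by lia
    rw [cokernel.condition_assoc, zero_comp]
  let c : X ⟶ C :=
    { f := φ
      comm' i k hik := (comp_zero.trans (hφ i k hik).symm) }
  have : ∀ n, Injective (C.X n) := fun n => inferInstanceAs (Injective (Injective.under _))
  refine ⟨(HomotopyCategory.quotient _ _).obj C, (HomotopyCategory.quotient _ _).map c,
    rightOrthogonal_of_injective C fun _ _ => rfl, ?_⟩
  rintro ⟨j⟩ f hf
  obtain ⟨f, rfl⟩ := (HomotopyCategory.quotient _ _).map_surjective f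
  rw [← Functor.map_comp, stalk_map_eq_zero_iff (sub_add_cancel j 1)] at hf
  obtain ⟨g, hg⟩ := hf
  let e := HomologicalComplex.singleObjXSelf (ComplexShape.up ℤ) j (ModuleCat.of R R)
  have h₁ : (e.inv ≫ f.f j) ≫ cokernel.π (X.d (j - 1) j) = 0 := by
    rw [← cancel_mono (Injective.ι _), zero_comp, Category.assoc, Category.assoc]
    exact hg.symm.trans comp_zero
  obtain ⟨y, hy⟩ := (ShortComplex.moduleCat_exact_iff _).1
    (ShortComplex.exact_cokernel (X.d (j - 1) j)) ((e.inv ≫ f.f j).hom (1 : R))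
    (LinearMap.congr_fun (congrArg ModuleCat.Hom.hom h₁) (1 : R))
  exact (stalk_map_eq_zero_iff (sub_add_cancel j 1) f).2
    ⟨ModuleCat.ofHom (LinearMap.toSpanSingleton R _ y), ModuleCat.hom_ext (LinearMap.ext_ring
      ((congrArg (X.d (j - 1) j).hom (one_smul R y)).trans hy))⟩

/-- Every complex has a K-injective resolution. -/
lemma decomposes_acyclic_rightOrthogonal :
    Decomposes (HomotopyCategory.subcategoryAcyclic (ModuleCat.{u} R))
      (HomotopyCategory.subcategoryAcyclic (ModuleCat.{u} R)).rightOrthogonal :=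
  decomposes_of_detecting
    (G := fun j : ULift.{u} ℤ => stalk j.down (ModuleCat.of R R))
    (fun j => ⟨⟨j.down + 1⟩, nonempty_stalk_iso_shift _ _⟩) acyclic_iff_stalk
    (fun x hx => rightOrthogonal_pi _ x hx) exists_hom_injective

/-! ### Resolutions by complexes of pure-injective modules -/

/-- The morphism from a complex to its bidual. -/
def toBidual (X : CochainComplex (ModuleCat.{u} R) ℤ) :
    X ⟶ ((bidual R).mapHomologicalComplex (ComplexShape.up ℤ)).obj X where
  f i := unitL (X.X i)

/-- The bidual has character modules as components and is a retract of its own bidual by the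
triangle identity, hence is orthogonal to the pure acyclic complexes. Detection of maps from
finitely presented stalks is `exists_lift_of_bidual`. -/
lemma exists_hom_bidual (X : K R) :
    ∃ (Z : K R) (c : X ⟶ Z), (kPI R ⊓ (pureAcyclic R).rightOrthogonal) Z ∧
      ∀ (a : FpIndex R × ℤ) (f : stalk a.2 (fpModule a.1) ⟶ X), f ≫ c = 0 → f = 0 := by
  obtain ⟨X, rfl⟩ := HomotopyCategory.quotient_obj_surjective X
  refine ⟨(HomotopyCategory.quotient _ _).obj _, (HomotopyCategory.quotient _ _).map (toBidual X),
    ⟨ObjectProperty.le_isoClosure _ _ fun n => isPureInjective_dualR _, fun W f hW => ?_⟩, ?_⟩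
  · obtain ⟨W, rfl⟩ := HomotopyCategory.quotient_obj_surjective W
    exact hom_eq_zero_of_bidual_retract hW (fun i => dualRMap (unitR _)) (fun i => rfl)
      (fun i j => rfl) f
  · rintro ⟨a, j⟩ f hf
    obtain ⟨f, rfl⟩ := (HomotopyCategory.quotient _ _).map_surjective f
    rw [← Functor.map_comp, stalk_map_eq_zero_iff (sub_add_cancel j 1)] at hf
    obtain ⟨g : fpModule a ⟶ dualR (dualL (X.X (j - 1))), hg⟩ := hf
    refine (stalk_map_eq_zero_iff (sub_add_cancel j 1) f).2 ?_
    obtain ⟨x, hx, hx'⟩ := exists_lift_of_bidual (X.d (j - 1) j) a.2.2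
      (fun i => ((HomologicalComplex.singleObjXSelf (ComplexShape.up ℤ) j (fpModule a)).inv ≫
        f.f j).hom (Submodule.Quotient.mk (Pi.single i 1)))
      (fun i => g.hom (Submodule.Quotient.mk (Pi.single i 1)))
      (fun l => by
        simp only [← map_smul, ← map_sum]
        exact (congrArg g.hom (fpModule_sum_eq_zero a l)).trans (map_zero _))
      (fun i => LinearMap.congr_fun (congrArg ModuleCat.Hom.hom hg) _)
    obtain ⟨h, hh⟩ := exists_fpModule_hom a x hx
    exact ⟨h, fpModule_hom_ext a fun i => (congrArg (X.d (j - 1) j).hom (hh i)).trans (hx' i)⟩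

instance : (kPI R).IsClosedUnderIsomorphisms :=
  inferInstanceAs (dwPureInjective R).isoClosure.IsClosedUnderIsomorphisms

/-- The orthogonality is carried along in the second class: biduals have it directly, whereas for
all of `kPI R` it is deduced from this decomposition. -/
lemma decomposes_pureAcyclic_inf :
    Decomposes (pureAcyclic R) (kPI R ⊓ (pureAcyclic R).rightOrthogonal) :=
  decomposes_of_detecting
    (G := fun a : FpIndex R × ℤ => stalk a.2 (fpModule a.1))
    (fun a => ⟨⟨a.1, a.2 + 1⟩, nonempty_stalk_iso_shift _ _⟩)
    (fun Z => (pureAcyclic_iff Z).trans ⟨fun h a => h a.1 a.2, fun h a j => h ⟨a, j⟩⟩)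
    (fun x hx => ⟨kPI_pi x fun n => (hx n).1, rightOrthogonal_pi _ x fun n => (hx n).2⟩)
    exists_hom_bidual

lemma isZero_of_kPI_of_pureAcyclic {X : K R} (h : kPI R X) (h' : pureAcyclic R X) : IsZero X := by
  obtain ⟨Y, hY, ⟨e⟩⟩ := h
  have := (pureAcyclic R).prop_of_iso e h'
  exact (isZero_of_isPureInjective hY this).of_iso e

/-- There are no nonzero morphisms from a pure acyclic complex to a complex of pure-injective
modules. -/
lemma kPI_le_rightOrthogonal : kPI R ≤ (pureAcyclic R).rightOrthogonal := by
  intro Y hY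
  obtain ⟨P, I, f, g, h, hT, hP, hI⟩ := decomposes_pureAcyclic_inf Y
  -- The pure acyclic part of `Y` is an extension of complexes in K(PI), hence lies in K(PI) ∩ PAc =
  -- 0, and `Y` is isomorphic to the orthogonal part `I`.
  have hP' : kPI R P := (kPI R).ext_of_isTriangulatedClosed₁ _ hT hY hI.1
  have : IsIso g := (Triangle.isZero₁_iff_isIso₂ _ hT).1 (isZero_of_kPI_of_pureAcyclic hP' hP)
  exact (pureAcyclic R).rightOrthogonal.prop_of_iso (asIso g).symm hI.2

lemma decomposes_pureAcyclic_kPI : Decomposes (pureAcyclic R) (kPI R) :=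
  decomposes_pureAcyclic_inf.mono le_rfl inf_le_left

end Resolutions

/-! ### Duals of complexes -/

section DualComplex

variable {C V : Type*} [Category* C] [Category* V] [Preadditive C] [Preadditive V]
  (D : Cᵒᵖ ⥤ V) [D.Additive] (s : ℤ → ℤˣ) (n : ℤ)

/-- The complex with components `D (E^{n - q})`, with signs `s` in the differential. -/
def dualComplex (E : CochainComplex C ℤ) : CochainComplex V ℤ where
  X q := D.obj (op (E.X (n - q)))
  d q q' := s q • D.map (E.d (n - q') (n - q)).op
  shape q q' h := by
    rw [E.shape _ _ (fun h' => h (by simp only [ComplexShape.up_Rel] at h' ⊢; lia)), op_zero,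
      D.map_zero, smul_zero]
  d_comp_d' q q' q'' _ _ := by
    rw [Linear.units_smul_comp, Linear.comp_units_smul, ← D.map_comp, ← op_comp, E.d_comp_d,
      op_zero, D.map_zero, smul_zero, smul_zero]

variable {D s n}

/-- Morphisms to the dual complex are null-homotopic if cocycles in the Hom double complex are
coboundaries. -/
lemma dualComplex_hom_eq_zero {E : CochainComplex C ℤ} {X : CochainComplex V ℤ}
    (h : ∀ k : ∀ p q, X.X q ⟶ D.obj (op (E.X p)),
      (∀ p p' q q', p + 1 = p' → q + 1 = q' → p' + q = n →
        X.d q q' ≫ k p q' = s q • k p' q ≫ D.map (E.d p p').op) →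
      ∃ t : ∀ p q, X.X q ⟶ D.obj (op (E.X p)), ∀ p p' q q' q'', p + 1 = p' → q + 1 = q' →
        q' + 1 = q'' → p + q' = n →
        k p q' = X.d q' q'' ≫ t p q'' + s q • t p' q' ≫ D.map (E.d p p').op)
    (f : (HomotopyCategory.quotient _ (ComplexShape.up ℤ)).obj X ⟶
      (HomotopyCategory.quotient _ _).obj (dualComplex D s n E)) : f = 0 := by
  obtain ⟨f, rfl⟩ := (HomotopyCategory.quotient _ _).map_surjective f
  let F : ∀ q, X.X q ⟶ D.obj (op (E.X (n - q))) := f.f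
  have hF : ∀ q q', X.d q q' ≫ F q' = s q • F q ≫ D.map (E.d (n - q') (n - q)).op :=
    fun q q' => (f.comm q q').symm.trans (Linear.comp_units_smul (F q) (s q) _)
  -- The double-indexed family is supported on the antidiagonal `p + q = n`; elsewhere it is zero
  -- and plays no role.
  obtain ⟨t, ht⟩ := h (fun p q => if h : n - q = p then F q ≫ eqToHom (by rw [h]) else 0)
    (by
      intro p p' q q' hp hq hn
      obtain rfl : p' = n - q := by lia
      obtain rfl : p = n - q' := by lia
      rw [dif_pos rfl, dif_pos rfl, eqToHom_refl, eqToHom_refl, Category.comp_id,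
        Category.comp_id, hF])
  rw [quotient_map_eq_zero_iff]
  refine ⟨fun q r => t (n - r) q, fun i j k hij hjk => ?_⟩
  have := ht (n - j) (n - i) i j k (by lia) hij hjk (by lia)
  rw [dif_pos rfl, eqToHom_refl, Category.comp_id, ← Linear.comp_units_smul] at this
  exact this

lemma exists_of_dualComplex_hom_eq_zero {E : CochainComplex C ℤ} {X : CochainComplex V ℤ}
    (h : ∀ f : (HomotopyCategory.quotient _ (ComplexShape.up ℤ)).obj X ⟶
      (HomotopyCategory.quotient _ _).obj (dualComplex D s n E), f = 0)
    (k : ∀ p q, X.X q ⟶ D.obj (op (E.X p)))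
    (hk : ∀ p p' q q', p + 1 = p' → q + 1 = q' → p' + q = n →
        X.d q q' ≫ k p q' = s q • k p' q ≫ D.map (E.d p p').op) :
    ∃ t : ∀ p q, X.X q ⟶ D.obj (op (E.X p)), ∀ p p' q q' q'', p + 1 = p' → q + 1 = q' →
      q' + 1 = q'' → p + q' = n →
      k p q' = X.d q' q'' ≫ t p q'' + s q • t p' q' ≫ D.map (E.d p p').op := by
  obtain ⟨t : ∀ q r, X.X q ⟶ D.obj (op (E.X (n - r))), ht⟩ :=
    (quotient_map_eq_zero_iff _).1 (h ((HomotopyCategory.quotient _ _).map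
      { f := fun q => k (n - q) q
        comm' := fun q q' hqq' => (Linear.comp_units_smul (k (n - q) q) (s q) _).trans
          (hk (n - q') (n - q) q q' (by simp at hqq'; lia) hqq' (by lia)).symm }))
  refine ⟨fun p q => t q (n - p) ≫ eqToHom (by simp), ?_⟩
  intro p p' q q' q'' hp hq hq' hn
  have key : ∀ (q r : ℤ) (h : D.obj (op (E.X (n - (n - (n - r))))) = D.obj (op (E.X (n - r)))),
      t q (n - (n - r)) ≫ eqToHom h = t q r := by
    intro q r
    have : ∀ (r' : ℤ) (_ : r' = r) (h : D.obj (op (E.X (n - r'))) = D.obj (op (E.X (n - r)))),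
      t q r' ≫ eqToHom h = t q r := by rintro _ rfl h; rw [eqToHom_refl, Category.comp_id]
    exact this _ (by lia)
  obtain rfl : p' = n - q := by lia
  obtain rfl : p = n - q' := by lia
  beta_reduce
  rw [key, key, ← Linear.comp_units_smul]
  exact ht q q' q'' hq hq'

lemma hom_units_smul {S : Type u} [Ring S] {A B : ModuleCat.{u} S} (v : ℤˣ) (φ : A ⟶ B) (a : A) :
    (v • φ).hom a = v • φ.hom a := by
  obtain rfl | rfl := Int.units_eq_one_or v
  · rw [one_smul, one_smul]
  · rw [Units.neg_smul, one_smul, Units.neg_smul, one_smul]; rfl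

/-- The dual of an acyclic complex is acyclic, if the duality is exact. -/
lemma acyclic_dualComplex {S S' : Type u} [Ring S] [Ring S']
    {D : (ModuleCat.{u} S)ᵒᵖ ⥤ ModuleCat.{u} S'} [D.Additive]
    (hD : ∀ {A B C : ModuleCat.{u} S} (f : A ⟶ B) (g : B ⟶ C),
      (∀ b, g.hom b = 0 → ∃ a, f.hom a = b) →
      ∀ x, (D.map f.op).hom x = 0 → ∃ y, (D.map g.op).hom y = x)
    {E : CochainComplex (ModuleCat.{u} S) ℤ} (hE : E.Acyclic) : (dualComplex D s n E).Acyclic := by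
  rw [acyclic_iff] at hE ⊢
  intro i j k hij hjk x hx
  obtain ⟨y, hy⟩ := hD (E.d (n - k) (n - j)) (E.d (n - j) (n - i))
    (hE _ _ _ (by lia) (by lia)) x (by
      have := (hom_units_smul (s j) _ x).symm.trans hx
      exact (smul_eq_zero_iff_eq _).1 this)
  refine ⟨s i • y, ?_⟩
  refine (hom_units_smul (s i) _ _).trans ?_
  rw [← hy]
  obtain h | h := Int.units_eq_one_or (s i)
  · rw [h, one_smul, one_smul]; rfl
  · rw [h, Units.neg_smul, one_smul, Units.neg_smul, one_smul]
    exact (congrArg Neg.neg (map_neg _ y)).trans (neg_neg _)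

end DualComplex

/-! ### Dual complexes and characters of the total tensor product -/

section TensorCharacters

variable {R : Type u} [Ring R]

/-- The duality from right modules to left modules. -/
def dualRFunctor (R : Type u) [Ring R] : (ModuleCat.{u} Rᵐᵒᵖ)ᵒᵖ ⥤ ModuleCat.{u} R where
  obj M := dualR M.unop
  map f := dualRMap f.unop

instance : (dualRFunctor R).Additive where
  map_add := dualRMap_add _ _

/-- The duality from left modules to right modules. -/
def dualLFunctor (R : Type u) [Ring R] : (ModuleCat.{u} R)ᵒᵖ ⥤ ModuleCat.{u} Rᵐᵒᵖ where
  obj M := dualL M.unop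
  map f := dualLMap f.unop

instance : (dualLFunctor R).Additive where
  map_add := dualLMap_add _ _

lemma acyclic_dualComplexR {s : ℤ → ℤˣ} {n : ℤ} {E : CochainComplex (ModuleCat.{u} Rᵐᵒᵖ) ℤ}
    (hE : E.Acyclic) : (dualComplex (dualRFunctor R) s n E).Acyclic :=
  acyclic_dualComplex (fun f g h x hx => by
    obtain ⟨χ, hχ⟩ := characters_of_exact f.hom.toAddMonoidHom g.hom.toAddMonoidHom h (evR x)
      (DFunLike.congr_fun (congrArg evR hx))
    exact ⟨mkR χ, dualR_ext hχ⟩) hE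

lemma acyclic_dualComplexL {s : ℤ → ℤˣ} {n : ℤ} {X : CochainComplex (ModuleCat.{u} R) ℤ}
    (hX : X.Acyclic) : (dualComplex (dualLFunctor R) s n X).Acyclic :=
  acyclic_dualComplex (fun f g h x hx => by
    obtain ⟨χ, hχ⟩ := characters_of_exact f.hom.toAddMonoidHom g.hom.toAddMonoidHom h (evL x)
      (DFunLike.congr_fun (congrArg evL hx))
    exact ⟨mkL χ, dualL_ext hχ⟩) hX

/-! ### Characters of the tensor product of two complexes -/

variable {E : CochainComplex (ModuleCat.{u} Rᵐᵒᵖ) ℤ} {X : CochainComplex (ModuleCat.{u} R) ℤ}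

/-- The inclusion of a summand of the tensor product of two complexes. -/
def tensorι (E : CochainComplex (ModuleCat.{u} Rᵐᵒᵖ) ℤ) (X : CochainComplex (ModuleCat.{u} R) ℤ)
    {p q n : ℤ} (h : p + q = n) :
    TensorOver R (E.X p) (X.X q) →+ (((tensorComplex R).obj E).obj X).X n :=
  (HomologicalComplex.ιMapBifunctor E X (tensor R) (ComplexShape.up ℤ) p q n h).hom

lemma tensor_d_ι {p p' q q' n n' : ℤ} (hp : p + 1 = p') (hq : q + 1 = q') (h : p + q = n)
    (hn : n + 1 = n') (z : TensorOver R (E.X p) (X.X q)) :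
    ((((tensorComplex R).obj E).obj X).d n n').hom (tensorι E X h z) =
      tensorι E X (show p' + q = n' by lia) (tensorMap (E.d p p') (𝟙 _) z) +
      p.negOnePow • tensorι E X (show p + q' = n' by lia) (tensorMap (𝟙 _) (X.d q q') z) := by
  have h₁ : HomologicalComplex.ιMapBifunctor E X (tensor R) (ComplexShape.up ℤ) p q n h ≫
      (HomologicalComplex.mapBifunctor E X (tensor R) (ComplexShape.up ℤ)).d n n' =
      (1 : ℤˣ) • (((tensor R).map (E.d p p')).app (X.X q) ≫
        HomologicalComplex.ιMapBifunctor E X (tensor R) (ComplexShape.up ℤ) p' q n'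
          (show p' + q = n' by lia)) +
      p.negOnePow • (((tensor R).obj (E.X p)).map (X.d q q') ≫
        HomologicalComplex.ιMapBifunctor E X (tensor R) (ComplexShape.up ℤ) p q' n'
          (show p + q' = n' by lia)) := by
    rw [HomologicalComplex.mapBifunctor.d_eq, Preadditive.comp_add,
      HomologicalComplex.mapBifunctor.ι_D₁, HomologicalComplex.mapBifunctor.ι_D₂,
      HomologicalComplex.mapBifunctor.d₁_eq E X (tensor R) (ComplexShape.up ℤ) hp q n'
        (show p' + q = n' by lia),
      HomologicalComplex.mapBifunctor.d₂_eq E X (tensor R) (ComplexShape.up ℤ) p hq n'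
        (show p + q' = n' by lia)]
    rfl
  refine (congrArg (fun f => f.hom z) h₁).trans ?_
  have hu : ∀ {A B : AddCommGrpCat.{u}} (v : ℤˣ) (φ : A ⟶ B) (a : A),
      (v • φ).hom a = v • φ.hom a := by
    intro A B v φ a
    obtain rfl | rfl := Int.units_eq_one_or v
    · rw [one_smul, one_smul]
    · rw [Units.neg_smul, one_smul, Units.neg_smul, one_smul]; rfl
  exact congrArg₂ (· + ·) ((hu 1 (((tensor R).map (E.d p p')).app (X.X q) ≫
      HomologicalComplex.ιMapBifunctor E X (tensor R) (ComplexShape.up ℤ) p' q n' _) z).trans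
    (one_smul _ _)) (hu p.negOnePow (((tensor R).obj (E.X p)).map (X.d q q') ≫
      HomologicalComplex.ιMapBifunctor E X (tensor R) (ComplexShape.up ℤ) p q' n' _) z)

lemma tensor_hom_ext_ι {A : Type} [AddCommGroup A] {n : ℤ}
    {a b : (((tensorComplex R).obj E).obj X).X n →+ A}
    (h : ∀ (p q : ℤ) (h : p + q = n) (z), a (tensorι E X h z) = b (tensorι E X h z)) : a = b := by
  -- The target is lifted to the universe of the modules, where it becomes an object of the category
  -- in which the total complex is a coproduct.
  let a' : (HomologicalComplex.mapBifunctor E X (tensor R) (ComplexShape.up ℤ)).X n ⟶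
    AddCommGrpCat.of (ULift.{u} A) :=
    AddCommGrpCat.ofHom (AddEquiv.ulift.symm.toAddMonoidHom.comp a)
  let b' : (HomologicalComplex.mapBifunctor E X (tensor R) (ComplexShape.up ℤ)).X n ⟶
    AddCommGrpCat.of (ULift.{u} A) :=
    AddCommGrpCat.ofHom (AddEquiv.ulift.symm.toAddMonoidHom.comp b)
  have : a' = b' := by
    apply HomologicalComplex.mapBifunctor.hom_ext
    intro p q hpq
    ext z
    exact h p q hpq z
  ext x
  exact congrArg (fun f => ULift.down (f.hom x)) this

lemma exists_tensor_char {A : Type} [AddCommGroup A] (n : ℤ)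
    (χ : ∀ p q : ℤ, TensorOver R (E.X p) (X.X q) →+ A) :
    ∃ φ : (((tensorComplex R).obj E).obj X).X n →+ A,
      ∀ (p q : ℤ) (h : p + q = n) (z), φ (tensorι E X h z) = χ p q z := by
  let φ : (HomologicalComplex.mapBifunctor E X (tensor R) (ComplexShape.up ℤ)).X n ⟶
    AddCommGrpCat.of (ULift.{u} A) := HomologicalComplex.mapBifunctorDesc fun p q _ =>
      AddCommGrpCat.ofHom (AddEquiv.ulift.symm.toAddMonoidHom.comp (χ p q))
  refine ⟨AddEquiv.ulift.toAddMonoidHom.comp φ.hom, fun p q h z => ?_⟩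
  exact congrArg (fun f => ULift.down (f.hom z)) (HomologicalComplex.ι_mapBifunctorDesc
    (F := tensor R) (c := ComplexShape.up ℤ) (fun p q _ =>
      AddCommGrpCat.ofHom (AddEquiv.ulift.symm.toAddMonoidHom.comp (χ p q))) p q h)

lemma units_smul_apply {A B : Type*} [AddCommGroup A] [AddCommGroup B] (v : ℤˣ) (f : A →+ B)
    (a : A) : f (v • a) = v • f a := by
  obtain rfl | rfl := Int.units_eq_one_or v
  · rw [one_smul, one_smul]
  · rw [Units.neg_smul, one_smul, Units.neg_smul, one_smul, map_neg]

/-- The tensor product of two complexes is acyclic if and only if cocycles in the double complex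
of characters are coboundaries. -/
lemma tensorComplex_acyclic_iff :
    (((tensorComplex R).obj E).obj X).Acyclic ↔
      ∀ (n : ℤ) (χ : ∀ p q : ℤ, TensorOver R (E.X p) (X.X q) →+ QZ),
        (∀ p p' q q', p + 1 = p' → q + 1 = q' → p' + q = n → ∀ z : TensorOver R (E.X p) (X.X q),
          χ p' q (tensorMap (E.d p p') (𝟙 _) z) +
            p.negOnePow • χ p q' (tensorMap (𝟙 _) (X.d q q') z) = 0) →
        ∃ χ' : ∀ p q : ℤ, TensorOver R (E.X p) (X.X q) →+ QZ,
          ∀ p p' q q', p + 1 = p' → q + 1 = q' → p + q = n → ∀ z : TensorOver R (E.X p) (X.X q),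
          χ' p' q (tensorMap (E.d p p') (𝟙 _) z) +
            p.negOnePow • χ' p q' (tensorMap (𝟙 _) (X.d q q') z) = χ p q z := by
  rw [acyclic_iff_ab]
  constructor
  · intro h n χ hχ
    obtain ⟨φ, hφ⟩ := exists_tensor_char (E := E) (X := X) n χ
    obtain ⟨φ', hφ'⟩ := characters_of_exact
      ((((tensorComplex R).obj E).obj X).d (n - 1) n).hom
      ((((tensorComplex R).obj E).obj X).d n (n + 1)).hom
      (h (n - 1) n (n + 1) (by lia) rfl) φ
      (DFunLike.congr_fun (f := φ.comp _) (g := 0) (tensor_hom_ext_ι fun p q hpq z => by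
        rw [AddMonoidHom.comp_apply, tensor_d_ι rfl rfl hpq (by lia), map_add, units_smul_apply,
          hφ, hφ, AddMonoidHom.zero_apply]
        exact hχ p _ q _ rfl rfl (by lia) z))
    refine ⟨fun p q => if h : p + q = n + 1 then φ'.comp (tensorι E X h) else 0,
      fun p p' q q' hp hq hn z => ?_⟩
    beta_reduce
    rw [dif_pos (show p' + q = n + 1 by lia), dif_pos (show p + q' = n + 1 by lia), ← hφ p q hn z, ← hφ' (tensorι E X hn z),
      tensor_d_ι hp hq hn rfl, map_add, units_smul_apply]
    rfl
  · intro h i j k hij hjk x hx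
    refine exact_of_characters _ ((((tensorComplex R).obj E).obj X).d j k).hom
      (fun φ hφ => ?_) hx
    obtain ⟨χ', hχ'⟩ := h j
      (fun p q => if h : p + q = j then φ.comp (tensorι E X h) else 0)
      (fun p p' q q' hp hq hn z => by
        have := hφ (tensorι E X (show p + q = i by lia) z)
        rw [tensor_d_ι hp hq _ hij, map_add, units_smul_apply] at this
        rw [dif_pos (show p' + q = j by lia), dif_pos (show p + q' = j by lia)]
        exact this)
    obtain ⟨φ', hφ'⟩ := exists_tensor_char (E := E) (X := X) k χ'
    refine ⟨φ', DFunLike.congr_fun (g := φ'.comp _) (tensor_hom_ext_ι fun p q hpq z => ?_)⟩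
    have := hχ' p _ q _ rfl rfl hpq z
    rw [dif_pos hpq] at this
    rw [AddMonoidHom.comp_apply, tensor_d_ι rfl rfl hpq hjk, map_add, units_smul_apply, hφ', hφ']
    exact this.symm

end TensorCharacters

/-! ### K-flat complexes -/

section KFlat

variable {R : Type u} [Ring R]
  {E : CochainComplex (ModuleCat.{u} Rᵐᵒᵖ) ℤ} {X : CochainComplex (ModuleCat.{u} R) ℤ}

lemma evR_units_smul {M : ModuleCat.{u} Rᵐᵒᵖ} {N : ModuleCat.{u} R} (v : ℤˣ) (g : N ⟶ dualR M)
    (n : N) (m : M) : evR ((v • g).hom n) m = v • evR (g.hom n) m := by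
  rw [hom_units_smul, units_smul_apply]
  rfl

lemma evL_units_smul {M : ModuleCat.{u} Rᵐᵒᵖ} {N : ModuleCat.{u} R} (v : ℤˣ) (g : M ⟶ dualL N)
    (m : M) (n : N) : evL ((v • g).hom m) n = v • evL (g.hom m) n := by
  rw [hom_units_smul, units_smul_apply]
  rfl

lemma evR_add {M : ModuleCat.{u} Rᵐᵒᵖ} {N : ModuleCat.{u} R} (f g : N ⟶ dualR M)
    (n : N) (m : M) : evR ((f + g).hom n) m = evR (f.hom n) m + evR (g.hom n) m := rfl

lemma evL_add {M : ModuleCat.{u} Rᵐᵒᵖ} {N : ModuleCat.{u} R} (f g : M ⟶ dualL N)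
    (m : M) (n : N) : evL ((f + g).hom m) n = evL (f.hom m) n + evL (g.hom m) n := rfl

/-- The complex of left modules `Hom_ℤ(E, ℚ/ℤ)`, shifted by `n`. -/
abbrev dualComplexR (n : ℤ) (E : CochainComplex (ModuleCat.{u} Rᵐᵒᵖ) ℤ) :
    CochainComplex (ModuleCat.{u} R) ℤ :=
  dualComplex (dualRFunctor R) (fun q => (n - q).negOnePow) n E

/-- The complex of right modules `Hom_ℤ(X, ℚ/ℤ)`, shifted by `n`. -/
abbrev dualComplexL (n : ℤ) (X : CochainComplex (ModuleCat.{u} R) ℤ) :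
    CochainComplex (ModuleCat.{u} Rᵐᵒᵖ) ℤ :=
  dualComplex (dualLFunctor R) (fun p => (p + 1).negOnePow) n X

lemma dualComplexR_cocycle_iff {n p p' q q' : ℤ} (hn : p' + q = n)
    (k : ∀ p q, X.X q ⟶ dualR (E.X p)) :
    X.d q q' ≫ k p q' = (n - q).negOnePow • k p' q ≫ dualRMap (E.d p p') ↔
      ∀ x m, evR ((k p q').hom ((X.d q q').hom x)) m =
        p'.negOnePow • evR ((k p' q).hom x) ((E.d p p').hom m) := by
  obtain rfl : p' = n - q := by lia
  have key := fun x m =>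
    evR_units_smul (n - q).negOnePow (k (n - q) q ≫ dualRMap (E.d p (n - q))) x m
  exact ⟨fun h x m => (congrArg (fun φ => evR (φ.hom x) m) h).trans (key x m),
    fun h => dualR_hom_ext fun x m => (h x m).trans (key x m).symm⟩

lemma dualComplexR_coboundary_iff {n p p' q q' q'' : ℤ} (hp : p + 1 = p') (hq : q + 1 = q')
    (hn : p + q' = n) (k t : ∀ p q, X.X q ⟶ dualR (E.X p)) :
    k p q' = X.d q' q'' ≫ t p q'' +
      (n - q).negOnePow • t p' q' ≫ dualRMap (E.d p p') ↔
      ∀ x m, evR ((k p q').hom x) m = evR ((t p q'').hom ((X.d q' q'').hom x)) m +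
        p'.negOnePow • evR ((t p' q').hom x) ((E.d p p').hom m) := by
  obtain rfl : p' = n - q := by lia
  have key := fun x m => (evR_add (X.d q' q'' ≫ t p q'')
    ((n - q).negOnePow • t (n - q) q' ≫ dualRMap (E.d p (n - q))) x m).trans
    (congrArg (_ + ·) (evR_units_smul (n - q).negOnePow
      (t (n - q) q' ≫ dualRMap (E.d p (n - q))) x m))
  exact ⟨fun h x m => (congrArg (fun φ => evR (φ.hom x) m) h).trans (key x m),
    fun h => dualR_hom_ext fun x m => (h x m).trans (key x m).symm⟩

/-- Characters of the degree `n` part of `E ⊗_R X` are families of maps from `X.X q` to the dual of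
`E.X p` with `p + q = n`. With the sign chosen in `dualComplexR`, cocycles correspond as they stand,
and coboundaries correspond after twisting by the sign of `p`. -/
lemma tensorComplex_acyclic_iff_dualComplexR :
    (((tensorComplex R).obj E).obj X).Acyclic ↔
      ∀ (n : ℤ) (f : (HomotopyCategory.quotient _ (ComplexShape.up ℤ)).obj X ⟶
        (HomotopyCategory.quotient _ _).obj (dualComplexR n E)), f = 0 := by
  rw [tensorComplex_acyclic_iff]
  constructor
  · intro h n
    refine dualComplex_hom_eq_zero fun k hk => ?_
    obtain ⟨χ, hχ⟩ := h n (fun p q => tensorCharR (k p q)) (by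
      intro p p' q q' hp hq hn
      refine DFunLike.congr_fun (f := (tensorCharR (k p' q)).comp (tensorMap (E.d p p') (𝟙 _)) +
        p.negOnePow • (tensorCharR (k p q')).comp (tensorMap (𝟙 _) (X.d q q'))) (g := 0)
        (tensor_char_ext fun m x => ?_)
      have := (dualComplexR_cocycle_iff hn k).1 (hk p p' q q' hp hq hn) x m
      rw [← hp, Int.negOnePow_succ, hp] at this
      refine (congrArg (evR ((k p' q).hom x) ((E.d p p').hom m) + p.negOnePow • ·) this).trans ?_
      rw [smul_smul, mul_neg, Int.units_mul_self, Units.neg_smul, one_smul]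
      exact add_neg_cancel _)
    refine ⟨fun p q => p.negOnePow • homOfTensorCharR (χ p q), ?_⟩
    intro p p' q q' q'' hp hq hq' hn
    refine (dualComplexR_coboundary_iff hp hq hn k
      (fun p q => p.negOnePow • homOfTensorCharR (χ p q))).2 fun x m => ?_
    rw [evR_units_smul, evR_units_smul, smul_smul, Int.units_mul_self, one_smul, add_comm]
    exact (hχ p p' q' q'' hp hq' hn (QuotientAddGroup.mk (TensorProduct.tmul ℤ m x))).symm
  · intro h n χ hχ
    obtain ⟨t, ht⟩ := exists_of_dualComplex_hom_eq_zero (h n)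
      (fun p q => homOfTensorCharR (χ p q)) (by
        intro p p' q q' hp hq hn
        refine (dualComplexR_cocycle_iff hn (fun p q => homOfTensorCharR (χ p q))).2
          fun x m => ?_
        have := hχ p p' q q' hp hq hn (QuotientAddGroup.mk (TensorProduct.tmul ℤ m x))
        rw [add_eq_zero_iff_eq_neg] at this
        refine Eq.trans ?_ (congrArg (p'.negOnePow • ·) this.symm)
        rw [← hp, Int.negOnePow_succ, Units.neg_smul, smul_neg, neg_neg, smul_smul,
          Int.units_mul_self, one_smul]
        rfl)
    refine ⟨fun p q => tensorCharR (p.negOnePow • t p q), fun p p' q q' hp hq hn => ?_⟩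
    refine DFunLike.congr_fun (f := (tensorCharR (p'.negOnePow • t p' q)).comp
      (tensorMap (E.d p p') (𝟙 _)) + p.negOnePow • (tensorCharR (p.negOnePow • t p q')).comp
        (tensorMap (𝟙 _) (X.d q q'))) (tensor_char_ext fun m x => ?_)
    have := (dualComplexR_coboundary_iff hp (sub_add_cancel q 1) hn
      (fun p q => homOfTensorCharR (χ p q)) t).1 (ht p p' (q - 1) q q' hp (by lia) hq hn) x m
    refine Eq.trans ?_ this.symm
    rw [add_comm]
    refine congrArg₂ (· + ·) ?_ (evR_units_smul p'.negOnePow (t p' q) x ((E.d p p').hom m))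
    refine (congrArg (p.negOnePow • ·)
      (evR_units_smul p.negOnePow (t p q') ((X.d q q').hom x) m)).trans ?_
    rw [smul_smul, Int.units_mul_self, one_smul]

/-- The same adjunction read on the other side, with the roles of `p` and `q` exchanged. The sign in
`dualComplexL` is such that no twist is needed. -/
lemma dualComplexL_hom_eq_zero (h : (((tensorComplex R).obj E).obj X).Acyclic) (n : ℤ)
    (f : (HomotopyCategory.quotient _ (ComplexShape.up ℤ)).obj E ⟶
      (HomotopyCategory.quotient _ _).obj (dualComplexL n X)) : f = 0 := by
  rw [tensorComplex_acyclic_iff] at h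
  revert f
  refine dualComplex_hom_eq_zero fun (k : ∀ p q, E.X q ⟶ dualL (X.X p)) hk => ?_
  obtain ⟨χ, hχ⟩ := h n (fun p q => tensorCharL (k q p)) (by
    intro p p' q q' hp hq hn
    refine DFunLike.congr_fun (f := (tensorCharL (k q p')).comp (tensorMap (E.d p p') (𝟙 _)) +
      p.negOnePow • (tensorCharL (k q' p)).comp (tensorMap (𝟙 _) (X.d q q'))) (g := 0)
      (tensor_char_ext fun m x => ?_)
    have := (congrArg (fun φ => evL (φ.hom m) x) (hk q q' p p' hq hp (by lia))).trans
      (evL_units_smul (p + 1).negOnePow (k q' p ≫ dualLMap (X.d q q')) m x)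
    refine (congrArg (· + p.negOnePow • evL ((k q' p).hom m) ((X.d q q').hom x)) this).trans ?_
    rw [Int.negOnePow_succ, Units.neg_smul]
    exact neg_add_cancel _)
  refine ⟨fun p q => homOfTensorCharL (χ q p), ?_⟩
  intro p p' q q' q'' hp hq hq' hn
  refine dualL_hom_ext fun m x => ?_
  refine (hχ q' q'' p p' hq' hp (by lia)
    (QuotientAddGroup.mk (TensorProduct.tmul ℤ m x))).symm.trans ?_
  refine Eq.trans ?_ ((evL_add (E.d q' q'' ≫ homOfTensorCharL (χ q'' p))
    ((q + 1).negOnePow • homOfTensorCharL (χ q' p') ≫ dualLMap (X.d p p')) m x).trans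
    (congrArg (_ + ·) (evL_units_smul (q + 1).negOnePow
      (homOfTensorCharL (χ q' p') ≫ dualLMap (X.d p p')) m x))).symm
  rw [hq]
  rfl

/-- K-flatness becomes left orthogonality to the duals of acyclic complexes. This makes it invariant
under isomorphism in K(R) and stable under extensions. -/
lemma kFlat_iff (X : K R) :
    kFlat R X ↔ ∀ (E : CochainComplex (ModuleCat.{u} Rᵐᵒᵖ) ℤ), E.Acyclic →
      ∀ (n : ℤ) (f : X ⟶ (HomotopyCategory.quotient _ _).obj (dualComplexR n E)), f = 0 :=
  forall_congr' fun _ => forall_congr' fun _ => tensorComplex_acyclic_iff_dualComplexR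

instance : (kFlat R).IsClosedUnderIsomorphisms where
  of_iso e h := by
    rw [kFlat_iff] at h ⊢
    intro E hE n f
    rw [← cancel_epi e.hom, h E hE n (e.hom ≫ f), comp_zero]

/-- The duals of acyclic complexes are acyclic, because ℚ/ℤ is injective. -/
lemma leftOrthogonal_le_kFlat :
    (HomotopyCategory.subcategoryAcyclic (ModuleCat.{u} R)).leftOrthogonal ≤ kFlat R := by
  intro X hX
  rw [kFlat_iff]
  intro E hE n f
  refine hX f ?_
  rw [HomotopyCategory.quotient_obj_mem_subcategoryAcyclic_iff_acyclic]
  exact acyclic_dualComplexR hE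

lemma bidual_units_smul_comp {M M' : ModuleCat.{u} Rᵐᵒᵖ} (v : ℤˣ) (e : M ⟶ M') :
    dualRMap (dualLMap (v • dualRMap e)) ≫ dualRMap (unitR M) =
      dualRMap (unitR M') ≫ (v • dualRMap e) := by
  obtain rfl | rfl := Int.units_eq_one_or v
  · rw [one_smul]; rfl
  · rw [Units.neg_smul, one_smul, Preadditive.comp_neg]
    refine (congrArg (· ≫ dualRMap (unitR M)) ((bidual R).map_neg (f := dualRMap e))).trans ?_
    exact Preadditive.neg_comp _ _

/-- A dual complex is a retract of its bidual, through the dual of the evaluation map, so it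
receives no nonzero map from a pure acyclic complex. -/
lemma pureAcyclic_le_kFlat : pureAcyclic R ≤ kFlat R := by
  intro X hX
  rw [kFlat_iff]
  intro E hE n f
  exact hom_eq_zero_of_bidual_retract (X := X.as) hX (fun i => dualRMap (unitR _)) (fun i => rfl)
    (fun i j => bidual_units_smul_comp _ _) f

lemma extensionProduct_le_kFlat :
    (HomotopyCategory.subcategoryAcyclic (ModuleCat.{u} R)).leftOrthogonal.extensionProduct
      (pureAcyclic R) ≤ kFlat R := by
  rintro X ⟨L, P, f, g, h, hT, hL, hP⟩
  rw [kFlat_iff]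
  intro E hE n φ
  obtain ⟨ψ, rfl⟩ := yoneda_exact₂ hT φ ((kFlat_iff L).1 (leftOrthogonal_le_kFlat _ hL) E hE n _)
  rw [(kFlat_iff P).1 (pureAcyclic_le_kFlat _ hP) E hE n ψ, comp_zero]

/-- Acyclic K-flat complexes are pure acyclic. -/
lemma IsKFlat.isPureAcyclic (hX : IsKFlat R X) (hX' : X.Acyclic) : IsPureAcyclic R X := by
  refine isPureAcyclic_iff.2 fun M i j k hij hjk x hx => ?_
  -- The degrees are rewritten so that the dual of `X.X j` is definitionally the degree `0`
  -- component of `dualComplexL n X`, where the stalk of `M` sits.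
  obtain ⟨n, rfl⟩ : ∃ n, j = n - 0 := ⟨j, (sub_zero j).symm⟩
  obtain rfl : i = n - 1 := by lia
  obtain rfl : k = n - -1 := by lia
  -- A K-projective resolution of `M` has no nonzero map to the acyclic dual of `X`, so `f` factors
  -- through the acyclic cone `B`; K-flatness of `X` kills maps from `B`.
  have key : ∀ f : stalk 0 M ⟶ (HomotopyCategory.quotient _ _).obj (dualComplexL n X), f = 0 := by
    intro f
    obtain ⟨L, B, a, b, c, hT, hL, hB⟩ := decomposes_leftOrthogonal_acyclic (stalk 0 M)
    obtain ⟨B, rfl⟩ := HomotopyCategory.quotient_obj_surjective B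
    rw [HomotopyCategory.quotient_obj_mem_subcategoryAcyclic_iff_acyclic] at hB
    obtain ⟨g, rfl⟩ := yoneda_exact₂ hT f (hL _ (by
      rw [HomotopyCategory.quotient_obj_mem_subcategoryAcyclic_iff_acyclic]
      exact acyclic_dualComplexL hX'))
    exact (congrArg (b ≫ ·) (dualComplexL_hom_eq_zero (hX B hB) n g)).trans comp_zero
  refine exact_of_characters _ (tensorMap (𝟙 M) (X.d (n - 0) (n - -1))) (fun χ hχ => ?_) hx
  obtain ⟨g : M ⟶ dualL (X.X (n - -1)), hg⟩ := (stalk_hom_eq_zero_iff M _ 0).1 key (-1) 1 rfl rfl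
    (homOfTensorCharL χ) (dualL_hom_ext fun m y =>
      (evL_units_smul (0 + 1 : ℤ).negOnePow (homOfTensorCharL χ ≫ dualLMap (X.d (n - 1) (n - 0)))
        m y).trans ((congrArg ((0 + 1 : ℤ).negOnePow • ·)
          (hχ (QuotientAddGroup.mk (TensorProduct.tmul ℤ m y)))).trans (smul_zero _)))
  refine ⟨tensorCharL g, DFunLike.congr_fun (g := (tensorCharL g).comp _)
    (tensor_char_ext fun m y => ?_)⟩
  refine (congrArg (fun φ => evL (φ.hom m) y) hg.symm).trans
    ((evL_units_smul (-1 + 1 : ℤ).negOnePow (g ≫ dualLMap (X.d (n - 0) (n - -1))) m y).trans ?_)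
  rw [show (-1 + 1 : ℤ) = 0 from rfl, Int.negOnePow_zero, one_smul]
  rfl

lemma kFlat_inf_acyclic_le :
    kFlat R ⊓ HomotopyCategory.subcategoryAcyclic (ModuleCat.{u} R) ≤ pureAcyclic R := by
  rintro X ⟨hX, hX'⟩
  obtain ⟨X, rfl⟩ := HomotopyCategory.quotient_obj_surjective X
  rw [HomotopyCategory.quotient_obj_mem_subcategoryAcyclic_iff_acyclic] at hX'
  exact IsKFlat.isPureAcyclic hX hX'

/-- There are no nonzero morphisms from a K-flat complex to an acyclic complex of pure-injective
modules. -/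
lemma kAcPI_le_rightOrthogonal : kAcPI R ≤ (kFlat R).rightOrthogonal := by
  rintro Y ⟨hY, hY'⟩ W f hW
  obtain ⟨L, B, a, b, c, hT, hL, hB⟩ := decomposes_leftOrthogonal_acyclic W
  -- The cone of a K-projective resolution of a K-flat complex is K-flat and acyclic, hence pure
  -- acyclic, hence has no nonzero map to `Y`.
  have hB' : kFlat R B := prop_of_distTriang₃ (kFlat R) hT (leftOrthogonal_le_kFlat _ hL) hW
  obtain ⟨g, rfl⟩ := yoneda_exact₂ hT f (hL _ hY')
  rw [kPI_le_rightOrthogonal Y hY g (kFlat_inf_acyclic_le B ⟨hB', hB⟩), comp_zero]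

end KFlat

/-! ### Compact generation -/

section

variable {C : Type*} [Category.{u} C] [HasZeroObject C] [HasShift C ℤ] [Preadditive C]
  [∀ n : ℤ, (shiftFunctor C n).Additive] [Pretriangulated C] [IsTriangulated C]
  {T : Type*} [Category* T] [HasZeroObject T] [HasShift T ℤ] [Preadditive T]
  [∀ n : ℤ, (shiftFunctor T n).Additive] [Pretriangulated T] [IsTriangulated T]

lemma hom_eq_zero_of_shift {G Z : C} (h : ∀ (n : ℤ) (f : G ⟶ Z⟦n⟧), f = 0) (f : G ⟶ Z) : f = 0 := by
  rw [← cancel_mono ((shiftFunctorZero C ℤ).inv.app Z), h 0 (f ≫ _), zero_comp]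

/-- The quotient by the right orthogonal of a set of compact objects is compactly generated. -/
lemma isCompactlyGenerated_of_detecting [HasCoproducts.{u} C] {N Y : ObjectProperty C}
    [N.IsTriangulated] (hN : Decomposes N Y) (hY : Y ≤ N.rightOrthogonal)
    (Q : C ⥤ T) [Q.IsLocalization N.trW] [Q.Additive] [Q.CommShift ℤ]
    {ι : Type u} (G : ι → C) (hG : ∀ a, IsFinitary.{u} (G a))
    (h : ∀ Z, N Z ↔ ∀ a (f : G a ⟶ Z), f = 0) : IsCompactlyGenerated.{u} T := by
  refine isCompactlyGenerated_localization hN hY Q ⊤ (fun _ _ _ => trivial) le_top G hG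
    (fun a c _ => ?_) (fun Z hZ hZ' => ?_)
  · exact (ObjectProperty.leftOrthogonal.map_bijective_of_isTriangulated
      (fun _ f hZ => (h _).1 hZ a f) Q c).2
  · have : N Z := (h Z).2 fun a => hom_eq_zero_of_shift (hZ' a)
    exact (IsZero.iff_id_eq_zero Z).2 (hY _ hZ _ this)

end

variable (R : Type u) [Ring R]

lemma isCompactlyGenerated_derivedCategory [HasDerivedCategory.{w} (ModuleCat.{u} R)] :
    IsCompactlyGenerated.{u} (DerivedCategory (ModuleCat.{u} R)) :=
  isCompactlyGenerated_of_detecting decomposes_acyclic_rightOrthogonal le_rfl DerivedCategory.Qh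
    (fun j : ULift.{u} ℤ => stalk j.down (ModuleCat.of R R))
    (fun j => isFinitary_stalk j.down (ModuleCat.of R R)) acyclic_iff_stalk

lemma pureAcyclic_iff' (X : K R) :
    pureAcyclic R X ↔ ∀ (a : FpIndex R × ℤ) (f : stalk a.2 (fpModule a.1) ⟶ X), f = 0 :=
  (pureAcyclic_iff X).trans ⟨fun h a => h a.1 a.2, fun h a j => h ⟨a, j⟩⟩

lemma isCompactlyGenerated_dPur : IsCompactlyGenerated.{u} (DPur R) :=
  isCompactlyGenerated_of_detecting decomposes_pureAcyclic_kPI kPI_le_rightOrthogonal (QPur R)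
    (fun a : FpIndex R × ℤ => stalk a.2 (fpModule a.1))
    (fun a => isFinitary_stalk a.2 (fpModule a.1)) (pureAcyclic_iff' R)

lemma decomposes_kFlat_kAcPI : Decomposes (kFlat R) (kAcPI R) :=
  decomposes_leftOrthogonal_acyclic.inf decomposes_pureAcyclic_kPI pureAcyclic_le_acyclic
    extensionProduct_le_kFlat

/-- Every object of the quotient is represented by a complex in K_ac(PI), so fullness on acyclic
targets suffices for the finitely presented stalks to be compact. An object of K_ac(PI) orthogonal
to all of them is pure acyclic, hence zero. -/
lemma isCompactlyGenerated_dKFlat : IsCompactlyGenerated.{u} (DKFlat R) := by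
  refine isCompactlyGenerated_localization (decomposes_kFlat_kAcPI R) kAcPI_le_rightOrthogonal
    (QKFlat R) (HomotopyCategory.subcategoryAcyclic (ModuleCat.{u} R)) (fun J x hx => ?_)
    inf_le_right (fun a : FpIndex R × ℤ => stalk a.2 (fpModule a.1))
    (fun a => isFinitary_stalk a.2 (fpModule a.1)) (fun a c hc f => ?_) (fun Z hZ hZ' => ?_)
  · refine (acyclic_iff_stalk _).2 fun j f => ?_
    obtain ⟨s, g, rfl⟩ := isFinitary_stalk j.down (ModuleCat.of R R) J x f
    refine Finset.sum_eq_zero fun k _ => ?_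
    rw [(acyclic_iff_stalk _).1 (hx k) j (g k), zero_comp]
  -- For acyclic `c` the resolution `I` lies in K_ac(PI), so maps to it in the quotient come from
  -- K(R). They lift to `c` because finitely presented stalks have no nonzero map to `P⟦1⟧`.
  · obtain ⟨P, I, p, q, r, hT, hP, hI⟩ := decomposes_pureAcyclic_kPI c
    have hI' : kAcPI R I := ⟨hI, prop_of_distTriang₃ _ hT (pureAcyclic_le_acyclic _ hP) hc⟩
    have : IsIso ((QKFlat R).map q) :=
      isIso_map_of_trW (P := kFlat R) (QKFlat R) 
        (ObjectProperty.trW.mk' _ hT (pureAcyclic_le_kFlat _ hP))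
    obtain ⟨g, hg⟩ := (ObjectProperty.rightOrthogonal.map_bijective_of_isTriangulated
      (kAcPI_le_rightOrthogonal _ hI') (QKFlat R) _).2 (f ≫ (QKFlat R).map q)
    obtain ⟨g', rfl⟩ := coyoneda_exact₃ hT g
      ((pureAcyclic_iff' R _).1 ((pureAcyclic R).le_shift 1 _ hP) a _)
    refine ⟨g', ?_⟩
    rw [← cancel_mono ((QKFlat R).map q), ← hg, Functor.map_comp]
  · exact isZero_of_kPI_of_pureAcyclic hZ.1
      ((pureAcyclic_iff' R Z).2 fun a => hom_eq_zero_of_shift (hZ' a))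

/-! ### The recollement -/

variable [HasDerivedCategory.{w} (ModuleCat.{u} R)]

lemma isRecollement_kPI : IsRecollement (inclAcPI R)
    ((kPI R).ι ⋙ (DerivedCategory.Qh (C := ModuleCat.{u} R))) :=
  isRecollement_lift DerivedCategory.Qh decomposes_leftOrthogonal_acyclic
    decomposes_acyclic_rightOrthogonal decomposes_pureAcyclic_kPI kPI_le_rightOrthogonal
    pureAcyclic_le_acyclic extensionProduct_le_kFlat kAcPI_le_rightOrthogonal

lemma exists_canonical :
    ∃ (j : DPur R ⥤ DerivedCategory (ModuleCat.{u} R)) (_ : j.CommShift ℤ),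
      j.IsTriangulated ∧
        ∃ e : QPur R ⋙ j ≅ DerivedCategory.Qh, NatTrans.CommShift e.hom ℤ := by
  have hj : (pureAcyclic R).trW.IsInvertedBy (DerivedCategory.Qh (C := ModuleCat.{u} R)) :=
    fun _ _ f hf => isIso_map_of_trW
      (P := HomotopyCategory.subcategoryAcyclic (ModuleCat.{u} R)) _
      (ObjectProperty.trW_monotone pureAcyclic_le_acyclic _ hf)
  let j := Localization.lift _ hj (QPur R)
  let _ : Localization.Lifting (QPur R) (pureAcyclic R).trW
    (DerivedCategory.Qh (C := ModuleCat.{u} R)) j := ⟨Localization.fac _ hj (QPur R)⟩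
  let _ : j.CommShift ℤ := Functor.commShiftOfLocalization (QPur R) (pureAcyclic R).trW ℤ
    (DerivedCategory.Qh (C := ModuleCat.{u} R)) j
  have he : NatTrans.CommShift (Localization.fac _ hj (QPur R)).hom ℤ :=
    NatTrans.commShift_iso_hom_of_localization (QPur R) (pureAcyclic R).trW ℤ
    (DerivedCategory.Qh (C := ModuleCat.{u} R)) j
  have := Localization.essSurj_mapArrow (QPur R) (pureAcyclic R).trW
  exact ⟨j, inferInstance, Functor.isTriangulated_of_precomp_iso (Localization.fac _ hj (QPur R)),
    Localization.fac _ hj (QPur R), he⟩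

end KFlatDer

end

theorem mainTheorem2 (R : Type u) [Ring R] [HasDerivedCategory.{w} (ModuleCat.{u} R)] :
    KFlatDer.IsCompactlyGenerated.{u} (KFlatDer.DKFlat R) ∧
    KFlatDer.IsCompactlyGenerated.{u} (KFlatDer.DPur R) ∧
    KFlatDer.IsCompactlyGenerated.{u} (DerivedCategory (ModuleCat.{u} R)) ∧
    ∃ (i : KFlatDer.DKFlat R ⥤ KFlatDer.DPur R) (_ : i.CommShift ℤ)
      (j : KFlatDer.DPur R ⥤ DerivedCategory (ModuleCat.{u} R)) (_ : j.CommShift ℤ),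
      KFlatDer.IsRecollement i j ∧
      (∃ e : KFlatDer.QPur R ⋙ j ≅ DerivedCategory.Qh, NatTrans.CommShift e.hom ℤ) ∧
      ((KFlatDer.kAcPI R).ι ⋙ KFlatDer.QKFlat R).IsEquivalence ∧
      ((KFlatDer.kPI R).ι ⋙ KFlatDer.QPur R).IsEquivalence ∧
      (∃ e : ((KFlatDer.kAcPI R).ι ⋙ KFlatDer.QKFlat R) ⋙ i ≅
          KFlatDer.inclAcPI R ⋙ (KFlatDer.kPI R).ι ⋙ KFlatDer.QPur R,
        NatTrans.CommShift e.hom ℤ) ∧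
      KFlatDer.IsRecollement (KFlatDer.inclAcPI R)
        ((KFlatDer.kPI R).ι ⋙ (DerivedCategory.Qh (C := ModuleCat.{u} R))) := by
  refine ⟨KFlatDer.isCompactlyGenerated_dKFlat R, KFlatDer.isCompactlyGenerated_dPur R,
    KFlatDer.isCompactlyGenerated_derivedCategory R, ?_⟩
  have h₁ : ((KFlatDer.kAcPI R).ι ⋙ KFlatDer.QKFlat R).IsEquivalence :=
    KFlatDer.isEquivalence_ι_comp _ (KFlatDer.decomposes_kFlat_kAcPI R)
      KFlatDer.kAcPI_le_rightOrthogonal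
  have h₂ : ((KFlatDer.kPI R).ι ⋙ KFlatDer.QPur R).IsEquivalence :=
    KFlatDer.isEquivalence_ι_comp _ KFlatDer.decomposes_pureAcyclic_kPI
      KFlatDer.kPI_le_rightOrthogonal
  have h₃ := KFlatDer.isRecollement_kPI R
  obtain ⟨j, _, _, e, he⟩ := KFlatDer.exists_canonical R
  obtain ⟨i, _, hi, e'⟩ := h₃.exists_of_equivalence ((KFlatDer.kAcPI R).ι ⋙ KFlatDer.QKFlat R)
    ((KFlatDer.kPI R).ι ⋙ KFlatDer.QPur R) j (Functor.isoWhiskerLeft (KFlatDer.kPI R).ι e)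
  exact ⟨i, inferInstance, j, inferInstance, hi, ⟨e, he⟩, h₁, h₂, e', h₃⟩
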